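/- Let $m\ge 1$ and $n\ge 0$ be integers. Spaces. Let $D(n,m)$ be the space of $(m+1)$-tuples $(d_0,\dots,d_m)$ of positive divisors of degree $n$ on $\mathbb C$, each invariant under complex conjugation, such that no point of the real axis lies in the supports of all the $d_j$; it is a subspace of the $(m+1)$-st power of the symmetric product $\mathbb C^{(n)}$. Let $\Omega\mathbb{RP}^m$ be the space, with the compact-open topology, of continuous maps $\mathbb{RP}^1=\mathbb R\cup\{\infty\}\to\mathbb{RP}^m$ that send $\infty$ to $[1:\dots:1]$. Let $\mathrm{Rat}_n(\mathbb{RP}^m)$ be the closure in $\Omega\mathbb{RP}^m$ of the set of all maps $[p_0:\dots:p_m]$ with monic real polynomials $p_j$ of degree $n$ without a common complex root. Let $S(n,m)$ be the space of $(m+1)$-tuples of positive divisors of degree $n$ on $\mathbb R$ whose supports have empty common intersection, a subspace of $(\mathbb R^{(n)})^{m+1}$, and let $T(n,m)$ (mod 2 particles on $\mathbb R$) be the quotient space of $S(n,m)$ that identifies two tuples if for every $j$ and every $x\in\mathbb R$ the multiplicities of $x$ in their $j$-th divisors are congruent modulo $2$. Maps. $P:D(n,m)\to\mathrm{Rat}_n(\mathbb{RP}^m)$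 sends $(d_j)$ to the loop $[p_0:\dots:p_m]$, where $p_j$ is the monic polynomial with divisor of zeros $d_j$. $Q:\mathrm{Rat}_n(\mathbb{RP}^m)\to T(n,m)$ is the unique map such that $Q\circ P$ sends $(d_j)$ to the tuple of the real parts of the $d_j$ with multiplicities reduced modulo $2$. Stabilization. Fix $z\in\mathbb C$ with $\operatorname{Im} z\ne 0$. The map $D(n,m)\to D(n+2,m)$ that adds $z+\bar z$ to every divisor, the inclusion $\mathrm{Rat}_n(\mathbb{RP}^m)\subset\mathrm{Rat}_{n+2}(\mathbb{RP}^m)$ in $\Omega\mathbb{RP}^m$, and the canonical map $T(n,m)\to T(n+2,m)$ that keeps all multiplicities modulo $2$ commute with $P$ and $Q$. For each of the three families let the space with index $n=\infty$ be the disjoint union of the direct limit over even $n$ and the direct limit over odd $n$ of the corresponding sequence; $P$ and $Q$ induce maps of these spaces. Claim. The maps $$D(n,m)\xrightarrow{\;P\;}\mathrm{Rat}_n(\mathbb{RP}^m)\xrightarrow{\;Q\;}T(n,m)$$ are homotopy equivalences for all $m\ge 1$ and all $n\ge 0$, including $n=\infty$ (for every choice of $z$). -/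

import Mathlib

namespace RationalLoops

open Topology

/-! ## Homotopy equivalences and sequential direct limits -/

/-- A function between topological spaces is a homotopy equivalence if it is (continuous and)
the forward map of a homotopy equivalence. -/
def IsHomotopyEquiv {X Y : Type} [TopologicalSpace X] [TopologicalSpace Y] (f : X → Y) : Prop :=
  ∃ e : ContinuousMap.HomotopyEquiv X Y, (e.toFun : X → Y) = f

/-- The direct limit of a sequence `X 0 → X 1 → X 2 → ⋯`: the disjoint union of the `X k` modulo
the equivalence relation generated by `x ∼ ι k x`. -/
def SeqLim (X : ℕ → Type) (ι : ∀ k, X k → X (k + 1)) : Type :=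
  Quot fun a b : (Σ k, X k) => b = ⟨a.1 + 1, ι a.1 a.2⟩

/-- The direct limit topology. -/
instance (X : ℕ → Type) (ι : ∀ k, X k → X (k + 1)) [∀ k, TopologicalSpace (X k)] :
    TopologicalSpace (SeqLim X ι) :=
  inferInstanceAs (TopologicalSpace (Quot _))

/-- The map of direct limits induced by a map of sequences. -/
def SeqLim.map {X Y : ℕ → Type} {ι : ∀ k, X k → X (k + 1)} {κ : ∀ k, Y k → Y (k + 1)}
    (f : ∀ k, X k → Y k) (h : ∀ k x, f (k + 1) (ι k x) = κ k (f k x)) :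
    SeqLim X ι → SeqLim Y κ :=
  Quot.map (fun a => ⟨a.1, f a.1 a.2⟩) (by
    rintro ⟨k, x⟩ b rfl
    simp [h])

/-- For spaces `X n` with stabilization maps `ι n : X n → X (n + 2)`, the space `X ∞`: the disjoint
union of the direct limit of `X 0 → X 2 → X 4 → ⋯` and the direct limit of
`X 1 → X 3 → X 5 → ⋯`. -/
def Stable (X : ℕ → Type) (ι : ∀ n, X n → X (n + 2)) : Type :=
  SeqLim (fun k => X (2 * k)) (fun k => ι (2 * k)) ⊕
    SeqLim (fun k => X (2 * k + 1)) (fun k => ι (2 * k + 1))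

instance (X : ℕ → Type) (ι : ∀ n, X n → X (n + 2)) [∀ k, TopologicalSpace (X k)] :
    TopologicalSpace (Stable X ι) :=
  inferInstanceAs (TopologicalSpace (_ ⊕ _))

/-- The map `X ∞ → Y ∞` induced by maps `X n → Y n` that commute with the stabilizations. -/
def Stable.map {X Y : ℕ → Type} {ι : ∀ n, X n → X (n + 2)} {κ : ∀ n, Y n → Y (n + 2)}
    (f : ∀ n, X n → Y n) (h : ∀ n x, f (n + 2) (ι n x) = κ n (f n x)) :
    Stable X ι → Stable Y κ :=
  Sum.map (SeqLim.map (fun k => f (2 * k)) fun k => h (2 * k))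
    (SeqLim.map (fun k => f (2 * k + 1)) fun k => h (2 * k + 1))

/-! ## Symmetric products and divisors -/

/-- The `n`-fold symmetric product `Sym X n` carries the quotient topology of `X ^ n`. -/
instance (X : Type) [TopologicalSpace X] (n : ℕ) : TopologicalSpace (Sym X n) :=
  TopologicalSpace.coinduced
    (fun x : Fin n → X => (⟨Multiset.ofList (List.ofFn x), by simp⟩ : Sym X n)) inferInstance

/-- A positive divisor on `ℂ` is real if it is invariant under complex conjugation. -/
def IsRealDivisor (s : Multiset ℂ) : Prop := s.map (starRingEnd ℂ) = s

/-- `D n m`: the space of `(m + 1)`-tuples of real positive divisors of degree `n` on `ℂ` such that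
the intersection of the supports of all the `m + 1` divisors is disjoint from the real axis. -/
def D (n m : ℕ) : Type :=
  {d : Fin (m + 1) → Sym ℂ n //
    (∀ j, IsRealDivisor (d j)) ∧ ∀ x : ℝ, ∃ j, (x : ℂ) ∉ (d j : Multiset ℂ)}

instance (n m : ℕ) : TopologicalSpace (D n m) := inferInstanceAs (TopologicalSpace (Subtype _))

/-- The stabilization `D n m → D (n + 2) m` that adds `z + conj z` to every divisor, for a fixed
non-real `z`. -/
def stabD (m : ℕ) (z : ℂ) (hz : z.im ≠ 0) (n : ℕ) (d : D n m) : D (n + 2) m :=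
  ⟨fun j => z ::ₛ (starRingEnd ℂ z) ::ₛ d.1 j, by
    constructor
    · intro j
      have h : Multiset.map (starRingEnd ℂ) (d.1 j : Multiset ℂ) = d.1 j := d.2.1 j
      simp [IsRealDivisor, Sym.coe_cons, h, Multiset.cons_swap]
    · intro x
      obtain ⟨j, hj⟩ := d.2.2 x
      refine ⟨j, ?_⟩
      simp only [Sym.coe_cons, Multiset.mem_cons, not_or]
      refine ⟨?_, ?_, hj⟩
      · rintro rfl
        simp at hz
      · intro h
        have := congrArg Complex.im h
        simp at this
        exact hz this⟩

/-! ## Real projective spaces and loops -/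

/-- The real projective space of dimension `m`. -/
def RP (m : ℕ) : Type := Projectivization ℝ (Fin (m + 1) → ℝ)

/-- The point with homogeneous coordinates `v`. -/
noncomputable def RP.mk {m : ℕ} (v : {v : Fin (m + 1) → ℝ // v ≠ 0}) : RP m := Projectivization.mk' ℝ v

/-- The quotient topology. -/
noncomputable instance (m : ℕ) : TopologicalSpace (RP m) :=
  TopologicalSpace.coinduced RP.mk inferInstance

theorem RP.mk_eq_iff {m : ℕ} (v w : {v : Fin (m + 1) → ℝ // v ≠ 0}) :
    RP.mk v = RP.mk w ↔ ∃ a : ℝ, a • w.1 = v.1 :=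
  Projectivization.mk_eq_mk_iff' ℝ v.1 w.1 v.2 w.2

theorem RP.mk_surjective {m : ℕ} : Function.Surjective (RP.mk (m := m)) :=
  Projectivization.ind fun v hv => ⟨⟨v, hv⟩, rfl⟩

theorem RP.isOpenQuotientMap_mk {m : ℕ} : IsOpenQuotientMap (RP.mk (m := m)) := by
  refine IsOpenQuotientMap.of_isOpenMap_isQuotientMap ?_ ⟨⟨rfl⟩, RP.mk_surjective⟩
  intro U hU
  change IsOpen (RP.mk ⁻¹' (RP.mk '' U))
  have h : RP.mk ⁻¹' (RP.mk '' U) = ⋃ a : ℝˣ,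
      (fun v : {v : Fin (m + 1) → ℝ // v ≠ 0} =>
        (⟨(a : ℝ) • v.1, smul_ne_zero a.ne_zero v.2⟩ : {v : Fin (m + 1) → ℝ // v ≠ 0})) ⁻¹' U := by
    ext v
    simp only [Set.mem_preimage, Set.mem_image, Set.mem_iUnion]
    constructor
    · rintro ⟨w, hw, h⟩
      obtain ⟨a, ha⟩ := (RP.mk_eq_iff _ _).1 h
      have ha0 : a ≠ 0 := by
        rintro rfl
        exact w.2 (by simpa using ha.symm)
      refine ⟨Units.mk0 a ha0, ?_⟩
      convert hw using 1
      exact Subtype.ext ha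
    · rintro ⟨a, ha⟩
      exact ⟨_, ha, (RP.mk_eq_iff _ _).2 ⟨a, rfl⟩⟩
  rw [h]
  refine isOpen_iUnion fun a => hU.preimage ?_
  fun_prop

/-- The point `∞ = [1 : 0]` of the projective line, whose affine coordinate is `[x : 1] ↦ x`. -/
noncomputable def infty : RP 1 := RP.mk ⟨![1, 0], fun h => by simpa using congrFun h 0⟩

/-- The base point `[1 : 1 : ⋯ : 1]`. -/
noncomputable def basePt (m : ℕ) : RP m := RP.mk ⟨fun _ => 1, fun h => by simpa using congrFun h 0⟩

/-- The loop space of the real projective space: continuous maps from the projective line that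
send `∞` to the base point, with the compact-open topology. -/
def Loop (m : ℕ) : Type := {γ : C(RP 1, RP m) // γ infty = basePt m}

instance (m : ℕ) : TopologicalSpace (Loop m) := inferInstanceAs (TopologicalSpace (Subtype _))

/-! ## Rational loops -/

/-- The binary form `∏ (X - z Y)`, `z` running over the real divisor `s` (with multiplicity),
at the real point `v = (X, Y)`. This is the homogenization of the monic real polynomial with
divisor of zeros `s`. (The product is a real number, see `coe_form`.) -/
noncomputable def form (s : Multiset ℂ) (v : Fin 2 → ℝ) : ℝ :=
  ((s.map fun z => (v 0 : ℂ) - z * v 1).prod).re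

theorem coe_form {s : Multiset ℂ} (hs : IsRealDivisor s) (v : Fin 2 → ℝ) :
    (form s v : ℂ) = (s.map fun z => (v 0 : ℂ) - z * v 1).prod := by
  rw [form]
  apply Complex.conj_eq_iff_re.1
  rw [map_multiset_prod, Multiset.map_map]
  conv_rhs => rw [← hs, Multiset.map_map]
  simp

theorem form_eq_zero_iff {s : Multiset ℂ} (hs : IsRealDivisor s) (v : Fin 2 → ℝ) :
    form s v = 0 ↔ ∃ z ∈ s, (v 0 : ℂ) = z * v 1 := by
  rw [← Complex.ofReal_eq_zero, coe_form hs, Multiset.prod_eq_zero_iff]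
  simp [sub_eq_zero]

theorem form_smul {s : Multiset ℂ} (hs : IsRealDivisor s) (a : ℝ) (v : Fin 2 → ℝ) :
    form s (a • v) = a ^ (Multiset.card s) * form s v := by
  apply Complex.ofReal_injective
  push_cast
  rw [coe_form hs, coe_form hs]
  have : (fun z : ℂ => (((a • v) 0 : ℝ) : ℂ) - z * ((a • v) 1 : ℝ)) =
      fun z => (a : ℂ) * ((v 0 : ℂ) - z * v 1) := by
    ext z; simp; ring
  rw [this, Multiset.prod_map_mul]
  simp

theorem continuous_form (s : Multiset ℂ) : Continuous (form s) := by
  unfold form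
  refine Complex.continuous_re.comp (continuous_multiset_prod _ fun z _ => ?_)
  fun_prop

theorem form_add {s t : Multiset ℂ} (hs : IsRealDivisor s) (ht : IsRealDivisor t)
    (v : Fin 2 → ℝ) : form (s + t) v = form s v * form t v := by
  apply Complex.ofReal_injective
  push_cast
  rw [coe_form hs, coe_form ht, coe_form, Multiset.map_add, Multiset.prod_add]
  rw [IsRealDivisor] at *
  rw [Multiset.map_add, hs, ht]

theorem form_ne_zero {n m : ℕ} (d : D n m) {v : Fin 2 → ℝ} (hv : v ≠ 0) :
    (fun j => form (d.1 j) v) ≠ 0 := by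
  intro h
  have key : ∀ j, ∃ z ∈ (d.1 j : Multiset ℂ), (v 0 : ℂ) = z * v 1 := fun j =>
    (form_eq_zero_iff (d.2.1 j) v).1 (congrFun h j)
  by_cases h1 : v 1 = 0
  · obtain ⟨z, -, hz⟩ := key 0
    rw [h1] at hz
    simp only [Complex.ofReal_zero, mul_zero, Complex.ofReal_eq_zero] at hz
    apply hv
    ext i
    fin_cases i <;> simp [hz, h1]
  · obtain ⟨j, hj⟩ := d.2.2 (v 0 / v 1)
    obtain ⟨z, hz, e⟩ := key j
    apply hj
    have h1' : (v 1 : ℂ) ≠ 0 := by exact_mod_cast h1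
    push_cast
    rw [e, mul_div_assoc, div_self h1', mul_one]
    exact hz

/-- The map `[X : Y] ↦ [p₀(X, Y) : ⋯ : pₘ(X, Y)]` between projective spaces, where `p_j` is the form
with divisor `d_j`. -/
noncomputable def ratFun {n m : ℕ} (d : D n m) : RP 1 → RP m :=
  Projectivization.lift (fun v => RP.mk ⟨fun j => form (d.1 j) v.1, form_ne_zero d v.2⟩) (by
    intro a b t h
    refine (RP.mk_eq_iff _ _).2 ⟨t ^ n, ?_⟩
    ext j
    simp only [Pi.smul_apply, smul_eq_mul]
    rw [h, form_smul (d.2.1 j)]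
    simp)

theorem ratFun_mk {n m : ℕ} (d : D n m) (v : {v : Fin 2 → ℝ // v ≠ 0}) :
    ratFun d (RP.mk v) = RP.mk ⟨fun j => form (d.1 j) v.1, form_ne_zero d v.2⟩ := rfl

theorem continuous_ratFun {n m : ℕ} (d : D n m) : Continuous (ratFun d) := by
  rw [← RP.isOpenQuotientMap_mk.continuous_comp_iff]
  refine RP.isOpenQuotientMap_mk.continuous.comp
    (Continuous.subtype_mk (continuous_pi fun j => (continuous_form _).comp ?_) _)
  exact continuous_subtype_val

theorem ratFun_infty {n m : ℕ} (d : D n m) : ratFun d infty = basePt m := by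
  refine (RP.mk_eq_iff _ _).2 ⟨1, ?_⟩
  ext j
  simp [form]

/-- The loop defined by a tuple of divisors. -/
noncomputable def ratLoop {n m : ℕ} (d : D n m) : Loop m :=
  ⟨⟨ratFun d, continuous_ratFun d⟩, ratFun_infty d⟩

/-- The set of all loops which are restrictions to the real axis of conjugation-equivariant
based rational maps of degree `n` from the complex projective line, that is, of loops
`[p₀ : ⋯ : pₘ]` with monic real polynomials `p_j` of degree `n` without a common complex root. -/
def RRat (n m : ℕ) : Set (Loop m) :=
  {γ | ∃ d : D n m, (∀ z : ℂ, ∃ j, z ∉ (d.1 j : Multiset ℂ)) ∧ ratLoop d = γ}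

/-- The space of real rational maps: the closure of `RRat n m` in the loop space. -/
def Rat (n m : ℕ) : Type := closure (RRat n m)

instance (n m : ℕ) : TopologicalSpace (Rat n m) := inferInstanceAs (TopologicalSpace (Subtype _))

theorem isRealDivisor_shift {s : Multiset ℂ} (hs : IsRealDivisor s) (t : ℝ) :
    IsRealDivisor (s.map fun z => z + t) := by
  rw [IsRealDivisor, Multiset.map_map]
  conv_rhs => rw [← hs, Multiset.map_map]
  simp

theorem form_shift (s : Multiset ℂ) (t : ℝ) (v : Fin 2 → ℝ) :
    form (s.map fun z => z + t) v = form s ![v 0 - t * v 1, v 1] := by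
  rw [form, form, Multiset.map_map]
  congr 3
  ext z
  simp
  ring

/-- Every tuple of divisors in `D n m` defines a point of the closure of `RRat n m`: common zeros
are removed by a small real shift of the last divisor. -/
theorem ratLoop_mem {n m : ℕ} (hm : 1 ≤ m) (d : D n m) : ratLoop d ∈ closure (RRat n m) := by
  have hl : (0 : Fin (m + 1)) ≠ Fin.last m := by
    intro h
    have := congrArg Fin.val h
    simp at this
    omega
  set e : ℝ → Fin (m + 1) → Multiset ℂ := fun t j =>
    if j = Fin.last m then (d.1 j : Multiset ℂ).map (fun z => z + t) else d.1 j with he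
  have hcard : ∀ t j, Multiset.card (e t j) = n := by
    intro t j
    simp only [he]
    split_ifs <;> simp
  have hreal : ∀ t j, IsRealDivisor (e t j) := by
    intro t j
    simp only [he]
    split_ifs
    · exact isRealDivisor_shift (d.2.1 j) t
    · exact d.2.1 j
  have he0 : ∀ j, e 0 j = d.1 j := by
    intro j
    simp [he]
  set G : Set ℝ := {t | ∀ z : ℂ, ∃ j, z ∉ e t j} with hG
  have hGd : Dense G := by
    have hfin : (Set.image2 (fun a b : ℂ => (a - b).re) {a | a ∈ (d.1 0 : Multiset ℂ)}
        {b | b ∈ (d.1 (Fin.last m) : Multiset ℂ)}).Finite :=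
      Set.Finite.image2 _ (Multiset.finite_toSet _) (Multiset.finite_toSet _)
    refine (hfin.countable.dense_compl ℝ).mono ?_
    intro t ht z
    by_contra! hz
    apply ht
    have h0 := hz 0
    have h1 := hz (Fin.last m)
    simp only [he, if_neg hl, if_true, Multiset.mem_map] at h0 h1
    obtain ⟨b, hb, rfl⟩ := h1
    exact ⟨_, h0, b, hb, by simp⟩
  let A : Set ℝ := {t | ∀ x : ℝ, ∃ j, (x : ℂ) ∉ e t j}
  have h0A : (0 : ℝ) ∈ A := by
    intro x
    obtain ⟨j, hj⟩ := d.2.2 x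
    exact ⟨j, by rwa [he0]⟩
  let δ : A → D n m := fun t => ⟨fun j => ⟨e t j, hcard t j⟩, fun j => hreal t j, t.2⟩
  have hδ0 : δ ⟨0, h0A⟩ = d := by
    apply Subtype.ext
    funext j
    exact Subtype.ext (he0 j)
  have hcont : Continuous fun t => ratLoop (δ t) := by
    refine Continuous.subtype_mk (ContinuousMap.continuous_of_continuous_uncurry _ ?_) _
    rw [← (IsOpenQuotientMap.id.prodMap RP.isOpenQuotientMap_mk).continuous_comp_iff]
    refine RP.isOpenQuotientMap_mk.continuous.comp
      (Continuous.subtype_mk (f := fun p : A × {v : Fin 2 → ℝ // v ≠ 0} => fun j =>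
        form (e p.1 j) p.2.1) (continuous_pi fun j => ?_) fun p => form_ne_zero (δ p.1) p.2.2)
    by_cases hj : j = Fin.last m
    · simp only [he, if_pos hj, form_shift]
      refine (continuous_form _).comp (continuous_pi fun i => ?_)
      have hv : ∀ k : Fin 2, Continuous fun a : A × {v : Fin 2 → ℝ // v ≠ 0} => a.2.1 k :=
        fun k => (continuous_apply k).comp (continuous_subtype_val.comp continuous_snd)
      have ht : Continuous fun a : A × {v : Fin 2 → ℝ // v ≠ 0} => a.1.1 :=
        continuous_subtype_val.comp continuous_fst
      fin_cases i
      · exact (hv 0).sub (ht.mul (hv 1))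
      · exact hv 1
    · simp only [he, if_neg hj]
      exact (continuous_form _).comp (continuous_subtype_val.comp continuous_snd)
  have hcl : (⟨0, h0A⟩ : A) ∈ closure {t : A | t.1 ∈ G} := by
    rw [closure_subtype]
    refine closure_mono ?_ (hGd 0)
    intro t ht
    exact ⟨⟨t, fun x => ht x⟩, ht, rfl⟩
  have := map_mem_closure hcont hcl (t := RRat n m) fun t ht => ⟨δ t, ht, rfl⟩
  rwa [hδ0] at this

/-- The map `P` that sends a tuple of divisors to the rational loop it defines. -/
noncomputable def P {m : ℕ} (hm : 1 ≤ m) (n : ℕ) (d : D n m) : Rat n m :=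
  ⟨ratLoop d, ratLoop_mem hm d⟩

theorem isRealDivisor_pair (z : ℂ) : IsRealDivisor {z, starRingEnd ℂ z} := by
  simp [IsRealDivisor]
  exact Multiset.pair_comm _ _

theorem form_pair_pos {z : ℂ} (hz : z.im ≠ 0) {v : Fin 2 → ℝ} (hv : v ≠ 0) :
    form {z, starRingEnd ℂ z} v ≠ 0 := by
  rw [Ne, form_eq_zero_iff (isRealDivisor_pair z)]
  rintro ⟨w, hw, e⟩
  have hw' : w.im ≠ 0 := by
    simp at hw
    rcases hw with rfl | rfl
    · exact hz
    · simpa using hz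
  have h1 := congrArg Complex.im e
  have h0 := congrArg Complex.re e
  simp at h0 h1
  have h1' := h1.resolve_left hw'
  apply hv
  ext i
  fin_cases i <;> simp [h0, h1']

/-- Adding `z + conj z` to all divisors does not change the rational loop. -/
theorem ratLoop_stabD {n m : ℕ} (z : ℂ) (hz : z.im ≠ 0) (d : D n m) :
    ratLoop (stabD m z hz n d) = ratLoop d := by
  apply Subtype.ext
  apply ContinuousMap.ext
  intro x
  obtain ⟨v, rfl⟩ := RP.mk_surjective x
  refine (RP.mk_eq_iff _ _).2 ⟨form {z, starRingEnd ℂ z} v.1, ?_⟩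
  ext j
  change _ * form (d.1 j) v.1 = form ((stabD m z hz n d).1 j) v.1
  rw [← form_add (isRealDivisor_pair z) (d.2.1 j)]
  simp [stabD, Sym.coe_cons]

theorem RRat_subset {n m : ℕ} (hm : 1 ≤ m) : closure (RRat n m) ⊆ closure (RRat (n + 2) m) := by
  refine closure_minimal ?_ isClosed_closure
  rintro _ ⟨d, -, rfl⟩
  rw [← ratLoop_stabD Complex.I (by simp) d]
  exact ratLoop_mem hm _

/-- The inclusion of `Rat n m` into `Rat (n + 2) m`, as subspaces of the loop space. -/
def stabRat {m : ℕ} (hm : 1 ≤ m) (n : ℕ) (γ : Rat n m) : Rat (n + 2) m :=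
  ⟨γ.1, RRat_subset hm γ.2⟩

theorem P_stabD {m : ℕ} (hm : 1 ≤ m) (z : ℂ) (hz : z.im ≠ 0) (n : ℕ) (d : D n m) :
    P hm (n + 2) (stabD m z hz n d) = stabRat hm n (P hm n d) :=
  Subtype.ext (ratLoop_stabD z hz d)

/-! ## Mod 2 particles on the real line -/

/-- `S n m`: the space of `(m + 1)`-tuples of positive divisors of degree `n` on the real line such
that the intersection of the supports of all the `m + 1` divisors is empty. -/
def S (n m : ℕ) : Type :=
  {s : Fin (m + 1) → Sym ℝ n // ∀ x : ℝ, ∃ j, x ∉ (s j : Multiset ℝ)}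

instance (n m : ℕ) : TopologicalSpace (S n m) := inferInstanceAs (TopologicalSpace (Subtype _))

/-- Two tuples are equivalent if all their multiplicities agree modulo 2. -/
def parity (n m : ℕ) : Setoid (S n m) where
  r s t := ∀ j (x : ℝ),
    (s.1 j : Multiset ℝ).count x ≡ (t.1 j : Multiset ℝ).count x [MOD 2]
  iseqv := ⟨fun _ _ _ => rfl, fun h j x => (h j x).symm, fun h k j x => (h j x).trans (k j x)⟩

/-- `T n m`: the space of mod 2 particles on the real line, a quotient space of `S n m`. -/
def T (n m : ℕ) : Type := Quotient (parity n m)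

instance (n m : ℕ) : TopologicalSpace (T n m) :=
  inferInstanceAs (TopologicalSpace (Quotient (parity n m)))

/-- A tuple of real multisets without a common point, whose cardinalities do not exceed `n` and have
the parity of `n`, agrees modulo 2 with some point of `S n m`. -/
theorem exists_S {n m : ℕ} (hm : 1 ≤ m) (e : Fin (m + 1) → Multiset ℝ)
    (hc : ∀ j, ∃ k, Multiset.card (e j) + 2 * k = n) (he : ∀ x : ℝ, ∃ j, x ∉ e j) :
    ∃ s : S n m, ∀ j (x : ℝ), (s.1 j : Multiset ℝ).count x ≡ (e j).count x [MOD 2] := by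
  choose k hk using hc
  obtain ⟨M, hM⟩ : ∃ M : ℝ, ∀ j, ∀ x ∈ e j, x < M := by
    have hfin : (⋃ j, {x | x ∈ e j}).Finite := Set.finite_iUnion fun j => Multiset.finite_toSet _
    obtain ⟨M, hM⟩ := hfin.bddAbove
    refine ⟨M + 1, fun j x hx => ?_⟩
    have : x ≤ M := hM (Set.mem_iUnion.2 ⟨j, hx⟩)
    linarith
  refine ⟨⟨fun j => ⟨e j + Multiset.replicate (2 * k j) (M + (j : ℕ)), by simp [hk]⟩, ?_⟩, ?_⟩
  · intro x
    by_cases hx : ∃ j : Fin (m + 1), x = M + (j : ℕ)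
    · obtain ⟨j, rfl⟩ := hx
      obtain ⟨i, hi⟩ : ∃ i : Fin (m + 1), i ≠ j := by
        have : Nontrivial (Fin (m + 1)) := Fin.nontrivial_iff_two_le.2 (by omega)
        exact exists_ne j
      refine ⟨i, fun h => ?_⟩
      rcases Multiset.mem_add.1 h with h | h
      · have := hM i _ h
        have : (0 : ℝ) ≤ (j : ℕ) := Nat.cast_nonneg _
        linarith
      · have := Multiset.eq_of_mem_replicate h
        simp at this
        exact hi (Fin.ext this.symm)
    · obtain ⟨j, hj⟩ := he x
      refine ⟨j, fun h => ?_⟩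
      rcases Multiset.mem_add.1 h with h | h
      · exact hj h
      · exact hx ⟨j, Multiset.eq_of_mem_replicate h⟩
  · intro j x
    change Multiset.count x (e j + Multiset.replicate (2 * k j) (M + (j : ℕ))) ≡ _ [MOD 2]
    rw [Multiset.count_add, Multiset.count_replicate]
    split_ifs
    · simp [Nat.ModEq, Nat.add_mod]
    · simp [Nat.ModEq]

/-- The real part of a divisor on `ℂ`, as a divisor on `ℝ`. -/
noncomputable def realPart (s : Multiset ℂ) : Multiset ℝ :=
  (s.filter fun z => z.im = 0).map Complex.re

theorem mem_realPart {s : Multiset ℂ} {x : ℝ} : x ∈ realPart s ↔ (x : ℂ) ∈ s := by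
  simp only [realPart, Multiset.mem_map, Multiset.mem_filter]
  constructor
  · rintro ⟨z, ⟨hz, h⟩, rfl⟩
    rwa [show ((z.re : ℝ) : ℂ) = z from Complex.ext rfl (by simp [h])]
  · intro h
    exact ⟨x, ⟨h, by simp⟩, by simp⟩

theorem card_realPart {s : Multiset ℂ} (hs : IsRealDivisor s) :
    ∃ k, Multiset.card (realPart s) + 2 * k = Multiset.card s := by
  refine ⟨Multiset.card (s.filter fun z => 0 < z.im), ?_⟩
  have h1 : Multiset.card (s.filter fun z => 0 < z.im) =
      Multiset.card (s.filter fun z => z.im < 0) := by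
    conv_rhs => rw [← hs]
    rw [Multiset.filter_map, Multiset.card_map]
    congr 2
    ext z
    simp
  have h2 := congrArg Multiset.card (Multiset.filter_add_not (fun z : ℂ => z.im = 0) s)
  have h3 := congrArg Multiset.card (Multiset.filter_add_not (fun z : ℂ => 0 < z.im)
    (s.filter fun z => ¬ z.im = 0))
  rw [Multiset.card_add] at h2 h3
  rw [Multiset.filter_filter, Multiset.filter_filter] at h3
  have h4 : (s.filter fun z : ℂ => 0 < z.im ∧ ¬ z.im = 0) = s.filter fun z => 0 < z.im := by
    refine Multiset.filter_congr fun z _ => ⟨fun h => h.1, fun h => ⟨h, h.ne'⟩⟩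
  have h5 : (s.filter fun z : ℂ => (¬ 0 < z.im) ∧ ¬ z.im = 0) = s.filter fun z => z.im < 0 := by
    refine Multiset.filter_congr fun z _ => ⟨fun h => ?_, fun h => ⟨h.not_gt, h.ne⟩⟩
    exact lt_of_le_of_ne (not_lt.1 h.1) h.2
  rw [h4, h5] at h3
  rw [realPart, Multiset.card_map]
  omega

theorem exists_S_of_D {n m : ℕ} (hm : 1 ≤ m) (d : D n m) :
    ∃ s : S n m, ∀ j (x : ℝ),
      (s.1 j : Multiset ℝ).count x ≡ (realPart (d.1 j)).count x [MOD 2] := by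
  refine exists_S hm _ (fun j => ?_) fun x => ?_
  · obtain ⟨k, hk⟩ := card_realPart (d.2.1 j)
    exact ⟨k, by rw [hk]; simp⟩
  · obtain ⟨j, hj⟩ := d.2.2 x
    exact ⟨j, fun h => hj (mem_realPart.1 h)⟩

/-- The map `D n m → T n m` that sends a tuple of divisors to their real parts with multiplicities
reduced modulo 2. (As a point of `T n m`, this is the class of any `s` in `S n m` whose
multiplicities are congruent modulo 2 to those of the real parts.) -/
noncomputable def R {m : ℕ} (hm : 1 ≤ m) (n : ℕ) (d : D n m) : T n m :=
  Quotient.mk (parity n m) (exists_S_of_D hm d).choose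

theorem R_eq {m : ℕ} (hm : 1 ≤ m) {n : ℕ} (d : D n m) (s : S n m)
    (h : ∀ j (x : ℝ), (s.1 j : Multiset ℝ).count x ≡ (realPart (d.1 j)).count x [MOD 2]) :
    R hm n d = Quotient.mk (parity n m) s :=
  Quotient.sound (s := parity n m) fun j x =>
    ((exists_S_of_D hm d).choose_spec j x).trans (h j x).symm

theorem exists_stabS {n m : ℕ} (hm : 1 ≤ m) (s : S n m) :
    ∃ t : S (n + 2) m, ∀ j (x : ℝ),
      (t.1 j : Multiset ℝ).count x ≡ (s.1 j : Multiset ℝ).count x [MOD 2] :=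
  exists_S hm _ (fun j => ⟨1, by simp⟩) s.2

/-- The canonical inclusion of `T n m` into `T (n + 2) m`: the mod 2 multiplicities of all particles
remain the same. -/
noncomputable def stabT {m : ℕ} (hm : 1 ≤ m) (n : ℕ) : T n m → T (n + 2) m :=
  Quotient.map (sa := parity n m) (sb := parity (n + 2) m)
    (fun s => (exists_stabS hm s).choose) fun s t h j x =>
      ((exists_stabS hm s).choose_spec j x).trans
        ((h j x).trans ((exists_stabS hm t).choose_spec j x).symm)

theorem R_stabD {m : ℕ} (hm : 1 ≤ m) (z : ℂ) (hz : z.im ≠ 0) (n : ℕ) (d : D n m) :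
    R hm (n + 2) (stabD m z hz n d) = stabT hm n (R hm n d) := by
  refine R_eq hm _ _ fun j x => ?_
  refine ((exists_stabS hm _).choose_spec j x).trans
    (((exists_S_of_D hm d).choose_spec j x).trans ?_)
  have : realPart ((stabD m z hz n d).1 j) = realPart (d.1 j) := by
    simp [realPart, stabD, Sym.coe_cons, hz]
  rw [this]


/-! ## The map from rational loops to mod 2 particles -/

/-- The vector `w` (possibly zero) lies on the line `y`. -/
def Inc {m : ℕ} (w : Fin (m + 1) → ℝ) (y : RP m) : Prop :=
  ∀ u, RP.mk u = y → ∀ i j, w i * u.1 j = w j * u.1 i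

theorem inc_mk {m : ℕ} (w : Fin (m + 1) → ℝ) (u : {v : Fin (m + 1) → ℝ // v ≠ 0}) :
    Inc w (RP.mk u) ↔ ∀ i j, w i * u.1 j = w j * u.1 i := by
  refine ⟨fun h => h u rfl, fun h u' hu' i j => ?_⟩
  obtain ⟨a, ha⟩ := (RP.mk_eq_iff _ _).1 hu'
  rw [← ha]
  simp only [Pi.smul_apply, smul_eq_mul]
  linear_combination a * h i j

theorem isClosed_inc {m : ℕ} : IsClosed {p : (Fin (m + 1) → ℝ) × RP m | Inc p.1 p.2} := by
  rw [← (IsOpenQuotientMap.id.prodMap RP.isOpenQuotientMap_mk).isQuotientMap.isClosed_preimage]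
  simp only [Set.preimage_ofPred_eq, Prod.map_fst, Prod.map_snd, inc_mk, id]
  simp only [Set.ofPred_forall]
  refine isClosed_iInter fun i => isClosed_iInter fun j => isClosed_eq ?_ ?_
  · exact ((continuous_apply i).comp continuous_fst).mul
      ((continuous_apply j).comp (continuous_subtype_val.comp continuous_snd))
  · exact ((continuous_apply j).comp continuous_fst).mul
      ((continuous_apply i).comp (continuous_subtype_val.comp continuous_snd))

theorem inc_smul {m : ℕ} {a : ℝ} (ha : a ≠ 0) {w : Fin (m + 1) → ℝ} {y : RP m} :
    Inc (a • w) y ↔ Inc w y := by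
  obtain ⟨u, rfl⟩ := RP.mk_surjective y
  simp only [inc_mk, Pi.smul_apply, smul_eq_mul, mul_assoc, mul_right_inj' ha]

theorem Inc.eq_mk {m : ℕ} {w : Fin (m + 1) → ℝ} {y : RP m} (h : Inc w y) (hw : w ≠ 0) :
    y = RP.mk ⟨w, hw⟩ := by
  obtain ⟨u, rfl⟩ := RP.mk_surjective y
  rw [inc_mk] at h
  obtain ⟨i, hi⟩ := Function.ne_iff.1 hw
  simp only [Pi.zero_apply] at hi
  refine (RP.mk_eq_iff _ _).2 ⟨u.1 i / w i, ?_⟩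
  ext j
  simp only [Pi.smul_apply, smul_eq_mul]
  have := h i j
  field_simp
  linarith

/-- The point of the projective line with affine coordinate `x`. -/
noncomputable def aff (x : ℝ) : RP 1 := RP.mk ⟨![x, 1], fun h => by simpa using congrFun h 1⟩

theorem aff_or_infty (y : RP 1) : y = infty ∨ ∃ x, y = aff x := by
  obtain ⟨⟨v, hv⟩, rfl⟩ := RP.mk_surjective y
  by_cases h : v 1 = 0
  · left
    refine (RP.mk_eq_iff _ _).2 ⟨v 0, ?_⟩
    ext i
    fin_cases i
    · simp
    · simp [h]
  · right
    refine ⟨v 0 / v 1, (RP.mk_eq_iff _ _).2 ⟨v 1, ?_⟩⟩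
    ext i
    fin_cases i
    · simp
      field_simp
    · simp

theorem continuous_aff : Continuous aff := by
  refine RP.isOpenQuotientMap_mk.continuous.comp (Continuous.subtype_mk (continuous_pi fun i => ?_) _)
  fin_cases i
  · exact continuous_id
  · exact continuous_const

open Polynomial

theorem eval_prod_eq_form {s : Multiset ℂ} (hs : IsRealDivisor s) (x : ℝ) :
    ((s.map fun z => (X - C z : ℂ[X])).prod).eval (x : ℂ) = form s ![x, 1] := by
  rw [coe_form hs, eval_multiset_prod, Multiset.map_map]
  simp

/-- A loop in the closure is given by polynomials of degree at most `n`, possibly with common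
zeros. -/
theorem exists_poly {n m : ℕ} {γ : Loop m} (hγ : γ ∈ closure (RRat n m)) :
    ∃ q : Fin (m + 1) → ℝ[X], (∃ j, q j ≠ 0) ∧ (∀ j, (q j).natDegree ≤ n) ∧
      ∀ x : ℝ, Inc (fun j => (q j).eval x) (γ.1 (aff x)) := by
  let ev : (Fin (m + 1) → Fin (n + 1) → ℝ) → ℝ → Fin (m + 1) → ℝ := fun c x j => ∑ i, c j i * x ^ (i : ℕ)
  let K : Set (Metric.sphere (0 : Fin (m + 1) → Fin (n + 1) → ℝ) 1 × Loop m) :=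
    {p | ∀ x : ℝ, Inc (ev p.1.1 x) (p.2.1 (aff x))}
  have hK : IsClosed K := by
    simp only [K, Set.ofPred_forall]
    refine isClosed_iInter fun x => isClosed_inc.preimage
      (f := fun p : Metric.sphere (0 : Fin (m + 1) → Fin (n + 1) → ℝ) 1 × Loop m => (ev p.1.1 x, p.2.1 (aff x))) ?_
    refine Continuous.prodMk ?_ ?_
    · have : Continuous fun c : Fin (m + 1) → Fin (n + 1) → ℝ => ev c x := by
        simp only [ev]
        fun_prop
      exact this.comp (continuous_subtype_val.comp continuous_fst)
    · exact (continuous_eval_const (F := C(RP 1, RP m)) (aff x)).comp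
        (continuous_subtype_val.comp continuous_snd)
  have hcl : IsClosed (Prod.snd '' K) := isClosedMap_snd_of_compactSpace _ hK
  have hsub : RRat n m ⊆ Prod.snd '' K := by
    rintro _ ⟨d, -, rfl⟩
    let c : Fin (m + 1) → Fin (n + 1) → ℝ := fun j i => (((d.1 j : Multiset ℂ).map fun z => X - C z).prod.coeff i).re
    have hc : ∀ x, ev c x = fun j => form (d.1 j) ![x, 1] := by
      intro x
      ext j
      have h := eval_prod_eq_form (d.2.1 j) x
      have hdeg : (((d.1 j : Multiset ℂ).map fun z => X - C z).prod).natDegree < n + 1 := by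
        rw [natDegree_multiset_prod_X_sub_C_eq_card]
        simp
      rw [eval_eq_sum_range' hdeg, Finset.sum_range] at h
      have h' := congrArg Complex.re h
      rw [Complex.ofReal_re, Complex.re_sum] at h'
      rw [← h']
      refine Finset.sum_congr rfl fun i _ => ?_
      rw [← Complex.ofReal_pow, Complex.re_mul_ofReal]
    have hc0 : c ≠ 0 := by
      intro h0
      have := form_ne_zero d (v := ![0, 1]) (fun h => by simpa using congrFun h 1)
      apply this
      rw [← hc 0, h0]
      ext j
      simp [ev]
    refine ⟨(⟨‖c‖⁻¹ • c, ?_⟩, ratLoop d), ?_, rfl⟩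
    · simp [norm_smul, norm_ne_zero_iff.2 hc0]
    · intro x
      have : ev (‖c‖⁻¹ • c) x = ‖c‖⁻¹ • ev c x := by
        ext j
        simp [ev, Finset.mul_sum, mul_assoc]
      change Inc (ev (‖c‖⁻¹ • c) x) (ratFun d (aff x))
      rw [this, inc_smul (inv_ne_zero (norm_ne_zero_iff.2 hc0)), hc, aff, ratFun_mk, inc_mk]
      intro i j
      exact mul_comm _ _
  obtain ⟨⟨c, γ'⟩, hcK, rfl⟩ := closure_minimal hsub hcl hγ
  refine ⟨fun j => ∑ i : Fin (n + 1), monomial (i : ℕ) (c.1 j i), ?_, ?_, ?_⟩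
  · by_contra! h
    have : c.1 = 0 := by
      ext j i
      have := congrArg (fun p => coeff p (i : ℕ)) (h j)
      simp [finsetSum_coeff, coeff_monomial, Fin.val_inj] at this
      exact this
    have h1 : ‖c.1‖ = 1 := by simpa using c.2
    rw [this] at h1
    simp at h1
  · intro j
    refine natDegree_sum_le_of_forall_le _ _ fun i _ => (natDegree_monomial_le _).trans ?_
    omega
  · intro x
    convert hcK x using 2
    simp [ev, eval_finsetSum]

/-- The common factor can be removed. -/
theorem exists_coprime_poly {n m : ℕ} {γ : Loop m} (hγ : γ ∈ closure (RRat n m)) :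
    ∃ r : Fin (m + 1) → ℝ[X], (∃ a : Fin (m + 1) → ℝ[X], ∑ j, a j * r j = 1) ∧
      (∀ j, (r j).natDegree ≤ n) ∧
      ∀ x : ℝ, Inc (fun j => (r j).eval x) (γ.1 (aff x)) := by
  obtain ⟨q, ⟨j₀, hj₀⟩, hdeg, hq⟩ := exists_poly hγ
  obtain ⟨g, hg⟩ := (IsPrincipalIdealRing.principal (Ideal.span (Set.range q))).principal
  have hmem : ∀ j, q j ∈ Ideal.span (Set.range q) := fun j => Ideal.subset_span ⟨j, rfl⟩
  rw [hg] at hmem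
  have hdvd : ∀ j, g ∣ q j := fun j => Ideal.mem_span_singleton.1 (hmem j)
  choose r hr using hdvd
  have hg0 : g ≠ 0 := by
    rintro rfl
    exact hj₀ (by rw [hr j₀, zero_mul])
  have hgm : g ∈ Ideal.span (Set.range q) := by
    rw [hg]
    exact Ideal.mem_span_singleton_self g
  obtain ⟨a, ha⟩ := (Ideal.mem_span_range_iff_exists_fun).1 hgm
  refine ⟨r, ⟨a, ?_⟩, ?_, ?_⟩
  · apply mul_left_cancel₀ hg0
    rw [mul_one, Finset.mul_sum]
    conv_rhs => rw [← ha]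
    refine Finset.sum_congr rfl fun j _ => ?_
    rw [hr j]
    ring
  · intro j
    by_cases h : r j = 0
    · simp [h]
    · have := hdeg j
      rw [hr j, natDegree_mul hg0 h] at this
      omega
  · have hcl : IsClosed {x : ℝ | Inc (fun j => (r j).eval x) (γ.1 (aff x))} := by
      refine isClosed_inc.preimage
        (f := fun x : ℝ => ((fun j => (r j).eval x : Fin (m + 1) → ℝ), γ.1 (aff x))) ?_
      refine Continuous.prodMk (continuous_pi fun j => (r j).continuous) ?_
      exact γ.1.continuous.comp continuous_aff
    have hd : Dense ({x : ℝ | x ∈ g.roots}ᶜ) :=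
      (Multiset.finite_toSet g.roots).countable.dense_compl ℝ
    intro x
    refine closure_minimal ?_ hcl (hd x)
    intro y hy
    have hy' : g.eval y ≠ 0 := by
      intro h
      exact hy ((mem_roots hg0).2 h)
    have := hq y
    rw [show (fun j => (q j).eval y) = g.eval y • fun j => (r j).eval y by
      ext j; rw [hr j]; simp] at this
    exact (inc_smul hy').1 this

theorem coeff_top {m : ℕ} {γ : Loop m} (r : Fin (m + 1) → ℝ[X]) (k : ℕ)
    (hk : ∀ j, (r j).natDegree ≤ k)
    (hr : ∀ x : ℝ, Inc (fun j => (r j).eval x) (γ.1 (aff x))) (i j : Fin (m + 1)) :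
    (r i).coeff k = (r j).coeff k := by
  let b : ℝ → RP 1 := fun y => RP.mk ⟨![1, y], fun h => by simpa using congrFun h 0⟩
  have hb : Continuous b := by
    refine RP.isOpenQuotientMap_mk.continuous.comp
      (Continuous.subtype_mk (continuous_pi fun i => ?_) _)
    fin_cases i
    · exact continuous_const
    · exact continuous_id
  have hcl : IsClosed {y : ℝ | Inc (fun j => (reflect k (r j)).eval y) (γ.1 (b y))} := by
    refine isClosed_inc.preimage
      (f := fun y : ℝ => ((fun j => (reflect k (r j)).eval y : Fin (m + 1) → ℝ), γ.1 (b y))) ?_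
    exact Continuous.prodMk (continuous_pi fun j => (reflect k (r j)).continuous)
      (γ.1.continuous.comp hb)
  have hd : Dense ({0}ᶜ : Set ℝ) := dense_compl_singleton 0
  have h0 := closure_minimal (s := ({0}ᶜ : Set ℝ)) ?_ hcl (hd 0)
  · have hγ : γ.1 (b 0) = basePt m := γ.2
    have h1 : Inc (fun j => (reflect k (r j)).eval 0) (γ.1 (b 0)) := h0
    rw [hγ, basePt, inc_mk] at h1
    have := h1 i j
    simp only [← coeff_zero_eq_eval_zero, coeff_reflect, revAt_le (Nat.zero_le k), Nat.sub_zero,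
      mul_one] at this
    exact this
  · intro y hy
    have hy : y ≠ 0 := hy
    have e : b y = aff y⁻¹ := by
      refine (RP.mk_eq_iff _ _).2 ⟨y, ?_⟩
      ext i
      fin_cases i
      · simp [hy]
      · simp
    have h := hr y⁻¹
    rw [← e, ← inc_smul (pow_ne_zero k hy)] at h
    change Inc _ _
    convert h using 1
    ext j
    let _ := invertibleOfNonzero (inv_ne_zero hy)
    have := eval₂_reflect_mul_pow (RingHom.id ℝ) y⁻¹ k (r j) (hk j)
    simp only [invOf_eq_inv, inv_inv] at this
    simp only [Pi.smul_apply, smul_eq_mul, eval]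
    rw [← this, mul_comm, mul_assoc, ← mul_pow, inv_mul_cancel₀ hy, one_pow, mul_one]

/-- The divisor of complex zeros of a real polynomial is real. -/
theorem isRealDivisor_roots (p : ℝ[X]) : IsRealDivisor (p.map Complex.ofRealHom).roots := by
  rw [IsRealDivisor]
  have h := roots_map_of_injective_of_card_eq_natDegree (p := p.map Complex.ofRealHom)
    (f := starRingEnd ℂ) (starRingEnd ℂ).injective
    ((IsAlgClosed.splits _).natDegree_eq_card_roots).symm
  rw [h, Polynomial.map_map]
  congr 2
  ext x
  simp

/-- A loop in the closure is given by coprime monic polynomials of some degree `k ≤ n`. -/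
theorem exists_monic {n m : ℕ} {γ : Loop m} (hγ : γ ∈ closure (RRat n m)) :
    ∃ k ≤ n, ∃ e : D k m, ratLoop e = γ := by
  obtain ⟨r, ⟨a, ha⟩, hdeg, hr⟩ := exists_coprime_poly hγ
  obtain ⟨j₀, hj₀⟩ : ∃ j₀, ∀ j, (r j).natDegree ≤ (r j₀).natDegree :=
    Finite.exists_max fun j => (r j).natDegree
  set k := (r j₀).natDegree with hk
  have htop := coeff_top r k hj₀ hr
  have hc0 : (r j₀).coeff k ≠ 0 := by
    intro h
    have h1 : r j₀ = 0 := leadingCoeff_eq_zero.1 h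
    have hk0 : k = 0 := by rw [hk, h1, natDegree_zero]
    have hall : ∀ j, r j = 0 := by
      intro j
      have h2 := hj₀ j
      rw [hk0, Nat.le_zero] at h2
      rw [eq_C_of_natDegree_eq_zero h2]
      have h3 := htop j j₀
      rw [h, hk0] at h3
      rw [h3, C_0]
    simp [hall] at ha
  set c := (r j₀).coeff k with hc
  have hcj : ∀ j, (r j).coeff k = c := fun j => htop j j₀
  have hdj : ∀ j, (r j).natDegree = k := fun j =>
    le_antisymm (hj₀ j) (le_natDegree_of_ne_zero (by rw [hcj]; exact hc0))
  have hrj : ∀ j, r j ≠ 0 := by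
    intro j h
    have := hcj j
    rw [h, coeff_zero] at this
    exact hc0 this.symm
  have hval : ∀ j (x : ℝ), (r j).eval x =
      c * form ((r j).map Complex.ofRealHom).roots ![x, 1] := by
    intro j x
    apply Complex.ofReal_injective
    push_cast
    rw [← eval_prod_eq_form (isRealDivisor_roots _)]
    have h := (IsAlgClosed.splits ((r j).map Complex.ofRealHom)).eq_prod_roots
    have h2 : (((r j).eval x : ℝ) : ℂ) = ((r j).map Complex.ofRealHom).eval (x : ℂ) := by
      have := eval_map_apply (f := Complex.ofRealHom) (p := r j) (x := x)
      simpa using this.symm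
    rw [h2]
    conv_lhs => rw [h]
    rw [eval_mul, eval_C, leadingCoeff_map, leadingCoeff, hdj, hcj]
    simp
  let e : D k m := ⟨fun j => ⟨((r j).map Complex.ofRealHom).roots, by
      rw [← (IsAlgClosed.splits _).natDegree_eq_card_roots, natDegree_map, hdj]⟩,
    fun j => isRealDivisor_roots _, by
      intro x
      by_contra! h
      have hz : ∀ j, (r j).eval x = 0 := by
        intro j
        have h1 := h j
        rw [hval, (form_eq_zero_iff (isRealDivisor_roots _) _).2 ⟨_, h1, by simp⟩, mul_zero]
      have := congrArg (eval x) ha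
      simp [eval_finsetSum, hz] at this⟩
  refine ⟨k, hdeg j₀, e, ?_⟩
  apply Subtype.ext
  apply ContinuousMap.ext
  intro y
  rcases aff_or_infty y with rfl | ⟨x, rfl⟩
  · exact (ratLoop e).2.trans γ.2.symm
  · have h := hr x
    rw [show (fun j => (r j).eval x) = c • fun j => form (e.1 j) ![x, 1] from
      funext fun j => hval j x, inc_smul hc0] at h
    exact (h.eq_mk (form_ne_zero e fun h => by simpa using congrFun h 1)).symm

/-- The degrees of two tuples of forms that define sufficiently close loops have the same
parity. -/
theorem even_add_degree {n k m : ℕ} (e : D k m) (h : ratLoop e ∈ closure (RRat n m)) :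
    Even (n + k) := by
  let W : Set (RP m × RP m) := {p | ∀ u w, RP.mk u = p.1 → RP.mk w = p.2 → u.1 ⬝ᵥ w.1 ≠ 0}
  have hWmk : ∀ u w, (RP.mk u, RP.mk w) ∈ W ↔ u.1 ⬝ᵥ w.1 ≠ 0 := by
    intro u w
    refine ⟨fun h => h u w rfl rfl, fun h u' w' hu hw => ?_⟩
    obtain ⟨a, ha⟩ := (RP.mk_eq_iff _ _).1 hu.symm
    obtain ⟨b, hb⟩ := (RP.mk_eq_iff _ _).1 hw.symm
    rw [← ha, ← hb, smul_dotProduct, dotProduct_smul] at h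
    intro h0
    simp [h0] at h
  have hW : IsOpen W := by
    rw [← (RP.isOpenQuotientMap_mk.prodMap RP.isOpenQuotientMap_mk).isQuotientMap.isOpen_preimage]
    have : Prod.map RP.mk RP.mk ⁻¹' W = {p : {v : Fin (m + 1) → ℝ // v ≠ 0} ×
        {v : Fin (m + 1) → ℝ // v ≠ 0} | p.1.1 ⬝ᵥ p.2.1 ≠ 0} := by
      ext p
      exact hWmk _ _
    rw [this]
    refine isOpen_ne_fun ?_ continuous_const
    exact (continuous_subtype_val.comp continuous_fst).dotProduct
      (continuous_subtype_val.comp continuous_snd)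
  let cir : ℝ → {v : Fin 2 → ℝ // v ≠ 0} := fun θ => ⟨![Real.cos θ, Real.sin θ], fun h => by
    have h0 := congrFun h 0
    have h1 := congrFun h 1
    simp at h0 h1
    have := Real.sin_sq_add_cos_sq θ
    simp [h0, h1] at this⟩
  have hcir : Continuous cir := by
    refine Continuous.subtype_mk (continuous_pi fun i => ?_) _
    fin_cases i
    · exact Real.continuous_cos
    · exact Real.continuous_sin
  let κ : C(RP 1, RP m) := (ratLoop e).1
  let α : C(ℝ, RP 1) := ⟨fun θ => RP.mk (cir θ), RP.isOpenQuotientMap_mk.continuous.comp hcir⟩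
  have hO : IsOpen {δ : Loop m | ∀ θ ∈ Set.Icc 0 Real.pi, (κ (α θ), δ.1 (α θ)) ∈ W} := by
    have h1 : IsOpen {f : C(ℝ, RP m × RP m) | Set.MapsTo f (Set.Icc 0 Real.pi) W} :=
      ContinuousMap.isOpen_setOfPred_mapsTo isCompact_Icc hW
    have h2 : Continuous fun δ : Loop m => ((κ.prodMk δ.1).comp α : C(ℝ, RP m × RP m)) := by
      refine ContinuousMap.continuous_of_continuous_uncurry _ ?_
      have h3 : Continuous fun δ : Loop m => (δ.1.comp α : C(ℝ, RP m)) :=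
        (ContinuousMap.continuous_precomp α).comp continuous_subtype_val
      have h4 : Continuous fun p : Loop m × ℝ => (p.1.1.comp α : C(ℝ, RP m)) p.2 :=
        continuous_eval.comp ((h3.comp continuous_fst).prodMk continuous_snd)
      exact Continuous.prodMk ((κ.comp α).continuous.comp continuous_snd) h4
    exact h1.preimage h2
  obtain ⟨_, hδ, d, -, rfl⟩ := mem_closure_iff.1 h _ hO (by
    intro θ _
    change (κ (RP.mk (cir θ)), κ (RP.mk (cir θ))) ∈ W
    obtain ⟨u, hu⟩ := RP.mk_surjective (κ (RP.mk (cir θ)))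
    rw [← hu, hWmk]
    exact fun h => u.2 (dotProduct_self_eq_zero.1 h))
  let ψ : ℝ → ℝ := fun θ => (fun j => form (e.1 j) (cir θ).1) ⬝ᵥ fun j => form (d.1 j) (cir θ).1
  have hψ : Continuous ψ := by
    have : Continuous fun θ => (cir θ).1 := continuous_subtype_val.comp hcir
    exact Continuous.dotProduct (continuous_pi fun j => (continuous_form _).comp this)
      (continuous_pi fun j => (continuous_form _).comp this)
  have hne : ∀ θ ∈ Set.Icc 0 Real.pi, ψ θ ≠ 0 := by
    intro θ hθ
    have := hδ θ hθ
    exact (hWmk ⟨_, form_ne_zero e (cir θ).2⟩ ⟨_, form_ne_zero d (cir θ).2⟩).1 this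
  have hend : ψ Real.pi = (-1) ^ (n + k) * ψ 0 := by
    have hc : (cir Real.pi).1 = (-1 : ℝ) • (cir 0).1 := by
      ext i
      fin_cases i <;> simp [cir]
    simp only [ψ, hc, dotProduct, Finset.mul_sum]
    refine Finset.sum_congr rfl fun j _ => ?_
    rw [form_smul (e.2.1 j), form_smul (d.2.1 j)]
    simp only [Sym.card_coe]
    ring
  by_contra hodd
  rw [Nat.not_even_iff_odd] at hodd
  rw [hodd.neg_one_pow] at hend
  have h0 : (0 : ℝ) ∈ Set.uIcc (ψ 0) (ψ Real.pi) := by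
    rw [hend, Set.mem_uIcc]
    rcases le_total 0 (ψ 0) with h | h
    · right; constructor <;> linarith
    · left; constructor <;> linarith
  obtain ⟨θ, hθ, h00⟩ := intermediate_value_uIcc hψ.continuousOn h0
  rw [Set.uIcc_of_le Real.pi_pos.le] at hθ
  exact hne θ hθ h00

theorem I_im_ne : Complex.I.im ≠ 0 := by
  rw [Complex.I_im]
  exact one_ne_zero

theorem P_surjective {m : ℕ} (hm : 1 ≤ m) (n : ℕ) : Function.Surjective (P hm n) := by
  rintro ⟨γ, hγ⟩
  obtain ⟨k, hk, e, rfl⟩ := exists_monic hγ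
  obtain ⟨l, rfl⟩ : ∃ l, n = k + 2 * l := by
    obtain ⟨s, hs⟩ := even_add_degree e hγ
    exact ⟨s - k, by omega⟩
  have key : ∀ l, ∃ d : D (k + 2 * l) m, ratLoop d = ratLoop e := by
    intro l
    induction l with
    | zero => exact ⟨e, rfl⟩
    | succ l ih =>
      obtain ⟨d, hd⟩ := ih
      exact ⟨stabD m Complex.I (by simp) _ d, (ratLoop_stabD _ _ d).trans hd⟩
  obtain ⟨d, hd⟩ := key l
  exact ⟨d, Subtype.ext hd⟩

theorem count_realPart (s : Multiset ℂ) (x : ℝ) :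
    (realPart s).count x = s.count (x : ℂ) := by
  rw [realPart, Multiset.count_map, Multiset.filter_filter, Multiset.count_eq_card_filter_eq]
  congr 1
  refine Multiset.filter_congr fun z _ => ⟨fun h => ?_, fun h => ?_⟩
  · exact Complex.ext (by simp [h.1]) (by simp [h.2])
  · rw [← h]
    simp

/-- The mod 2 particles of a tuple of divisors are determined by the rational loop. -/
theorem R_eq_of_P_eq {m : ℕ} (hm : 1 ≤ m) {n : ℕ} (d d' : D n m) (h : P hm n d = P hm n d') :
    R hm n d = R hm n d' := by
  have h1 : ratFun d = ratFun d' := congrArg (fun γ : Rat n m => (γ.1.1 : RP 1 → RP m)) h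
  have h2 : ∀ i j, (d.1 i : Multiset ℂ) + d'.1 j = (d.1 j : Multiset ℂ) + d'.1 i := by
    intro i j
    have hroots : ∀ s : Multiset ℂ, ((s.map fun z => (X - C z : ℂ[X])).prod).roots = s :=
      roots_multiset_prod_X_sub_C
    rw [← hroots (d.1 i + d'.1 j), ← hroots (d.1 j + d'.1 i)]
    congr 1
    refine eq_of_infinite_eval_eq _ _ ((Set.infinite_range_of_injective
      Complex.ofReal_injective).mono ?_)
    rintro _ ⟨x, rfl⟩
    simp only [Set.mem_ofPred_eq, Multiset.map_add, Multiset.prod_add, eval_mul]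
    rw [eval_prod_eq_form (d.2.1 i), eval_prod_eq_form (d'.2.1 j), eval_prod_eq_form (d.2.1 j),
      eval_prod_eq_form (d'.2.1 i)]
    have h3 := congrFun h1 (aff x)
    rw [aff, ratFun_mk, ratFun_mk] at h3
    obtain ⟨a, ha⟩ := (RP.mk_eq_iff _ _).1 h3
    have hi := congrFun ha i
    have hj := congrFun ha j
    simp only [Pi.smul_apply, smul_eq_mul] at hi hj
    rw [← hi, ← hj]
    push_cast
    ring
  refine R_eq hm _ _ fun j x => ((exists_S_of_D hm d').choose_spec j x).trans ?_
  rw [count_realPart, count_realPart]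
  obtain ⟨l, hl⟩ := d.2.2 x
  obtain ⟨l', hl'⟩ := d'.2.2 x
  have c1 := congrArg (Multiset.count (x : ℂ)) (h2 l l')
  have c2 := congrArg (Multiset.count (x : ℂ)) (h2 j l)
  rw [Multiset.count_add, Multiset.count_add] at c1 c2
  rw [Multiset.count_eq_zero_of_notMem hl] at c1 c2
  rw [Multiset.count_eq_zero_of_notMem hl'] at c1
  have : Multiset.count (x : ℂ) (d.1 j) = Multiset.count (x : ℂ) (d'.1 j) := by omega
  rw [this]

/-- The map `Q` from rational loops to mod 2 particles through which the map `R` factors; it sends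
a loop `[p₀ : ⋯ : pₘ]` to the real zeros of the polynomials `p_j` with multiplicities reduced
modulo 2. -/
noncomputable def Q {m : ℕ} (hm : 1 ≤ m) (n : ℕ) (γ : Rat n m) : T n m :=
  R hm n (P_surjective hm n γ).choose

theorem Q_P {m : ℕ} (hm : 1 ≤ m) (n : ℕ) (d : D n m) : Q hm n (P hm n d) = R hm n d :=
  R_eq_of_P_eq hm _ _ (P_surjective hm n (P hm n d)).choose_spec

theorem Q_stabRat {m : ℕ} (hm : 1 ≤ m) (n : ℕ) (γ : Rat n m) :
    Q hm (n + 2) (stabRat hm n γ) = stabT hm n (Q hm n γ) := by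
  obtain ⟨d, rfl⟩ := P_surjective hm n γ
  rw [← P_stabD hm Complex.I I_im_ne n d, Q_P, Q_P]
  exact R_stabD hm Complex.I I_im_ne n d

/-! ## The stable case -/

/-- `D ∞ m`, where stabilization adds `z + conj z`. -/
def DInf (m : ℕ) (z : ℂ) (hz : z.im ≠ 0) : Type := Stable (fun n => D n m) (stabD m z hz)

/-- `Rat ∞ m`. -/
def RatInf {m : ℕ} (hm : 1 ≤ m) : Type := Stable (fun n => Rat n m) (stabRat hm)

/-- `T ∞ m`. -/
def TInf {m : ℕ} (hm : 1 ≤ m) : Type := Stable (fun n => T n m) (stabT hm)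

instance (m : ℕ) (z : ℂ) (hz : z.im ≠ 0) : TopologicalSpace (DInf m z hz) :=
  inferInstanceAs (TopologicalSpace (Stable _ _))

instance {m : ℕ} (hm : 1 ≤ m) : TopologicalSpace (RatInf hm) :=
  inferInstanceAs (TopologicalSpace (Stable _ _))

noncomputable instance {m : ℕ} (hm : 1 ≤ m) : TopologicalSpace (TInf hm) :=
  inferInstanceAs (TopologicalSpace (Stable _ _))

/-- The map `P` for `n = ∞`. -/
noncomputable def PInf {m : ℕ} (hm : 1 ≤ m) (z : ℂ) (hz : z.im ≠ 0) : DInf m z hz → RatInf hm :=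
  Stable.map (P hm) (P_stabD hm z hz)

/-- The map `Q` for `n = ∞`. -/
noncomputable def QInf {m : ℕ} (hm : 1 ≤ m) : RatInf hm → TInf hm :=
  Stable.map (Q hm) (Q_stabRat hm)

end RationalLoops

namespace RationalLoops

open Topology unitInterval

/-! ## Homotopy equivalences of sequences of spaces -/

/-! A point of `D n m` amounts to a tuple of monic real binary forms of degree `n` without a common
real zero. The forms are evaluated on an interval that covers the real projective line and divided
by `rho z ^ n`, where `rho z` is the positive function |X - zY|. The tuples then become the nowhere
vanishing functions in a finite-dimensional affine space `formSpace` (`homeoD`), and adding z and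
its conjugate becomes an inclusion of affine spaces. All inverses and homotopies are built
compatibly with these inclusions (`SeqHomotopyInverse`), which settles finite and infinite `n`
together.

The map `P`. A loop determines its tuple of forms up to a nowhere vanishing scalar function, whose
sign is fixed at infinity because the forms are monic. Hence `Rat n m` is homeomorphic to the space
of normalized functions f/‖f‖ (`homeoRat`), and `P` becomes normalization. The functions at an angle
less than a prescribed acute or right angle to a given one form a convex set, so partitions of unity
yield continuous selections of forms close in direction to a given normalized function
(`AffineModel.exists_isSelection`). Selections at less than a right angle give the inverse: straight
segments give the homotopy on forms, and shrinking the angle to zero gives the homotopy on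
normalized functions.

The composite `R` of `P` and `Q`. Two tuples have the same mod 2 particles exactly when
corresponding forms never have opposite signs. Hence the fibres of `R` are convex, and each contains
the standard tuple with simple zeros at the particles, filled up by non-real pairs. The fibres do
not vary continuously, since particles can vanish in pairs. But when tuples converge, their standard
points converge along ultrafilters to a point of the limit's fibre (`exists_limit_oddType`).

Fibres are therefore contracted one number of particles at a time, by maps `push k`. Such a map
jumps near fibres with fewer than `k` particles, but it becomes continuous when followed by a map
that is constant on those fibres (`FibredModel.continuous_comp_push`). The composite of all pushes
is constant on all fibres and descends to an inverse of `R`. Running the pushes in order of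
increasing `k` gives the homotopy upstairs; running them in order of decreasing `k` preserves fibres
and gives the homotopy on `T n m`. The limit argument also shows that `Q` is continuous, so `Q`
follows by two out of three. -/

theorem isHomotopyEquiv_of_homotopies {X Y : Type} [TopologicalSpace X] [TopologicalSpace Y]
    {f : X → Y} {g : Y → X} (hf : Continuous f) (hg : Continuous g)
    {H : X × I → X} (hH : Continuous H) (H0 : ∀ x, H (x, 0) = x) (H1 : ∀ x, H (x, 1) = g (f x))
    {H' : Y × I → Y} (hH' : Continuous H') (H'0 : ∀ y, H' (y, 0) = y)
    (H'1 : ∀ y, H' (y, 1) = f (g y)) : IsHomotopyEquiv f := by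
  refine ⟨⟨⟨f, hf⟩, ⟨g, hg⟩, ⟨ContinuousMap.Homotopy.symm ⟨⟨fun p => H (p.2, p.1), ?_⟩, ?_, ?_⟩⟩,
    ⟨ContinuousMap.Homotopy.symm ⟨⟨fun p => H' (p.2, p.1), ?_⟩, ?_, ?_⟩⟩⟩, rfl⟩
  · exact hH.comp continuous_swap
  · exact H0
  · exact H1
  · exact hH'.comp continuous_swap
  · exact H'0
  · exact H'1

/-- Two out of three: `f` after the homotopy inverse of `h` is a homotopy inverse of `g`. It is used
to pass from `P` and `R` to `Q`. -/
theorem IsHomotopyEquiv.of_comp {X Y Z : Type} [TopologicalSpace X] [TopologicalSpace Y]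
    [TopologicalSpace Z] {f : X → Y} {g : Y → Z} {h : X → Z} (hf : IsHomotopyEquiv f)
    (hh : IsHomotopyEquiv h) (hg : Continuous g) (hgf : ∀ x, g (f x) = h x) :
    IsHomotopyEquiv g := by
  obtain ⟨e, rfl⟩ := hf
  obtain ⟨k, rfl⟩ := hh
  let G : C(Y, Z) := ⟨g, hg⟩
  have hG : G.comp e.toFun = k.toFun := ContinuousMap.ext hgf
  refine ⟨⟨G, e.toFun.comp k.invFun, ?_, ?_⟩, rfl⟩
  · have h1 : ((e.toFun.comp k.invFun).comp G).Homotopic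
        (((e.toFun.comp k.invFun).comp G).comp (e.toFun.comp e.invFun)) :=
      (ContinuousMap.Homotopic.refl ((e.toFun.comp k.invFun).comp G)).comp e.right_inv.symm
    have h2 : ((e.toFun.comp k.invFun).comp G).comp (e.toFun.comp e.invFun) =
        (e.toFun.comp (k.invFun.comp k.toFun)).comp e.invFun := by
      rw [← hG]
      rfl
    rw [h2] at h1
    have h3 : (e.toFun.comp (k.invFun.comp k.toFun)).Homotopic (e.toFun.comp (.id X)) :=
      (ContinuousMap.Homotopic.refl e.toFun).comp k.left_inv
    exact (h1.trans (h3.comp (ContinuousMap.Homotopic.refl e.invFun))).trans e.right_inv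
  · have : G.comp (e.toFun.comp k.invFun) = k.toFun.comp k.invFun := by
      rw [← hG]
      rfl
    rw [this]
    exact k.right_inv

theorem IsHomotopyEquiv.continuous {X Y : Type} [TopologicalSpace X] [TopologicalSpace Y]
    {f : X → Y} (hf : IsHomotopyEquiv f) : Continuous f := by
  obtain ⟨e, rfl⟩ := hf
  exact e.toFun.continuous

/-- A homotopy inverse of a map of sequences of spaces which, like the homotopies, is a map of
sequences. -/
structure SeqHomotopyInverse {X Y : ℕ → Type} [∀ k, TopologicalSpace (X k)]
    [∀ k, TopologicalSpace (Y k)] (ι : ∀ k, X k → X (k + 1)) (κ : ∀ k, Y k → Y (k + 1))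
    (f : ∀ k, X k → Y k) where
  inv : ∀ k, Y k → X k
  continuous_inv : ∀ k, Continuous (inv k)
  inv_map : ∀ k y, inv (k + 1) (κ k y) = ι k (inv k y)
  left : ∀ k, X k × I → X k
  continuous_left : ∀ k, Continuous (left k)
  left_map : ∀ k x t, left (k + 1) (ι k x, t) = ι k (left k (x, t))
  left_zero : ∀ k x, left k (x, 0) = x
  left_one : ∀ k x, left k (x, 1) = inv k (f k x)
  right : ∀ k, Y k × I → Y k
  continuous_right : ∀ k, Continuous (right k)
  right_map : ∀ k y t, right (k + 1) (κ k y, t) = κ k (right k (y, t))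
  right_zero : ∀ k y, right k (y, 0) = y
  right_one : ∀ k y, right k (y, 1) = f k (inv k y)

/-- The map from a term of a sequence to the direct limit. -/
def SeqLim.of {X : ℕ → Type} (ι : ∀ k, X k → X (k + 1)) (k : ℕ) (x : X k) : SeqLim X ι :=
  Quot.mk _ ⟨k, x⟩

theorem SeqLim.continuous_map {X Y : ℕ → Type} [∀ k, TopologicalSpace (X k)]
    [∀ k, TopologicalSpace (Y k)] {ι : ∀ k, X k → X (k + 1)} {κ : ∀ k, Y k → Y (k + 1)}
    (f : ∀ k, X k → Y k) (hf : ∀ k, Continuous (f k))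
    (h : ∀ k x, f (k + 1) (ι k x) = κ k (f k x)) : Continuous (SeqLim.map f h) := by
  refine continuous_quot_lift _ ?_
  refine continuous_quot_mk.comp (continuous_sigma fun k => ?_)
  exact continuous_sigmaMk.comp (hf k)

/-- A homotopy of a direct limit that is defined on the terms of the sequence. -/
def SeqLim.homotopy {X : ℕ → Type} {ι : ∀ k, X k → X (k + 1)} (H : ∀ k, X k × I → X k)
    (h : ∀ k x t, H (k + 1) (ι k x, t) = ι k (H k (x, t))) (p : SeqLim X ι × I) : SeqLim X ι :=
  SeqLim.map (fun k x => H k (x, p.2)) (fun k x => h k x p.2) p.1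

/-- The unit interval is locally compact, so the product of a quotient map with it is again a
quotient map. Continuity can thus be checked on the terms of the sequence, one at a time. -/
theorem SeqLim.continuous_homotopy {X : ℕ → Type} [∀ k, TopologicalSpace (X k)]
    {ι : ∀ k, X k → X (k + 1)} (H : ∀ k, X k × I → X k)
    (h : ∀ k x t, H (k + 1) (ι k x, t) = ι k (H k (x, t))) (hH : ∀ k, Continuous (H k)) :
    Continuous (SeqLim.homotopy H h) := by
  have hq : IsQuotientMap (Quot.mk _ : (Σ k, X k) → SeqLim X ι) := isQuotientMap_quot_mk
  refine hq.continuous_lift_prod_left ?_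
  have hs : Continuous fun p : Σ k, X k × I => (Quot.mk _ ⟨p.1, H p.1 p.2⟩ : SeqLim X ι) :=
    continuous_quot_mk.comp (continuous_sigma fun k => continuous_sigmaMk.comp (hH k))
  exact hs.comp (Homeomorph.sigmaProdDistrib (X := X) (Y := I)).continuous

namespace SeqHomotopyInverse

variable {X Y : ℕ → Type} [∀ k, TopologicalSpace (X k)] [∀ k, TopologicalSpace (Y k)]
  {ι : ∀ k, X k → X (k + 1)} {κ : ∀ k, Y k → Y (k + 1)} {f : ∀ k, X k → Y k}

theorem isHomotopyEquiv (e : SeqHomotopyInverse ι κ f) (hf : ∀ k, Continuous (f k)) (k : ℕ) :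
    IsHomotopyEquiv (f k) :=
  isHomotopyEquiv_of_homotopies (hf k) (e.continuous_inv k) (e.continuous_left k) (e.left_zero k)
    (e.left_one k) (e.continuous_right k) (e.right_zero k) (e.right_one k)

theorem isHomotopyEquiv_lim (e : SeqHomotopyInverse ι κ f) (hf : ∀ k, Continuous (f k))
    (h : ∀ k x, f (k + 1) (ι k x) = κ k (f k x)) : IsHomotopyEquiv (SeqLim.map f h) := by
  refine isHomotopyEquiv_of_homotopies (SeqLim.continuous_map f hf h)
    (SeqLim.continuous_map e.inv e.continuous_inv e.inv_map)
    (SeqLim.continuous_homotopy e.left e.left_map e.continuous_left) ?_ ?_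
    (SeqLim.continuous_homotopy e.right e.right_map e.continuous_right) ?_ ?_
  · rintro ⟨k, x⟩
    exact congrArg (SeqLim.of ι k) (e.left_zero k x)
  · rintro ⟨k, x⟩
    exact congrArg (SeqLim.of ι k) (e.left_one k x)
  · rintro ⟨k, x⟩
    exact congrArg (SeqLim.of κ k) (e.right_zero k x)
  · rintro ⟨k, x⟩
    exact congrArg (SeqLim.of κ k) (e.right_one k x)

end SeqHomotopyInverse

theorem IsHomotopyEquiv.sumMap {X X' Y Y' : Type} [TopologicalSpace X] [TopologicalSpace X']
    [TopologicalSpace Y] [TopologicalSpace Y'] {f : X → Y} {f' : X' → Y'}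
    (hf : IsHomotopyEquiv f) (hf' : IsHomotopyEquiv f') : IsHomotopyEquiv (Sum.map f f') := by
  obtain ⟨e, rfl⟩ := hf
  obtain ⟨e', rfl⟩ := hf'
  have key : ∀ {A B : Type} [TopologicalSpace A] [TopologicalSpace B] {a : C(A, A)} {b : C(B, B)},
      a.Homotopic (.id A) → b.Homotopic (.id B) →
        ∃ H : (A ⊕ B) × I → A ⊕ B, Continuous H ∧ (∀ x, H (x, 0) = x) ∧
          ∀ x, H (x, 1) = Sum.map a b x := by
    rintro A B _ _ a b ⟨F⟩ ⟨G⟩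
    let H : (A × I) ⊕ (B × I) → A ⊕ B :=
      Sum.map (fun p => F.symm (p.2, p.1)) (fun p => G.symm (p.2, p.1))
    have hH : Continuous H :=
      (F.symm.continuous.comp continuous_swap).sumMap (G.symm.continuous.comp continuous_swap)
    refine ⟨fun p => H (Homeomorph.sumProdDistrib p), hH.comp (Homeomorph.continuous _), ?_, ?_⟩
    · rintro (x | x)
      · exact congrArg Sum.inl (F.symm.apply_zero x)
      · exact congrArg Sum.inr (G.symm.apply_zero x)
    · rintro (x | x)
      · exact congrArg Sum.inl (F.symm.apply_one x)
      · exact congrArg Sum.inr (G.symm.apply_one x)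
  obtain ⟨H, hH, H0, H1⟩ := key e.left_inv e'.left_inv
  obtain ⟨K, hK, K0, K1⟩ := key e.right_inv e'.right_inv
  refine isHomotopyEquiv_of_homotopies (e.toFun.continuous.sumMap e'.toFun.continuous)
    (e.invFun.continuous.sumMap e'.invFun.continuous) hH H0 ?_ hK K0 ?_
  · rintro (x | x)
    · exact H1 _
    · exact H1 _
  · rintro (x | x)
    · exact K1 _
    · exact K1 _

end RationalLoops

namespace RationalLoops

open Topology unitInterval Filter Set

/-! ## Extension of continuous maps -/

/-- A function can be constructed on the union of an increasing sequence of sets by successive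
extension. -/
theorem exists_of_extension {α β : Type*} {X : ℕ → Set α} (hX : Monotone X)
    {p : ℕ → (α → β) → Prop} (hp : ∀ i f g, EqOn f g (X i) → p i f → p i g)
    (h0 : ∃ f, p 0 f) (h1 : ∀ i f, p i f → ∃ g, p (i + 1) g ∧ EqOn g f (X i)) :
    ∃ f, ∀ i, p i f := by
  classical
  choose! e he hee using h1
  obtain ⟨f0, hf0⟩ := h0
  let F : ℕ → α → β := fun i => Nat.rec f0 (fun i f => e i f) i
  have hF : ∀ i, p i (F i) := by
    intro i
    induction i with
    | zero => exact hf0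
    | succ i ih => exact he i _ ih
  have hst : ∀ i j, i ≤ j → EqOn (F j) (F i) (X i) := by
    intro i j hij
    induction j, hij using Nat.le_induction with
    | base => exact fun _ _ => rfl
    | succ j hj ih => exact fun x hx => (hee j _ (hF j) (hX hj hx)).trans (ih hx)
  -- The value at the first stage that contains `x` is kept by all later stages.
  let g : α → β := fun x => if h : ∃ i, x ∈ X i then F (Nat.find h) x else f0 x
  refine ⟨g, fun i => hp i (F i) g (fun x hx => ?_) (hF i)⟩
  have h : ∃ i, x ∈ X i := ⟨i, hx⟩
  simp only [g, dif_pos h]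
  exact hst _ _ (Nat.find_min' h hx) (Nat.find_spec h)

/-- A point of `X` outside one closed set is not in the closure of that piece, so continuity within
the piece is vacuous there. -/
theorem continuousOn_ite_closed {α β : Type*} [TopologicalSpace α] [TopologicalSpace β]
    {X Z₁ Z₂ : Set α} [DecidablePred (· ∈ Z₁)] (h₁ : IsClosed Z₁) (h₂ : IsClosed Z₂) {f g : α → β}
    (hf : ContinuousOn f (X ∩ Z₁)) (hg : ContinuousOn g (X ∩ Z₂))
    (h : ∀ x ∈ X, x ∈ Z₁ → x ∈ Z₂ → f x = g x) :
    ContinuousOn (fun x => if x ∈ Z₁ then f x else g x) (X ∩ (Z₁ ∪ Z₂)) := by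
  have e1 : EqOn (fun x => if x ∈ Z₁ then f x else g x) f (X ∩ Z₁) := fun x hx => if_pos hx.2
  have e2 : EqOn (fun x => if x ∈ Z₁ then f x else g x) g (X ∩ Z₂) := fun x hx => by
    by_cases hx1 : x ∈ Z₁
    · simp only [if_pos hx1]
      exact h x hx.1 hx1 hx.2
    · simp only [if_neg hx1]
  have c1 := hf.congr e1
  have c2 := hg.congr e2
  rw [inter_union_distrib_left]
  intro x hx
  refine continuousWithinAt_union.2 ⟨?_, ?_⟩
  · by_cases hx1 : x ∈ X ∩ Z₁
    · exact c1 x hx1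
    · refine continuousWithinAt_of_notMem_closure fun hc => hx1 ⟨?_, ?_⟩
      · exact hx.elim (·.1) (·.1)
      · exact closure_minimal inter_subset_right h₁ hc
  · by_cases hx1 : x ∈ X ∩ Z₂
    · exact c2 x hx1
    · refine continuousWithinAt_of_notMem_closure fun hc => hx1 ⟨?_, ?_⟩
      · exact hx.elim (·.1) (·.1)
      · exact closure_minimal inter_subset_right h₂ hc

/-- Tietze's theorem on the subspace `X`, which is normal because it is metrizable. `X` itself need
not be closed. -/
theorem exists_continuousOn_extension {α E : Type} [MetricSpace α] [TopologicalSpace E]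
    [TietzeExtension.{0, 0} E] [Nonempty E] {X Z : Set α} (hZ : IsClosed Z) {f : α → E}
    (hf : ContinuousOn f (X ∩ Z)) :
    ∃ g : α → E, ContinuousOn g X ∧ EqOn g f (X ∩ Z) := by
  classical
  have hc : IsClosed ((Subtype.val : X → α) ⁻¹' Z) := hZ.preimage continuous_subtype_val
  obtain ⟨g, hg⟩ := ContinuousMap.exists_restrict_eq hc
    ⟨fun x => f x.1.1, hf.comp_continuous (by fun_prop) fun x => ⟨x.1.2, x.2⟩⟩
  obtain ⟨e0⟩ := ‹Nonempty E›
  refine ⟨fun x => if h : x ∈ X then g ⟨x, h⟩ else e0, ?_, ?_⟩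
  · rw [continuousOn_iff_continuous_domRestrict]
    convert! g.continuous using 1
    ext x
    simp
  · intro x hx
    have := congrArg (fun k => k ⟨⟨x, hx.1⟩, hx.2⟩) hg
    simpa [hx.1] using! this

theorem AffineSubspace.add_smul_sub_mem {E : Type*} [AddCommGroup E] [Module ℝ E]
    (A : AffineSubspace ℝ E) {f w : E} (hf : f ∈ A) (hw : w ∈ A) (u : ℝ) :
    f + u • (w - f) ∈ A := by
  have := AffineMap.lineMap_mem u hf hw
  rwa [AffineMap.lineMap_apply, vsub_eq_sub, vadd_eq_add, add_comm] at this

/-- A base point `b` identifies `A` with its direction, a finite-dimensional vector space, where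
Tietze's theorem applies. -/
theorem exists_continuousOn_extension_affine {α E : Type} [MetricSpace α] [NormedAddCommGroup E]
    [NormedSpace ℝ E] (A : AffineSubspace ℝ E) [FiniteDimensional ℝ A.direction]
    (hA : (A : Set E).Nonempty) {X Z : Set α} (hZ : IsClosed Z) {f : α → E}
    (hf : ContinuousOn f (X ∩ Z)) (hfA : MapsTo f (X ∩ Z) A) :
    ∃ g : α → E, ContinuousOn g X ∧ MapsTo g X A ∧ EqOn g f (X ∩ Z) := by
  classical
  obtain ⟨b, hb⟩ := hA
  have : TietzeExtension.{0, 0} A.direction := TietzeExtension.of_tvs ℝ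
  let φ : α → A.direction := fun x =>
    if h : f x ∈ A then ⟨f x - b, AffineSubspace.vsub_mem_direction h hb⟩ else 0
  have hφ : ContinuousOn φ (X ∩ Z) := by
    rw [Topology.IsInducing.subtypeVal.continuousOn_iff]
    refine (hf.sub (continuousOn_const (c := b))).congr fun x hx => ?_
    have : f x ∈ A := hfA hx
    simp [φ, this]
  obtain ⟨g, hg, hgf⟩ := exists_continuousOn_extension hZ hφ
  refine ⟨fun x => (g x : E) + b, ?_, ?_, ?_⟩
  · exact (continuous_subtype_val.comp_continuousOn hg).add continuousOn_const
  · intro x _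
    exact AffineSubspace.vadd_mem_of_mem_direction (g x).2 hb
  · intro x hx
    have : f x ∈ A := hfA hx
    simp [hgf hx, φ, this]

/-! ## Sequences of open sets with convex fibres -/

/-- An increasing sequence of finite-dimensional affine spaces `A i` in which the open subsets
`A i ∩ U` are decomposed into the fibres of a function `type`. The number `size c` measures the
complexity of a fibre, and `std c` is its standard point. -/
structure FibredModel (B : Type) [NormedAddCommGroup B] [NormedSpace ℝ B] where
  A : ℕ → AffineSubspace ℝ B
  mono : Monotone A
  nonempty : ∀ i, (A i : Set B).Nonempty
  finiteDimensional : ∀ i, FiniteDimensional ℝ (A i).direction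
  U : Set B
  isOpen_U : IsOpen U
  nonempty_compl : Uᶜ.Nonempty
  C : Type
  type : B → C
  size : C → ℕ
  std : C → B
  exists_bound : ∀ i, ∃ N, ∀ f ∈ A i, f ∈ U → size (type f) ≤ N
  -- The limit `w` of standard points may differ from the standard point of `f₀`, since `f₀` can lie
  -- in a simpler fibre; what survives is that the segment from `f₀` to `w` stays in the fibre of
  -- `f₀`. The size is lower semicontinuous, and where it is locally constant the standard point is
  -- continuous.
  exists_limit : ∀ i (F : Ultrafilter B) (f₀ : B), f₀ ∈ A i → f₀ ∈ U → ↑F ≤ 𝓝 f₀ →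
    (∀ᶠ f in F, f ∈ A i ∧ f ∈ U) →
    ∃ w ∈ A i, Tendsto (fun f => std (type f)) F (𝓝 w) ∧
      (∀ u ∈ Icc (0 : ℝ) 1, f₀ + u • (w - f₀) ∈ U ∧ type (f₀ + u • (w - f₀)) = type f₀) ∧
      (∀ᶠ f in F, size (type f₀) ≤ size (type f)) ∧
      ((∀ᶠ f in F, size (type f) = size (type f₀)) → w = std (type f₀))

namespace FibredModel

variable {B : Type} [NormedAddCommGroup B] [NormedSpace ℝ B] (M : FibredModel B)

/-- The open subset of the `i`-th affine space. -/
def dom (i : ℕ) : Set B := (M.A i : Set B) ∩ M.U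

theorem dom_mono : Monotone M.dom := fun _ _ h => inter_subset_inter_left _ (M.mono h)

theorem isClosed_A (i : ℕ) : IsClosed (M.A i : Set B) := by
  have := M.finiteDimensional i
  exact AffineSubspace.closed_of_finiteDimensional (M.A i)

/-- The limit property for the principal ultrafilter at `f`: each fibre is star-shaped about its
standard point. -/
theorem std_mem {i : ℕ} {f : B} (hf : f ∈ M.dom i) :
    M.std (M.type f) ∈ M.A i ∧ ∀ u ∈ Icc (0 : ℝ) 1,
      f + u • (M.std (M.type f) - f) ∈ M.U ∧
        M.type (f + u • (M.std (M.type f) - f)) = M.type f := by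
  obtain ⟨w, hw, ht, hu, -, -⟩ := M.exists_limit i (pure f) f hf.1 hf.2 (pure_le_nhds f) hf
  have : w = M.std (M.type f) :=
    tendsto_nhds_unique ht (tendsto_pure_nhds _ _)
  subst this
  exact ⟨hw, hu⟩

/-- The complement of `U` together with the points of size less than `k`. -/
def lower (i k : ℕ) : Set B := {f | f ∈ M.dom i ∧ M.size (M.type f) < k} ∪ M.Uᶜ

/-- This is lower semicontinuity of the size: a limit in `U` of points of size less than `k` has
size less than `k`. -/
theorem isClosed_lower (i k : ℕ) : IsClosed (M.lower i k) := by
  rw [isClosed_iff_ultrafilter]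
  intro f F hF hl
  by_cases hf : f ∈ M.U
  swap
  · exact Or.inr hf
  have h1 : ∀ᶠ g in (F : Filter B), g ∈ M.dom i ∧ M.size (M.type g) < k := by
    filter_upwards [hl, hF (M.isOpen_U.mem_nhds hf)] with g hg hgU
    exact hg.resolve_right fun h => h hgU
  have hfA : f ∈ M.A i :=
    (M.isClosed_A i).mem_of_frequently_of_tendsto
      (Eventually.frequently (f := (F : Filter B)) (h1.mono fun g hg => hg.1.1)) hF
  obtain ⟨w, -, -, -, h2, -⟩ := M.exists_limit i F f hfA hf hF (h1.mono fun g hg => hg.1)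
  obtain ⟨g, hg1, hg2⟩ := (h1.and h2).exists
  exact Or.inl ⟨⟨hfA, hf⟩, hg2.trans_lt hg1.2⟩

/-- The points of the `i`-th space of size at least `k`. -/
def upper (i k : ℕ) : Set B := {f | f ∈ M.dom i ∧ k ≤ M.size (M.type f)}

theorem upper_mono (k : ℕ) : Monotone fun i => M.upper i k :=
  fun _ _ h _ hf => ⟨M.dom_mono h hf.1, hf.2⟩

theorem notMem_lower {i k : ℕ} {f : B} (hf : f ∈ M.upper i k) : f ∉ M.lower i k := by
  rintro (h | h)
  · exact absurd hf.2 h.2.not_ge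
  · exact h hf.1.2

/-- The set in question is the stratum of size exactly `k`, where the last clause of `exists_limit`
identifies the limit of the standard points. -/
theorem continuousOn_std (i k : ℕ) :
    ContinuousOn (fun f => M.std (M.type f)) (M.upper i k ∩ M.lower i (k + 1)) := by
  intro f hf
  have hs : ∀ g ∈ M.upper i k ∩ M.lower i (k + 1), M.size (M.type g) = k := by
    rintro g ⟨hg, h | h⟩
    · have := hg.2
      have := h.2
      omega
    · exact absurd hg.1.2 h
  rw [ContinuousWithinAt, tendsto_iff_ultrafilter]
  intro F hF
  have hF1 : ↑F ≤ 𝓝 f := hF.trans nhdsWithin_le_nhds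
  have hF2 : ∀ᶠ g in (F : Filter B), g ∈ M.upper i k ∩ M.lower i (k + 1) :=
    hF self_mem_nhdsWithin
  obtain ⟨w, -, ht, -, -, hw⟩ := M.exists_limit i F f hf.1.1.1 hf.1.1.2 hF1
    (hF2.mono fun g hg => hg.1.1)
  rwa [hw (hF2.mono fun g hg => (hs g hg).trans (hs f hf).symm)] at ht

/-- Data for moving the points of size `k` of the `i`-th space to the standard points of their
fibres: a map `e` and a cut-off function `l`. -/
structure IsMove (k i : ℕ) (p : B → B × ℝ) : Prop where
  continuousOn : ContinuousOn p (M.upper i k)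
  mem_A : ∀ f ∈ M.upper i k, (p f).1 ∈ M.A i
  mem_Icc : ∀ f ∈ M.upper i k, (p f).2 ∈ Icc (0 : ℝ) 1
  eq_std : ∀ f ∈ M.dom i, M.size (M.type f) = k → p f = (M.std (M.type f), 1)
  mem_U : ∀ f ∈ M.upper i k, (p f).2 ≠ 0 → ∀ u ∈ Icc (0 : ℝ) 1, f + u • ((p f).1 - f) ∈ M.U
  limit : ∀ (F : Ultrafilter B) (f₀ : B), f₀ ∈ M.dom i → M.size (M.type f₀) < k → ↑F ≤ 𝓝 f₀ →
    (∀ᶠ f in F, f ∈ M.upper i k ∧ (p f).2 ≠ 0) →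
    ∃ w, Tendsto (fun f => (p f).1) F (𝓝 w) ∧
      ∀ u ∈ Icc (0 : ℝ) 1, f₀ + u • (w - f₀) ∈ M.U ∧ M.type (f₀ + u • (w - f₀)) = M.type f₀

variable {M}

theorem IsMove.congr {k i : ℕ} {p q : B → B × ℝ} (hp : M.IsMove k i p)
    (h : EqOn p q (M.upper i k)) : M.IsMove k i q where
  continuousOn := hp.continuousOn.congr h.symm
  mem_A f hf := h hf ▸ hp.mem_A f hf
  mem_Icc f hf := h hf ▸ hp.mem_Icc f hf
  eq_std f hf hk := h ⟨hf, hk.ge⟩ ▸ hp.eq_std f hf hk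
  mem_U f hf h0 := by
    rw [← h hf] at h0 ⊢
    exact hp.mem_U f hf h0
  limit F f₀ hf₀ hk hF hev := by
    obtain ⟨w, hw, hu⟩ := hp.limit F f₀ hf₀ hk hF (by
      filter_upwards [hev] with f hf
      rw [h hf.1]
      exact hf)
    refine ⟨w, hw.congr' ?_, hu⟩
    filter_upwards [hev] with f hf
    rw [h hf.1]

/-- The set where a segment stays in an open set is open. -/
theorem isOpen_segment_mem {X B : Type} [TopologicalSpace X] [NormedAddCommGroup B]
    [NormedSpace ℝ B] {U : Set B} (hU : IsOpen U) {a b : X → B} (ha : Continuous a)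
    (hb : Continuous b) : IsOpen {x | ∀ u ∈ Icc (0 : ℝ) 1, a x + u • (b x - a x) ∈ U} := by
  let φ : C(X, C(I, B)) := ContinuousMap.curry
    ⟨fun p => a p.1 + (p.2 : ℝ) • (b p.1 - a p.1), by fun_prop⟩
  have := (ContinuousMap.isOpen_setOfPred_mapsTo (isCompact_univ (X := I)) hU).preimage φ.continuous
  convert! this using 1
  ext x
  simp only [mem_preimage, mem_ofPred_eq, MapsTo, mem_univ, true_imp_iff]
  exact ⟨fun h u => h u u.2, fun h u hu => h (x := ⟨u, hu⟩)⟩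

variable (M)

/-- The target `e` is extended by Tietze's theorem from `Z` and the stratum of size `k`. The cut-off
is then supported so close to the points where the move is already prescribed that, near points of
smaller size, `e` inherits the limits found there. -/
theorem exists_isMove_extension (k i : ℕ) (p₀ : B → B × ℝ) {Z : Set B} (hZ : IsClosed Z)
    (hc : ContinuousOn p₀ (M.upper i k ∩ Z)) (hA : ∀ f ∈ M.upper i k ∩ Z, (p₀ f).1 ∈ M.A i)
    (hI : ∀ f ∈ M.upper i k ∩ Z, (p₀ f).2 ∈ Icc (0 : ℝ) 1)
    (hs : ∀ f ∈ M.dom i ∩ Z, M.size (M.type f) = k → p₀ f = (M.std (M.type f), 1))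
    (hU : ∀ f ∈ M.upper i k ∩ Z, (p₀ f).2 ≠ 0 →
      ∀ u ∈ Icc (0 : ℝ) 1, f + u • ((p₀ f).1 - f) ∈ M.U)
    (hl : ∀ (F : Ultrafilter B) (f₀ : B), f₀ ∈ M.dom i → M.size (M.type f₀) < k → ↑F ≤ 𝓝 f₀ →
      (∀ᶠ f in F, f ∈ M.upper i k ∩ Z ∧ (p₀ f).2 ≠ 0) →
      ∃ w, Tendsto (fun f => (p₀ f).1) F (𝓝 w) ∧
        ∀ u ∈ Icc (0 : ℝ) 1, f₀ + u • (w - f₀) ∈ M.U ∧ M.type (f₀ + u • (w - f₀)) = M.type f₀) :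
    ∃ p, M.IsMove k i p ∧ EqOn p p₀ (M.upper i k ∩ Z) := by
  classical
  have := M.finiteDimensional i
  set X := M.upper i k with hX
  set Y := M.lower i (k + 1) with hY
  have hYc : IsClosed Y := M.isClosed_lower i (k + 1)
  have hXY : ∀ f ∈ X, f ∈ Y ↔ M.size (M.type f) = k := by
    intro f hf
    constructor
    · rintro (h | h)
      · have := hf.2
        have := h.2
        omega
      · exact absurd hf.1.2 h
    · exact fun h => Or.inl ⟨hf.1, by omega⟩
  have hs' : ∀ f ∈ X, f ∈ Z → f ∈ Y → p₀ f = (M.std (M.type f), 1) :=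
    fun f hf hfZ hfY => hs f ⟨hf.1, hfZ⟩ ((hXY f hf).1 hfY)
  obtain ⟨e, hec, heA, hee⟩ := exists_continuousOn_extension_affine (M.A i) (M.nonempty i)
    (X := X) (hZ.union hYc) (f := fun f => if f ∈ Z then (p₀ f).1 else M.std (M.type f))
    (continuousOn_ite_closed hZ hYc (continuous_fst.comp_continuousOn hc)
      (M.continuousOn_std i k) fun f hf hfZ hfY => by rw [hs' f hf hfZ hfY]) (by
      rintro f ⟨hf, hf'⟩
      by_cases hfZ : f ∈ Z
      · simp only [if_pos hfZ]
        exact hA f ⟨hf, hfZ⟩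
      · simp only [if_neg hfZ]
        exact (M.std_mem hf.1).1)
  have heZ : ∀ f ∈ X, f ∈ Z → e f = (p₀ f).1 := fun f hf hfZ => by
    rw [hee ⟨hf, Or.inl hfZ⟩]
    exact if_pos hfZ
  have heY : ∀ f ∈ X, f ∈ Y → e f = M.std (M.type f) := fun f hf hfY => by
    by_cases hfZ : f ∈ Z
    · rw [heZ f hf hfZ, hs' f hf hfZ hfY]
    · rw [hee ⟨hf, Or.inr hfY⟩]
      exact if_neg hfZ
  -- Distance to the points of size less than `k` and to the complement of `U`. It is positive on
  -- `X`, where nonemptiness of the complement keeps `infDist` meaningful.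
  let ω : B → ℝ := fun f => Metric.infDist f (M.lower i k)
  have hω : ∀ f ∈ X, 0 < ω f := fun f hf =>
    ((M.isClosed_lower i k).notMem_iff_infDist_pos
      (M.nonempty_compl.mono subset_union_right)).1 (M.notMem_lower hf)
  let S : Set B := {g | g ∈ X ∧ (g ∈ Y ∨ g ∈ Z ∧ (p₀ g).2 ≠ 0)}
  -- On `N` the pair of `f` and its target is closer to such a pair over `S` than `f` is to the
  -- smaller strata. As `f` tends to a smaller stratum, both distances tend to zero.
  let N : Set B := {f | f ∈ X ∧ (∀ u ∈ Icc (0 : ℝ) 1, f + u • (e f - f) ∈ M.U) ∧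
    ∃ g ∈ S, dist f g + dist (e f) (e g) < ω f}
  have hSN : S ⊆ N := by
    rintro f ⟨hf, h⟩
    refine ⟨hf, ?_, f, ⟨hf, h⟩, by simpa using! hω f hf⟩
    rcases h with h | ⟨hfZ, h⟩
    · rw [heY f hf h]
      exact fun u hu => ((M.std_mem hf.1).2 u hu).1
    · rw [heZ f hf hfZ]
      exact hU f ⟨hf, hfZ⟩ h
  obtain ⟨V, hV, hVN⟩ : ∃ V : Set B, IsOpen V ∧ X ∩ V = N := by
    have hec' : Continuous fun x : X => e x := continuousOn_iff_continuous_domRestrict.1 hec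
    have h1 : IsOpen ({x : X | ∀ u ∈ Icc (0 : ℝ) 1, (x : B) + u • (e x - x) ∈ M.U} ∩
        {x : X | ∃ g ∈ S, dist (x : B) g + dist (e x) (e g) < ω x}) := by
      refine (isOpen_segment_mem M.isOpen_U continuous_subtype_val hec').inter ?_
      have : {x : X | ∃ g ∈ S, dist (x : B) g + dist (e x) (e g) < ω x} =
          ⋃ g ∈ S, {x : X | dist (x : B) g + dist (e x) (e g) < ω x} := by
        ext x
        simp
      rw [this]
      refine isOpen_biUnion fun g _ => isOpen_lt ?_ ?_
      · exact (continuous_subtype_val.dist continuous_const).add (hec'.dist continuous_const)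
      · exact (Metric.continuous_infDist_pt _).comp continuous_subtype_val
    obtain ⟨V, hV, h2⟩ := isOpen_induced_iff.1 h1
    refine ⟨V, hV, ?_⟩
    ext f
    constructor
    · rintro ⟨hf, hfV⟩
      have : (⟨f, hf⟩ : X) ∈ Subtype.val ⁻¹' V := hfV
      rw [h2] at this
      exact ⟨hf, this⟩
    · rintro ⟨hf, h⟩
      have : (⟨f, hf⟩ : X) ∈ Subtype.val ⁻¹' V := by
        rw [h2]
        exact h
      exact ⟨hf, this⟩
  have hYV : ∀ f ∈ X, f ∈ Y → f ∈ V := fun f hf h =>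
    (hVN.symm.subset (hSN ⟨hf, Or.inl h⟩)).2
  have hZV : ∀ f ∈ X, f ∈ Z → f ∉ V → (p₀ f).2 = 0 := fun f hf hfZ hfV => by
    by_contra h
    exact hfV (hVN.symm.subset (hSN ⟨hf, Or.inr ⟨hfZ, h⟩⟩)).2
  obtain ⟨l, hlc, hll⟩ := exists_continuousOn_extension (X := X)
    (hZ.union (hYc.union hV.isClosed_compl))
    (f := fun f => if f ∈ Z then (p₀ f).2 else if f ∈ Y then (1 : ℝ) else 0) (by
      refine continuousOn_ite_closed hZ (hYc.union hV.isClosed_compl)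
        (continuous_snd.comp_continuousOn hc) ?_ ?_
      · exact continuousOn_ite_closed hYc hV.isClosed_compl continuousOn_const
          continuousOn_const fun f hf h h' => absurd (hYV f hf h) h'
      · intro f hf hfZ h
        by_cases hfY : f ∈ Y
        · rw [if_pos hfY, hs' f hf hfZ hfY]
        · rw [if_neg hfY]
          exact hZV f hf hfZ (h.resolve_left hfY))
  have hlZ : ∀ f ∈ X, f ∈ Z → l f = (p₀ f).2 := fun f hf hfZ => by
    rw [hll ⟨hf, Or.inl hfZ⟩]
    exact if_pos hfZ
  have hlY : ∀ f ∈ X, f ∈ Y → l f = 1 := fun f hf hfY => by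
    by_cases hfZ : f ∈ Z
    · rw [hlZ f hf hfZ, hs' f hf hfZ hfY]
    · rw [hll ⟨hf, Or.inr (Or.inl hfY)⟩]
      simp only [if_neg hfZ, if_pos hfY]
  have hlV : ∀ f ∈ X, f ∉ V → l f = 0 := fun f hf hfV => by
    by_cases hfZ : f ∈ Z
    · rw [hlZ f hf hfZ, hZV f hf hfZ hfV]
    · rw [hll ⟨hf, Or.inr (Or.inr hfV)⟩]
      simp only [if_neg hfZ, if_neg fun h => hfV (hYV f hf h)]
  -- The extension given by Tietze's theorem is an arbitrary real function; clamping it to the unit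
  -- interval does not affect the prescribed values.
  let cl : ℝ → ℝ := fun x => max 0 (min 1 x)
  have hclI : ∀ x ∈ Icc (0 : ℝ) 1, cl x = x := fun x hx => by
    simp [cl, hx.1, hx.2]
  have hcl0 : cl 0 = 0 := hclI 0 (by simp)
  have hcl1 : cl 1 = 1 := hclI 1 (by simp)
  have hN : ∀ f ∈ X, cl (l f) ≠ 0 → f ∈ N := fun f hf h => by
    by_contra hfN
    refine h ?_
    rw [hlV f hf fun hfV => hfN (hVN.subset ⟨hf, hfV⟩), hcl0]
  refine ⟨fun f => (e f, cl (l f)), ⟨?_, heA, ?_, ?_, ?_, ?_⟩, ?_⟩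
  · exact hec.prodMk ((by fun_prop : Continuous cl).comp_continuousOn hlc)
  · exact fun f _ => ⟨le_max_left _ _, max_le zero_le_one (min_le_left _ _)⟩
  · intro f hf hk
    have hfX : f ∈ X := ⟨hf, hk.ge⟩
    have hfY := (hXY f hfX).2 hk
    rw [heY f hfX hfY, hlY f hfX hfY, hcl1]
  · exact fun f hf h => (hN f hf h).2.1
  · intro F f₀ hf₀ hk hF hev
    have hevN : ∀ᶠ f in (F : Filter B), f ∈ N := hev.mono fun f hf => hN f hf.1 hf.2
    choose! g hgS hg using fun (f : B) (hf : f ∈ N) => hf.2.2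
    have hω0 : Tendsto ω F (𝓝 0) := by
      have h1 : Tendsto (fun f => dist f f₀) F (𝓝 0) := tendsto_iff_dist_tendsto_zero.1 hF
      exact squeeze_zero (fun f => Metric.infDist_nonneg)
        (fun f => Metric.infDist_le_dist_of_mem (Or.inl ⟨hf₀, hk⟩)) h1
    have hd : Tendsto (fun f => dist f (g f)) F (𝓝 0) := by
      refine squeeze_zero' (Eventually.of_forall fun f => dist_nonneg) ?_ hω0
      filter_upwards [hevN] with f hf
      have := hg f hf
      have : 0 ≤ dist (e f) (e (g f)) := dist_nonneg
      linarith
    have hd' : Tendsto (fun f => dist (e f) (e (g f))) F (𝓝 0) := by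
      refine squeeze_zero' (Eventually.of_forall fun f => dist_nonneg) ?_ hω0
      filter_upwards [hevN] with f hf
      have := hg f hf
      have : 0 ≤ dist f (g f) := dist_nonneg
      linarith
    have hgF : Tendsto g F (𝓝 f₀) := Tendsto.congr_dist (f₁ := id) hF hd
    have hgF' : ↑(F.map g) ≤ 𝓝 f₀ := hgF
    have key : ∃ w, Tendsto (fun f => e (g f)) F (𝓝 w) ∧
        ∀ u ∈ Icc (0 : ℝ) 1, f₀ + u • (w - f₀) ∈ M.U ∧
          M.type (f₀ + u • (w - f₀)) = M.type f₀ := by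
      -- An ultrafilter decides between the two sources of `S`: points of size `k`, controlled by
      -- `exists_limit`, and points of `Z` with nonzero cut-off, controlled by `hl`.
      have hor : ∀ᶠ f in (F : Filter B),
          (g f ∈ X ∧ g f ∈ Y) ∨ (g f ∈ X ∩ Z ∧ (p₀ (g f)).2 ≠ 0) := by
        filter_upwards [hevN] with f hf
        obtain ⟨h1, h2 | h2⟩ := hgS f hf
        · exact Or.inl ⟨h1, h2⟩
        · exact Or.inr ⟨⟨h1, h2.1⟩, h2.2⟩
      rcases Ultrafilter.eventually_or.1 hor with h | h
      · obtain ⟨w, -, hw, hu, -⟩ := M.exists_limit i (F.map g) f₀ hf₀.1 hf₀.2 hgF'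
          (h.mono fun f hf => hf.1.1)
        refine ⟨w, Tendsto.congr' ?_ (tendsto_map'_iff.1 hw), hu⟩
        filter_upwards [h] with f hf
        exact (heY _ hf.1 hf.2).symm
      · obtain ⟨w, hw, hu⟩ := hl (F.map g) f₀ hf₀ hk hgF' h
        refine ⟨w, Tendsto.congr' ?_ (tendsto_map'_iff.1 hw), hu⟩
        filter_upwards [h] with f hf
        exact (heZ _ hf.1.1 hf.1.2).symm
    obtain ⟨w, hw, hu⟩ := key
    exact ⟨w, hw.congr_dist (by simpa only [dist_comm] using hd'), hu⟩
  · rintro f ⟨hf, hfZ⟩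
    refine Prod.ext (heZ f hf hfZ) ?_
    change cl (l f) = _
    rw [hlZ f hf hfZ, hclI _ (hI f ⟨hf, hfZ⟩)]

/-- One move serves all `i` at once: it is extended from each affine space to the next, with the
smaller affine space in the role of `Z`. This makes the homotopies compatible with stabilization. -/
theorem exists_isMove (k : ℕ) : ∃ p, ∀ i, M.IsMove k i p := by
  refine exists_of_extension (M.upper_mono k) (p := fun i p => M.IsMove k i p)
    (fun i p q h hp => hp.congr h) ?_ ?_
  · obtain ⟨p, hp, -⟩ := M.exists_isMove_extension k 0 (fun _ => 0) isClosed_empty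
      (by simp) (by simp) (by simp) (by simp) (by simp) (by
        intro F f₀ _ _ _ h
        obtain ⟨f, hf⟩ := h.exists
        exact hf.1.2.elim)
    exact ⟨p, hp⟩
  · intro i p hp
    have hXi : ∀ f, f ∈ M.upper (i + 1) k ∩ M.A i ↔ f ∈ M.upper i k := fun f =>
      ⟨fun h => ⟨⟨h.2, h.1.1.2⟩, h.1.2⟩, fun h => ⟨M.upper_mono k (Nat.le_succ i) h, h.1.1⟩⟩
    have hXi' : M.upper (i + 1) k ∩ M.A i = M.upper i k := Set.ext hXi
    obtain ⟨q, hq, hqp⟩ := M.exists_isMove_extension k (i + 1) p (M.isClosed_A i)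
      (by rw [hXi']; exact hp.continuousOn)
      (fun f hf => M.mono (Nat.le_succ i) (hp.mem_A f ((hXi f).1 hf)))
      (fun f hf => hp.mem_Icc f ((hXi f).1 hf))
      (fun f hf hk => hp.eq_std f ⟨hf.2, hf.1.2⟩ hk)
      (fun f hf => hp.mem_U f ((hXi f).1 hf))
      (by
        intro F f₀ hf₀ hk hF hev
        have hA : f₀ ∈ M.A i := (M.isClosed_A i).mem_of_frequently_of_tendsto
          (Eventually.frequently (f := (F : Filter B)) (hev.mono fun f hf => hf.1.2)) hF
        exact hp.limit F f₀ ⟨hA, hf₀.2⟩ hk hF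
          (hev.mono fun f hf => ⟨(hXi f).1 hf.1, hf.2⟩))
    exact ⟨q, hq, by rwa [hXi'] at hqp⟩

end FibredModel

end RationalLoops

namespace RationalLoops

open Topology unitInterval Filter Set

/-! ### Contracting the fibres in order of their size -/

namespace FibredModel

variable {B : Type} [NormedAddCommGroup B] [NormedSpace ℝ B] (M : FibredModel B)

/-- A choice of a move for every size. -/
noncomputable def move (k : ℕ) : B → B × ℝ := (M.exists_isMove k).choose

theorem isMove (k i : ℕ) : M.IsMove k i (M.move k) := (M.exists_isMove k).choose_spec i

open Classical in
/-- The homotopy that moves the points of size `k` to the standard points of their fibres and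
fixes all points of smaller size. -/
noncomputable def push (k : ℕ) (u : ℝ) (f : B) : B :=
  if M.size (M.type f) < k then f else f + (u * (M.move k f).2) • ((M.move k f).1 - f)

theorem push_of_lt {k : ℕ} {f : B} (h : M.size (M.type f) < k) (u : ℝ) : M.push k u f = f :=
  if_pos h

theorem push_of_le {k : ℕ} {f : B} (h : k ≤ M.size (M.type f)) (u : ℝ) :
    M.push k u f = f + (u * (M.move k f).2) • ((M.move k f).1 - f) :=
  if_neg h.not_gt

theorem push_zero (k : ℕ) (f : B) : M.push k 0 f = f := by
  rw [push]
  split_ifs <;> simp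

theorem push_of_eq {k i : ℕ} {f : B} (hf : f ∈ M.dom i) (h : M.size (M.type f) = k) (u : ℝ) :
    M.push k u f = f + u • (M.std (M.type f) - f) := by
  rw [push_of_le M h.ge, (M.isMove k i).eq_std f hf h]
  simp

theorem push_mem {k i : ℕ} {u : ℝ} (hu : u ∈ Icc (0 : ℝ) 1) {f : B} (hf : f ∈ M.dom i) :
    M.push k u f ∈ M.dom i := by
  by_cases h : M.size (M.type f) < k
  · rwa [push_of_lt M h]
  rw [push_of_le M (not_lt.1 h)]
  have hX : f ∈ M.upper i k := ⟨hf, not_lt.1 h⟩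
  have hI := (M.isMove k i).mem_Icc f hX
  refine ⟨AffineSubspace.add_smul_sub_mem _ hf.1 ((M.isMove k i).mem_A f hX) _, ?_⟩
  by_cases h0 : (M.move k f).2 = 0
  · rw [h0]
    simpa using hf.2
  · exact (M.isMove k i).mem_U f hX h0 _ ⟨mul_nonneg hu.1 hI.1, mul_le_one₀ hu.2 hI.1 hI.2⟩

/-- A function of the points of the `i`-th space is constant on the fibres of size less than
`k`. -/
def ConstBelow {W : Type} (i k : ℕ) (F : M.dom i → W) : Prop :=
  ∀ f g : M.dom i, M.type f = M.type g → M.size (M.type f) < k → F f = F g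

/-- `push` as a map of the `i`-th space. -/
noncomputable def pushOn (k i : ℕ) (u : I) (f : M.dom i) : M.dom i :=
  ⟨M.push k u f, M.push_mem u.2 f.2⟩

/-- At a point `f₀` of size less than `k`, which `push k` fixes, the images of nearby points may
converge to a point other than `f₀`. That limit lies on the segment from `f₀` to `w`, hence in the
fibre of `f₀`, and `F` does not see the difference. At the other points `push k` is itself
continuous, because nearby sizes are at least `k`. -/
theorem continuous_comp_push {Z W : Type} [TopologicalSpace Z] [TopologicalSpace W] {k i : ℕ}
    {F : Z × M.dom i → W} (hF : Continuous F) (hc : ∀ z, M.ConstBelow i k fun f => F (z, f))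
    {u : Z → I} (hu : Continuous u) :
    Continuous fun p : Z × M.dom i => F (p.1, M.pushOn k i (u p.1) p.2) := by
  rw [continuous_iff_ultrafilter]
  rintro ⟨z₀, f₀⟩ G hG
  have hz : Tendsto (fun p : Z × M.dom i => p.1) G (𝓝 z₀) :=
    (continuous_fst.tendsto (z₀, f₀)).mono_left hG
  have hf' : Tendsto (fun p : Z × M.dom i => p.2) G (𝓝 f₀) :=
    (continuous_snd.tendsto (z₀, f₀)).mono_left hG
  have hf : Tendsto (fun p : Z × M.dom i => (p.2 : B)) G (𝓝 f₀) :=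
    (continuous_subtype_val.tendsto f₀).comp hf'
  have huz : Tendsto (fun p : Z × M.dom i => ((u p.1 : I) : ℝ)) G (𝓝 (u z₀)) :=
    ((continuous_subtype_val.comp hu).tendsto z₀).comp hz
  have key : ∀ L : M.dom i, Tendsto (fun p : Z × M.dom i => M.push k (u p.1) p.2) G (𝓝 (L : B)) →
      F (z₀, L) = F (z₀, M.pushOn k i (u z₀) f₀) →
      Tendsto (fun p : Z × M.dom i => F (p.1, M.pushOn k i (u p.1) p.2)) G
        (𝓝 (F (z₀, M.pushOn k i (u z₀) f₀))) := by
    intro L hL e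
    rw [← e]
    refine (hF.tendsto (z₀, L)).comp ?_
    rw [nhds_prod_eq]
    exact hz.prodMk (tendsto_subtype_rng.2 hL)
  by_cases hk : M.size (M.type (f₀ : B)) < k
  · have he : M.pushOn k i (u z₀) f₀ = f₀ := Subtype.ext (M.push_of_lt hk _)
    have hor : ∀ᶠ p in (G : Filter (Z × M.dom i)),
        (M.push k (u p.1) p.2 = p.2) ∨ ((p.2 : B) ∈ M.upper i k ∧ (M.move k p.2).2 ≠ 0) := by
      refine Eventually.of_forall fun p => ?_
      by_cases h1 : M.size (M.type (p.2 : B)) < k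
      · exact Or.inl (M.push_of_lt h1 _)
      by_cases h2 : (M.move k p.2).2 = 0
      · left
        rw [push_of_le M (not_lt.1 h1), h2]
        simp
      · exact Or.inr ⟨⟨p.2.2, not_lt.1 h1⟩, h2⟩
    rcases Ultrafilter.eventually_or.1 hor with h | h
    · refine key f₀ (hf.congr' ?_) (by rw [he])
      filter_upwards [h] with p hp
      exact hp.symm
    · obtain ⟨w, hw, hwU⟩ := (M.isMove k i).limit (G.map fun p : Z × M.dom i => (p.2 : B)) f₀ f₀.2 hk hf h
      have hlI : Tendsto (fun p : Z × M.dom i => (M.move k p.2).2) G (𝓟 (Icc (0 : ℝ) 1)) := by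
        rw [tendsto_principal]
        exact h.mono fun p hp => (M.isMove k i).mem_Icc _ hp.1
      -- The cut-off need not converge to its value at `f₀`; compactness of the unit interval
      -- provides some limit `l`, and any value will do.
      obtain ⟨l, hl, hlG⟩ := isCompact_Icc.ultrafilter_le_nhds
        (G.map fun p : Z × M.dom i => (M.move k p.2).2) hlI
      have hlG' : Tendsto (fun p : Z × M.dom i => (M.move k p.2).2) G (𝓝 l) := hlG
      have hwA : w ∈ M.A i := (M.isClosed_A i).mem_of_frequently_of_tendsto
        (Eventually.frequently (f := (G : Filter (Z × M.dom i)))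
          (h.mono fun p hp => (M.isMove k i).mem_A _ hp.1)) hw
      have hul : (u z₀ : ℝ) * l ∈ Icc (0 : ℝ) 1 :=
        ⟨mul_nonneg (u z₀).2.1 hl.1, mul_le_one₀ (u z₀).2.2 hl.1 hl.2⟩
      obtain ⟨hU, ht⟩ := hwU _ hul
      refine key ⟨_, AffineSubspace.add_smul_sub_mem _ f₀.2.1 hwA _, hU⟩ ?_ ?_
      · have : Tendsto (fun p : Z × M.dom i =>
            (p.2 : B) + ((u p.1 : ℝ) * (M.move k p.2).2) • ((M.move k p.2).1 - p.2)) G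
            (𝓝 ((f₀ : B) + ((u z₀ : ℝ) * l) • (w - f₀))) :=
          hf.add ((huz.mul hlG').smul ((tendsto_map'_iff.1 hw).sub hf))
        refine this.congr' ?_
        filter_upwards [h] with p hp
        exact (M.push_of_le hp.1.2 _).symm
      · rw [he]
        exact hc z₀ _ _ ht (by
          change M.size (M.type (_ + _)) < k
          rwa [ht])
  · have hX : (f₀ : B) ∈ M.upper i k := ⟨f₀.2, not_lt.1 hk⟩
    obtain ⟨-, -, -, -, hsz, -⟩ := M.exists_limit i (G.map fun p : Z × M.dom i => (p.2 : B)) f₀ f₀.2.1 f₀.2.2 hf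
      (Eventually.of_forall (f := (G : Filter (Z × M.dom i))) fun p => p.2.2)
    have hsz' : ∀ᶠ p in (G : Filter (Z × M.dom i)), (p.2 : B) ∈ M.upper i k := by
      have : ∀ᶠ p in (G : Filter (Z × M.dom i)),
        M.size (M.type (f₀ : B)) ≤ M.size (M.type (p.2 : B)) := hsz
      filter_upwards [this] with p hp
      exact ⟨p.2.2, (not_lt.1 hk).trans hp⟩
    have hm : Tendsto (fun p : Z × M.dom i => M.move k p.2) G (𝓝 (M.move k f₀)) := by
      refine ((M.isMove k i).continuousOn f₀ hX).tendsto.comp ?_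
      exact tendsto_nhdsWithin_iff.2 ⟨hf, hsz'⟩
    refine key (M.pushOn k i (u z₀) f₀) ?_ rfl
    have : Tendsto (fun p : Z × M.dom i =>
        (p.2 : B) + ((u p.1 : ℝ) * (M.move k p.2).2) • ((M.move k p.2).1 - p.2)) G
        (𝓝 ((f₀ : B) + ((u z₀ : ℝ) * (M.move k f₀).2) • ((M.move k f₀).1 - f₀))) :=
      hf.add ((huz.mul ((continuous_snd.tendsto _).comp hm)).smul
        (((continuous_fst.tendsto _).comp hm).sub hf))
    have e : ((M.pushOn k i (u z₀) f₀ : M.dom i) : B) =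
        (f₀ : B) + ((u z₀ : ℝ) * (M.move k f₀).2) • ((M.move k f₀).1 - f₀) :=
      M.push_of_le hX.2 _
    rw [e]
    refine this.congr' ?_
    filter_upwards [hsz'] with p hp
    exact (M.push_of_le hp.2 _).symm

/-- The composite of the homotopies `push 0`, `push 1`, …, `push (k - 1)` at times `u 0`, `u 1`,
…, where `push (k - 1)` is applied first. -/
noncomputable def pushes (u : ℕ → ℝ) : ℕ → B → B
  | 0, f => f
  | k + 1, f => pushes u k (M.push k (u k) f)

theorem pushes_mem {u : ℕ → ℝ} (hu : ∀ k, u k ∈ Icc (0 : ℝ) 1) {i : ℕ} (k : ℕ) {f : B}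
    (hf : f ∈ M.dom i) : M.pushes u k f ∈ M.dom i := by
  induction k generalizing f with
  | zero => exact hf
  | succ k ih => exact ih (M.push_mem (hu k) hf)

theorem pushes_of_zero {u : ℕ → ℝ} (k : ℕ) (h : ∀ j < k, u j = 0) (f : B) :
    M.pushes u k f = f := by
  induction k generalizing f with
  | zero => rfl
  | succ k ih =>
    rw [pushes, h k (Nat.lt_succ_self k), push_zero]
    exact ih (fun j hj => h j (hj.trans (Nat.lt_succ_self k))) f

theorem pushes_congr {u v : ℕ → ℝ} (k : ℕ) (h : ∀ j < k, u j = v j) (f : B) :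
    M.pushes u k f = M.pushes v k f := by
  induction k generalizing f with
  | zero => rfl
  | succ k ih =>
    rw [pushes, pushes, h k (Nat.lt_succ_self k)]
    exact ih (fun j hj => h j (hj.trans (Nat.lt_succ_self k))) _

theorem pushes_of_size_lt {u : ℕ → ℝ} {k l : ℕ} {f : B} (h : M.size (M.type f) < k)
    (hkl : k ≤ l) : M.pushes u l f = M.pushes u k f := by
  induction l, hkl using Nat.le_induction with
  | base => rfl
  | succ l hl ih => rw [pushes, push_of_lt M (h.trans_le hl), ih]

/-- The composite of all homotopies `push k` at times `u k`. -/
noncomputable def total (u : ℕ → ℝ) (f : B) : B := M.pushes u (M.size (M.type f) + 1) f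

theorem total_eq {u : ℕ → ℝ} {k : ℕ} {f : B} (h : M.size (M.type f) < k) :
    M.total u f = M.pushes u k f :=
  (M.pushes_of_size_lt (Nat.lt_succ_self _) h).symm

theorem total_mem {u : ℕ → ℝ} (hu : ∀ k, u k ∈ Icc (0 : ℝ) 1) {i : ℕ} {f : B}
    (hf : f ∈ M.dom i) : M.total u f ∈ M.dom i := M.pushes_mem hu _ hf

/-- The composite of the final maps of the first `k` homotopies is constant on the fibres of size
less than `k`. -/
theorem pushes_one_eq {i k : ℕ} {u : ℕ → ℝ} (hu : ∀ j < k, u j = 1) {f g : B} (hf : f ∈ M.dom i)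
    (hg : g ∈ M.dom i) (h : M.type f = M.type g) (hk : M.size (M.type f) < k) :
    M.pushes u k f = M.pushes u k g := by
  induction k with
  | zero => omega
  | succ k ih =>
    have hu' : ∀ j < k, u j = 1 := fun j hj => hu j (hj.trans (Nat.lt_succ_self k))
    rw [pushes, pushes, hu k (Nat.lt_succ_self k)]
    rcases Nat.lt_succ_iff_lt_or_eq.1 hk with hk | hk
    · rw [push_of_lt M hk, push_of_lt M (h ▸ hk)]
      exact ih hu' hk
    · rw [M.push_of_eq hf hk, M.push_of_eq hg (h ▸ hk), h]
      simp

/-- The composites of the homotopies map fibres of size less than `k` to fibres if `push j` only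
begins when `push (j + 1)` has ended. -/
theorem type_pushes_eq {i k : ℕ} {u : ℕ → ℝ} (hu : ∀ j, u j ∈ Icc (0 : ℝ) 1)
    (hu' : ∀ j, u j ≠ 0 → u (j + 1) = 1) {f g : B} (hf : f ∈ M.dom i) (hg : g ∈ M.dom i)
    (h : M.type f = M.type g) (hk : M.size (M.type f) < k) :
    M.type (M.pushes u k f) = M.type (M.pushes u k g) := by
  induction k with
  | zero => omega
  | succ k ih =>
    rw [pushes, pushes]
    rcases Nat.lt_succ_iff_lt_or_eq.1 hk with hk | hk
    · rw [push_of_lt M hk, push_of_lt M (h ▸ hk)]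
      exact ih hk
    · rw [M.push_of_eq hf hk, M.push_of_eq hg (h ▸ hk)]
      by_cases h1 : u k = 1
      · rw [h1, h]
        simp
      -- If some push of smaller index had begun, `push k` would be finished. So only `push k` acts,
      -- and it moves both points inside their common fibre.
      · have h0 : ∀ j < k, u j = 0 := by
          by_contra! hne
          obtain ⟨j, hj, hne⟩ := hne
          have : ∀ l, j < l → u l = 1 := by
            intro l hl
            induction l, hl using Nat.le_induction with
            | base => exact hu' j hne
            | succ l hl ih => exact hu' l (by rw [ih]; exact one_ne_zero)
          exact h1 (this k hj)
        rw [pushes_of_zero M k h0, pushes_of_zero M k h0]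
        rw [((M.std_mem hf).2 _ (hu k)).2, ((M.std_mem hg).2 _ (hu k)).2, h]

/-- `pushes` as a map of the `i`-th space. -/
noncomputable def pushesOn (i k : ℕ) (u : ℕ → I) (f : M.dom i) : M.dom i :=
  ⟨M.pushes (fun j => u j) k f, M.pushes_mem (fun j => (u j).2) k f.2⟩

/-- When `push k` is under way, all pushes of smaller index are complete, and their composite is
constant on the fibres of size less than `k`. This is the condition under which
`continuous_comp_push` absorbs the jumps of `push k`. -/
theorem continuous_pushesOn {i : ℕ} (k : ℕ) {Z : Type} [TopologicalSpace Z] {u : Z → ℕ → I}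
    (hu : ∀ j, Continuous fun z => u z j) (hu' : ∀ z j, u z (j + 1) ≠ 0 → u z j = 1) :
    Continuous fun p : Z × M.dom i => M.pushesOn i k (u p.1) p.2 := by
  induction k generalizing u with
  | zero => exact continuous_snd
  | succ k ih =>
    have h1 : ∀ z, u z k ≠ 0 → ∀ j < k, u z j = 1 := by
      intro z hz j hj
      refine Nat.decreasingInduction' (P := fun l => u z l ≠ 0 ∧ (l < k → u z l = 1))
        (fun l hl _ h => ?_) hj.le ⟨hz, fun h => absurd h (lt_irrefl k)⟩ |>.2 hj
      have := hu' z l h.1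
      exact ⟨by rw [this]; exact one_ne_zero, fun _ => this⟩
    have h2 : Continuous fun p : Z × M.dom i =>
        M.pushesOn i k (fun _ => 1) (M.pushOn k i (u p.1 k) p.2) := by
      refine M.continuous_comp_push (F := fun p => M.pushesOn i k (fun _ => 1) p.2)
        (ih (u := fun _ _ => 1) (fun _ => continuous_const) fun _ _ _ => rfl) ?_ (hu k)
      intro z f g h hk
      exact Subtype.ext (M.pushes_one_eq (fun _ _ => rfl) f.2 g.2 h hk)
    -- Two closed sets cover the product: times at which `push k` has not begun, and times at which
    -- all earlier pushes have ended.
    have hc1 : IsClosed {p : Z × M.dom i | u p.1 k = 0} :=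
      isClosed_eq ((hu k).comp continuous_fst) continuous_const
    have hc2 : IsClosed {p : Z × M.dom i | ∀ j < k, u p.1 j = 1} := by
      have : {p : Z × M.dom i | ∀ j < k, u p.1 j = 1} = ⋂ j, ⋂ _ : j < k, {p | u p.1 j = 1} := by
        ext p
        simp
      rw [this]
      exact isClosed_iInter fun j => isClosed_iInter fun _ =>
        isClosed_eq ((hu j).comp continuous_fst) continuous_const
    rw [← continuousOn_univ]
    have huniv : (univ : Set (Z × M.dom i)) = {p | u p.1 k = 0} ∪ {p | ∀ j < k, u p.1 j = 1} := by
      refine (eq_univ_of_forall fun p => ?_).symm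
      by_cases h : u p.1 k = 0
      · exact Or.inl h
      · exact Or.inr (h1 p.1 h)
    rw [huniv]
    refine ContinuousOn.union_of_isClosed ?_ ?_ hc1 hc2
    · refine (ih hu hu').continuousOn.congr fun p hp => Subtype.ext ?_
      change M.pushes _ k (M.push k (u p.1 k) p.2) = M.pushes _ k p.2
      have : u p.1 k = 0 := hp
      rw [this, Icc.coe_zero, push_zero]
    · refine h2.continuousOn.congr fun p hp => Subtype.ext ?_
      exact M.pushes_congr k (fun j hj => congrArg Subtype.val (hp j hj)) _

/-- In this order the pushes map fibres to fibres, so a map constant on all fibres remains constant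
on those of size less than `k` after `pushes`. Again `continuous_comp_push` applies at every stage.
-/
theorem continuous_comp_pushesOn {i : ℕ} (k : ℕ) {Z W : Type} [TopologicalSpace Z]
    [TopologicalSpace W] {F : M.dom i → W} (hF : Continuous F)
    (hc : ∀ f g : M.dom i, M.type f = M.type g → F f = F g) {u : Z → ℕ → I}
    (hu : ∀ j, Continuous fun z => u z j) (hu' : ∀ z j, u z j ≠ 0 → u z (j + 1) = 1) :
    Continuous fun p : Z × M.dom i => F (M.pushesOn i k (u p.1) p.2) := by
  induction k with
  | zero => exact hF.comp continuous_snd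
  | succ k ih =>
    refine M.continuous_comp_push (F := fun p => F (M.pushesOn i k (u p.1) p.2)) ih ?_ (hu k)
    intro z f g h hk
    refine hc _ _ (M.type_pushes_eq (fun j => (u z j).2) (fun j hj => ?_) f.2 g.2 h hk)
    exact congrArg Subtype.val (hu' z j fun h0 => hj (congrArg Subtype.val h0))

/-- `total` as a map of the `i`-th space. -/
noncomputable def totalOn (i : ℕ) (u : ℕ → I) (f : M.dom i) : M.dom i :=
  ⟨M.total (fun j => u j) f, M.total_mem (fun j => (u j).2) f.2⟩

/-- Sizes are bounded on the `i`-th space, so `total` is a composite of a fixed finite number of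
pushes there, and the continuity results apply. -/
theorem exists_totalOn_eq (i : ℕ) : ∃ k, ∀ u f, M.totalOn i u f = M.pushesOn i k u f := by
  obtain ⟨N, hN⟩ := M.exists_bound i
  exact ⟨N + 1, fun u f => Subtype.ext (M.total_eq (Nat.lt_succ_of_le (hN f f.2.1 f.2.2)))⟩

theorem totalOn_zero (i : ℕ) (f : M.dom i) : M.totalOn i (fun _ => 0) f = f :=
  Subtype.ext (M.pushes_of_zero _ (fun _ _ => rfl) _)

theorem totalOn_one_eq {i : ℕ} {f g : M.dom i} (h : M.type f = M.type g) :
    M.totalOn i (fun _ => 1) f = M.totalOn i (fun _ => 1) g := by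
  refine Subtype.ext ?_
  change M.pushes _ _ _ = M.pushes _ _ _
  rw [← h]
  exact M.pushes_one_eq (fun _ _ => rfl) f.2 g.2 h (Nat.lt_succ_self _)

theorem type_totalOn_eq {i : ℕ} {u : ℕ → I} (hu : ∀ j, u j ≠ 0 → u (j + 1) = 1) {f g : M.dom i}
    (h : M.type f = M.type g) : M.type (M.totalOn i u f) = M.type (M.totalOn i u g) := by
  change M.type (M.pushes _ _ _) = M.type (M.pushes _ _ _)
  rw [← h]
  refine M.type_pushes_eq (fun j => (u j).2) (fun j hj => ?_) f.2 g.2 h (Nat.lt_succ_self _)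
  exact congrArg Subtype.val (hu j fun h0 => hj (congrArg Subtype.val h0))

/-- Times for which `push (k + 1)` begins when `push k` has ended. -/
noncomputable def upTime (t : I) (k : ℕ) : I :=
  -- `push k` runs while `t` goes from k/(k+1) to (k+1)/(k+2).
  projIcc 0 1 zero_le_one ((k + 2) * (1 - (k + 1) * (1 - (t : ℝ))))

/-- Times for which `push k` begins when `push (k + 1)` has ended. -/
noncomputable def downTime (t : I) (k : ℕ) : I :=
  -- `push k` runs while `t` goes from 1/(k+2) to 1/(k+1).
  projIcc 0 1 zero_le_one (((k + 2) * (t : ℝ) - 1) * (k + 1))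

theorem projIcc_eq_one {x : ℝ} (h : 1 ≤ x) : projIcc (0 : ℝ) 1 zero_le_one x = 1 :=
  projIcc_of_right_le zero_le_one h

theorem projIcc_eq_zero {x : ℝ} (h : x ≤ 0) : projIcc (0 : ℝ) 1 zero_le_one x = 0 :=
  projIcc_of_le_left zero_le_one h

theorem upTime_zero : upTime 0 = fun _ => 0 := by
  ext1 k
  refine projIcc_eq_zero ?_
  rw [Icc.coe_zero]
  have : (0 : ℝ) ≤ k := Nat.cast_nonneg k
  nlinarith

theorem upTime_one : upTime 1 = fun _ => 1 := by
  ext1 k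
  refine projIcc_eq_one ?_
  rw [Icc.coe_one]
  have : (0 : ℝ) ≤ k := Nat.cast_nonneg k
  linarith

theorem upTime_succ (t : I) (k : ℕ) (h : upTime t (k + 1) ≠ 0) : upTime t k = 1 := by
  refine projIcc_eq_one ?_
  by_contra! hlt
  refine h (projIcc_eq_zero ?_)
  push_cast
  have : (0 : ℝ) ≤ k := Nat.cast_nonneg k
  have h2 : 1 - ((k : ℝ) + 1 + 1) * (1 - t) ≤ 0 := by nlinarith
  nlinarith

theorem downTime_zero : downTime 0 = fun _ => 0 := by
  ext1 k
  refine projIcc_eq_zero ?_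
  rw [Icc.coe_zero]
  have : (0 : ℝ) ≤ k := Nat.cast_nonneg k
  nlinarith

theorem downTime_one : downTime 1 = fun _ => 1 := by
  ext1 k
  refine projIcc_eq_one ?_
  rw [Icc.coe_one]
  have : (0 : ℝ) ≤ k := Nat.cast_nonneg k
  nlinarith

theorem downTime_succ (t : I) (k : ℕ) (h : downTime t k ≠ 0) : downTime t (k + 1) = 1 := by
  refine projIcc_eq_one ?_
  by_contra! hlt
  refine h (projIcc_eq_zero ?_)
  push_cast at hlt
  have : (0 : ℝ) ≤ k := Nat.cast_nonneg k
  have h2 : ((k : ℝ) + 2) * t - 1 ≤ 0 := by nlinarith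
  nlinarith

theorem continuous_upTime (k : ℕ) : Continuous fun t => upTime t k := by
  unfold upTime
  exact continuous_projIcc.comp (by fun_prop)

theorem continuous_downTime (k : ℕ) : Continuous fun t => downTime t k := by
  unfold downTime
  exact continuous_projIcc.comp (by fun_prop)

/-- The quotient maps that collapse the fibres to points have a homotopy inverse. -/
noncomputable def seqHomotopyInverse {T : ℕ → Type} [∀ i, TopologicalSpace (T i)]
    (κ : ∀ i, T i → T (i + 1)) (R : ∀ i, M.dom i → T i) (hR : ∀ i, IsQuotientMap (R i))
    (hker : ∀ i f g, R i f = R i g ↔ M.type f = M.type g)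
    (hκ : ∀ i f, R (i + 1) (inclusion (M.dom_mono (Nat.le_succ i)) f) = κ i (R i f)) :
    SeqHomotopyInverse (X := fun i => M.dom i)
      (fun i => inclusion (M.dom_mono (Nat.le_succ i))) κ R where
  -- The completed contraction is constant on fibres, so the result is independent of the
  -- set-theoretic section `surjInv`.
  inv i y := M.totalOn i (fun _ => 1) (Function.surjInv (hR i).surjective y)
  continuous_inv i := by
    rw [(hR i).continuous_iff]
    obtain ⟨k, hk⟩ := M.exists_totalOn_eq i
    have h1 : Continuous fun p : Unit × M.dom i => M.pushesOn i k (fun _ => 1) p.2 :=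
      M.continuous_pushesOn k (u := fun _ _ => 1) (fun _ => continuous_const) fun _ _ _ => rfl
    have h2 : Continuous fun f : M.dom i => M.totalOn i (fun _ => 1) f := by
      simp only [hk]
      exact h1.comp (continuous_const.prodMk continuous_id : Continuous fun f => ((), f))
    refine h2.congr fun f => M.totalOn_one_eq ((hker i _ _).1 ?_)
    exact (Function.surjInv_eq (hR i).surjective (R i f)).symm
  inv_map i y := by
    let f := Function.surjInv (hR i).surjective y
    have hf : R i f = y := Function.surjInv_eq (hR i).surjective y
    refine Eq.trans (b := M.totalOn (i + 1) (fun _ => 1)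
      (inclusion (M.dom_mono (Nat.le_succ i)) f)) ?_ rfl
    refine M.totalOn_one_eq ((hker _ _ _).1 ?_)
    rw [hκ, hf]
    exact Function.surjInv_eq (hR (i + 1)).surjective _
  left i p := M.totalOn i (upTime p.2) p.1
  continuous_left i := by
    obtain ⟨k, hk⟩ := M.exists_totalOn_eq i
    simp only [hk]
    exact (M.continuous_pushesOn k continuous_upTime upTime_succ).comp continuous_swap
  -- `total` is a single map of `B` that does not depend on `i`, because the moves were chosen for
  -- all `i` at once.
  left_map i f t := rfl
  left_zero i f := by
    rw [upTime_zero]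
    exact M.totalOn_zero i f
  left_one i f := by
    rw [upTime_one]
    refine M.totalOn_one_eq ((hker i _ _).1 ?_)
    exact (Function.surjInv_eq (hR i).surjective (R i f)).symm
  -- With the order of `downTime` fibres go to fibres at every time, so this is well defined on the
  -- quotient.
  right i p := R i (M.totalOn i (downTime p.2) (Function.surjInv (hR i).surjective p.1))
  continuous_right i := by
    obtain ⟨k, hk⟩ := M.exists_totalOn_eq i
    refine (hR i).continuous_lift_prod_left ?_
    have h1 : Continuous fun p : I × M.dom i => R i (M.pushesOn i k (downTime p.1) p.2) :=
      M.continuous_comp_pushesOn k (hR i).continuous (fun f g => (hker i f g).2)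
        continuous_downTime downTime_succ
    refine (h1.comp continuous_swap).congr fun p => ?_
    change R i (M.pushesOn i k (downTime p.2) p.1) = _
    rw [← hk]
    refine (hker i _ _).2 (M.type_totalOn_eq (downTime_succ p.2) ((hker i _ _).1 ?_))
    exact (Function.surjInv_eq (hR i).surjective (R i p.1)).symm
  right_map i y t := by
    let f := Function.surjInv (hR i).surjective y
    have hf : R i f = y := Function.surjInv_eq (hR i).surjective y
    refine Eq.trans (b := R (i + 1) (M.totalOn (i + 1) (downTime t)
      (inclusion (M.dom_mono (Nat.le_succ i)) f))) ?_ ?_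
    · refine (hker _ _ _).2 (M.type_totalOn_eq (downTime_succ t) ((hker _ _ _).1 ?_))
      rw [hκ, hf]
      exact Function.surjInv_eq (hR (i + 1)).surjective _
    · exact hκ i (M.totalOn i (downTime t) f)
  right_zero i y := by
    rw [downTime_zero]
    exact (congrArg (R i) (M.totalOn_zero i _)).trans (Function.surjInv_eq _ y)
  right_one i y := by
    rw [downTime_one]

end FibredModel

end RationalLoops

namespace RationalLoops

open Topology unitInterval Filter Set

/-! ## Normalization of nowhere vanishing functions -/

section Normalization

set_option linter.unusedSectionVars false

variable {K E : Type} [TopologicalSpace K] [CompactSpace K] [NormedAddCommGroup E]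
  [InnerProductSpace ℝ E]

/-- The nowhere vanishing functions. -/
def nowhereZero (K E : Type) [TopologicalSpace K] [NormedAddCommGroup E] : Set C(K, E) :=
  {f | ∀ k, f k ≠ 0}

theorem isOpen_nowhereZero : IsOpen (nowhereZero K E) := by
  have := ContinuousMap.isOpen_setOfPred_mapsTo (isCompact_univ (X := K))
    (isOpen_compl_singleton (x := (0 : E)))
  convert! this using 1
  ext f
  simp [nowhereZero, MapsTo]

open Classical in
/-- The function `f / ‖f‖`. -/
noncomputable def normalize (f : C(K, E)) : C(K, E) :=
  if h : f ∈ nowhereZero K E then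
    ⟨fun k => ‖f k‖⁻¹ • f k, (f.continuous.norm.inv₀ fun k => norm_ne_zero_iff.2 (h k)).smul
      f.continuous⟩
  else 0

theorem normalize_apply {f : C(K, E)} (h : f ∈ nowhereZero K E) (k : K) :
    normalize f k = ‖f k‖⁻¹ • f k := by
  rw [normalize, dif_pos h]
  rfl

theorem norm_normalize {f : C(K, E)} (h : f ∈ nowhereZero K E) (k : K) :
    ‖normalize f k‖ = 1 := by
  rw [normalize_apply h, norm_smul, norm_inv, norm_norm, inv_mul_cancel₀ (norm_ne_zero_iff.2 (h k))]

theorem continuousOn_normalize : ContinuousOn normalize (nowhereZero K E) := by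
  rw [continuousOn_iff_continuous_domRestrict]
  refine ContinuousMap.continuous_of_continuous_uncurry _ ?_
  have h1 : Continuous fun p : nowhereZero K E × K => p.1.1 p.2 :=
    continuous_eval.comp ((continuous_subtype_val.comp continuous_fst).prodMk continuous_snd)
  have h2 : Continuous fun p : nowhereZero K E × K => ‖p.1.1 p.2‖⁻¹ • p.1.1 p.2 :=
    (h1.norm.inv₀ fun p => norm_ne_zero_iff.2 (p.1.2 p.2)).smul h1
  refine h2.congr fun p => ?_
  exact (normalize_apply p.1.2 p.2).symm

/-- The functions whose angle with `x.1` has a cosine greater than `x.2`. -/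
def cone (x : C(K, E) × ℝ) : Set C(K, E) :=
  {f | ∀ k, x.2 * ‖f k‖ < inner ℝ (f k) (x.1 k)}

theorem isOpen_cone : IsOpen {p : (C(K, E) × ℝ) × C(K, E) | p.2 ∈ cone p.1} := by
  have h1 : Continuous fun q : ((C(K, E) × ℝ) × C(K, E)) × K => q.1.2 q.2 :=
    continuous_eval.comp ((continuous_snd.comp continuous_fst).prodMk continuous_snd)
  have h2 : Continuous fun q : ((C(K, E) × ℝ) × C(K, E)) × K => q.1.1.1 q.2 :=
    continuous_eval.comp (((continuous_fst.comp continuous_fst).comp continuous_fst).prodMk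
      continuous_snd)
  let φ : C((C(K, E) × ℝ) × C(K, E), C(K, ℝ)) := ContinuousMap.curry
    ⟨fun q => inner ℝ (q.1.2 q.2) (q.1.1.1 q.2) - q.1.1.2 * ‖q.1.2 q.2‖,
      (h1.inner h2).sub (((continuous_snd.comp continuous_fst).comp continuous_fst).mul h1.norm)⟩
  have := (ContinuousMap.isOpen_setOfPred_mapsTo (isCompact_univ (X := K))
    (isOpen_Ioi (a := (0 : ℝ)))).preimage φ.continuous
  convert! this using 1
  ext p
  exact ⟨fun h k _ => sub_pos.2 (h k), fun h k => sub_pos.1 (h (mem_univ k))⟩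

/-- The norm is convex and the inner product with `x.1` is linear. Nonnegativity of `x.2` is
essential: cones wider than a half-space are not convex. -/
theorem convex_cone {x : C(K, E) × ℝ} (hx : 0 ≤ x.2) : Convex ℝ (cone x) := by
  intro f hf g hg a b ha hb hab k
  have h1 := hf k
  have h2 := hg k
  have h3 : ‖(a • f + b • g) k‖ ≤ a * ‖f k‖ + b * ‖g k‖ := by
    refine (norm_add_le _ _).trans (le_of_eq ?_)
    rw [ContinuousMap.smul_apply, ContinuousMap.smul_apply, norm_smul, norm_smul,
      Real.norm_of_nonneg ha, Real.norm_of_nonneg hb]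
  have h4 : inner ℝ ((a • f + b • g) k) (x.1 k) =
      a * inner ℝ (f k) (x.1 k) + b * inner ℝ (g k) (x.1 k) := by
    rw [ContinuousMap.add_apply, ContinuousMap.smul_apply, ContinuousMap.smul_apply,
      inner_add_left, real_inner_smul_left, real_inner_smul_left]
  rw [h4]
  have h5 : x.2 * ‖(a • f + b • g) k‖ ≤ a * (x.2 * ‖f k‖) + b * (x.2 * ‖g k‖) := by
    nlinarith [mul_le_mul_of_nonneg_left h3 hx]
  refine h5.trans_lt ?_
  rcases ha.eq_or_lt with rfl | ha'
  · have : b = 1 := by linarith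
    subst this
    linarith
  · nlinarith [mul_lt_mul_of_pos_left h1 ha', mul_le_mul_of_nonneg_left h2.le hb]

theorem nowhereZero_of_mem_cone {x : C(K, E) × ℝ} {f : C(K, E)} (hf : f ∈ cone x) :
    f ∈ nowhereZero K E := by
  intro k h
  have := hf k
  simp [h] at this

theorem mem_cone_normalize {f : C(K, E)} (hf : f ∈ nowhereZero K E) {t : ℝ} (ht : t < 1) :
    f ∈ cone (normalize f, t) := by
  intro k
  have h0 := norm_pos_iff.2 (hf k)
  change t * ‖f k‖ < inner ℝ (f k) (normalize f k)
  rw [normalize_apply hf, real_inner_smul_right, real_inner_self_eq_norm_sq]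
  have : ‖f k‖⁻¹ * ‖f k‖ ^ 2 = 1 * ‖f k‖ := by
    field_simp
  rw [this]
  exact mul_lt_mul_of_pos_right ht h0

theorem dist_normalize_le {g f : C(K, E)} (hg : ∀ k, ‖g k‖ = 1) {t : ℝ}
    (hf : f ∈ cone (g, t)) : dist (normalize f) g ≤ √(2 * (1 - t)) := by
  have hU := nowhereZero_of_mem_cone hf
  rw [ContinuousMap.dist_le (Real.sqrt_nonneg _)]
  intro k
  refine Real.le_sqrt_of_sq_le ?_
  have h0 := norm_pos_iff.2 (hU k)
  have h1 : t ≤ inner ℝ (normalize f k) (g k) := by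
    rw [normalize_apply hU, real_inner_smul_left]
    have := (hf k).le
    rw [inv_mul_eq_div, le_div_iff₀ h0]
    exact this
  rw [dist_eq_norm, norm_sub_sq_real, hg, norm_normalize hU]
  linarith

end Normalization

/-- Increasing finite-dimensional affine spaces of functions. -/
structure AffineModel (K E : Type) [TopologicalSpace K] [CompactSpace K] [NormedAddCommGroup E]
    [InnerProductSpace ℝ E] where
  A : ℕ → AffineSubspace ℝ C(K, E)
  mono : Monotone A
  nonempty : ∀ i, (A i : Set C(K, E)).Nonempty
  finiteDimensional : ∀ i, FiniteDimensional ℝ (A i).direction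

/-! ### A homotopy inverse of normalization from continuous selections -/

namespace AffineModel

variable {K E : Type} [TopologicalSpace K] [CompactSpace K] [NormedAddCommGroup E]
  [InnerProductSpace ℝ E] (M : AffineModel K E)

/-- The nowhere vanishing functions in the `i`-th space. -/
def dom (i : ℕ) : Set C(K, E) := (M.A i : Set C(K, E)) ∩ nowhereZero K E

theorem dom_mono : Monotone M.dom := fun _ _ h => inter_subset_inter_left _ (M.mono h)

/-- The normalizations of the nowhere vanishing functions in the `i`-th space. -/
def sph (i : ℕ) : Set C(K, E) := normalize '' M.dom i

theorem sph_mono : Monotone M.sph := fun _ _ h => image_mono (M.dom_mono h)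

theorem norm_of_mem_sph {i : ℕ} {g : C(K, E)} (hg : g ∈ M.sph i) (k : K) : ‖g k‖ = 1 := by
  obtain ⟨f, hf, rfl⟩ := hg
  exact norm_normalize hf.2 k

/-- Continuous selections of functions in the `i`-th space that are close to multiples of a given
normalized function. -/
structure IsSelection (i : ℕ) (s : C(K, E) × ℝ → C(K, E)) : Prop where
  continuousOn : ContinuousOn s (M.sph i ×ˢ Ico 0 1)
  mem : ∀ x ∈ M.sph i ×ˢ Ico (0 : ℝ) 1, s x ∈ M.A i ∧ s x ∈ cone x

/-- The admissible values at a point form a convex set, which over `Z` is the single value `s₀`.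
Local selections therefore glue by a partition of unity. -/
theorem exists_isSelection_extension (i : ℕ) (s₀ : C(K, E) × ℝ → C(K, E))
    {Z : Set (C(K, E) × ℝ)} (hZ : IsClosed Z)
    (hc : ContinuousOn s₀ (M.sph i ×ˢ Ico 0 1 ∩ Z))
    (hm : ∀ x ∈ M.sph i ×ˢ Ico (0 : ℝ) 1 ∩ Z, s₀ x ∈ M.A i ∧ s₀ x ∈ cone x) :
    ∃ s, M.IsSelection i s ∧ EqOn s s₀ (M.sph i ×ˢ Ico 0 1 ∩ Z) := by
  classical
  have := M.finiteDimensional i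
  set X : Set (C(K, E) × ℝ) := M.sph i ×ˢ Ico 0 1 with hX
  obtain ⟨e, hec, heA, hes⟩ := exists_continuousOn_extension_affine (M.A i) (M.nonempty i) hZ hc
    fun x hx => (hm x hx).1
  have hec' : Continuous fun x : X => e x := continuousOn_iff_continuous_domRestrict.1 hec
  obtain ⟨g, hg⟩ := exists_continuous_forall_mem_convex_of_local (X := X) (E := C(K, E))
    (t := fun x => {f | f ∈ M.A i ∧ f ∈ cone (x : C(K, E) × ℝ) ∧ ((x : C(K, E) × ℝ) ∈ Z → f = s₀ x)})
    (by
      intro x f hf g hg a b ha hb hab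
      refine ⟨(M.A i).convex hf.1 hg.1 ha hb hab,
        convex_cone x.2.2.1 hf.2.1 hg.2.1 ha hb hab, fun hx => ?_⟩
      rw [hf.2.2 hx, hg.2.2 hx, ← add_smul, hab, one_smul])
    (by
      intro x
      by_cases hxZ : (x : C(K, E) × ℝ) ∈ Z
      · refine ⟨{y : X | e y ∈ cone (y : C(K, E) × ℝ)}, ?_, fun y => e y, hec'.continuousOn, ?_⟩
        · refine (isOpen_cone.preimage (continuous_subtype_val.prodMk hec')).mem_nhds ?_
          change e x ∈ cone _
          rw [hes ⟨x.2, hxZ⟩]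
          exact (hm x ⟨x.2, hxZ⟩).2
        · exact fun y hy => ⟨heA y.2, hy, fun hyZ => hes ⟨y.2, hyZ⟩⟩
      -- Away from `Z`, a form whose normalization is the given function lies in the cone at this
      -- point, and in the cones at all nearby points because the cone condition is open.
      · obtain ⟨f, hf, hfx⟩ := x.2.1
        refine ⟨{y : X | f ∈ cone (y : C(K, E) × ℝ)} ∩ {y : X | (y : C(K, E) × ℝ) ∈ Zᶜ}, ?_,
          fun _ => f, continuousOn_const, ?_⟩
        · refine inter_mem ((isOpen_cone.preimage
            (continuous_subtype_val.prodMk continuous_const)).mem_nhds ?_)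
            ((hZ.isOpen_compl.preimage continuous_subtype_val).mem_nhds hxZ)
          have := mem_cone_normalize hf.2 x.2.2.2
          rwa [hfx] at this
        · exact fun y hy => ⟨hf.1, hy.1, fun h => absurd h hy.2⟩)
  let s : C(K, E) × ℝ → C(K, E) := fun x => if h : x ∈ X then g ⟨x, h⟩ else 0
  have hsg : ∀ x (hx : x ∈ X), s x = g ⟨x, hx⟩ := fun x hx => dif_pos hx
  refine ⟨s, ⟨?_, ?_⟩, ?_⟩
  · rw [continuousOn_iff_continuous_domRestrict]
    convert! g.continuous using 1
    ext1 x
    exact hsg x x.2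
  · intro x hx
    have := hg ⟨x, hx⟩
    rw [hsg x hx]
    exact ⟨this.1, this.2.1⟩
  · intro x hx
    rw [hsg x hx.1]
    exact (hg ⟨x, hx.1⟩).2.2 hx.2

/-- The hypothesis says that each space of normalized functions is closed in the next, so a
selection over the smaller one can be extended. -/
theorem exists_isSelection (hcl : ∀ i, ∃ Z, IsClosed Z ∧ M.sph (i + 1) ∩ Z = M.sph i) :
    ∃ s, ∀ i, M.IsSelection i s := by
  refine exists_of_extension (X := fun i => M.sph i ×ˢ Ico (0 : ℝ) 1)
    (fun i j h => prod_mono (M.sph_mono h) le_rfl) (p := fun i s => M.IsSelection i s)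
    (fun i s t h hs => ⟨hs.continuousOn.congr h.symm, fun x hx => h hx ▸ hs.mem x hx⟩) ?_ ?_
  · obtain ⟨s, hs, -⟩ := M.exists_isSelection_extension 0 (fun _ => 0) isClosed_empty
      (by simp) (by simp)
    exact ⟨s, hs⟩
  · intro i s hs
    obtain ⟨Z, hZ, hZs⟩ := hcl i
    have e : M.sph (i + 1) ×ˢ Ico (0 : ℝ) 1 ∩ Prod.fst ⁻¹' Z = M.sph i ×ˢ Ico (0 : ℝ) 1 := by
      rw [← hZs]
      ext x
      simp only [mem_inter_iff, mem_prod, mem_preimage]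
      tauto
    obtain ⟨t, ht, hts⟩ := M.exists_isSelection_extension (i + 1) s
      (hZ.preimage continuous_fst) (by rw [e]; exact hs.continuousOn) (by
        rw [e]
        exact fun x hx => ⟨M.mono (Nat.le_succ i) (hs.mem x hx).1, (hs.mem x hx).2⟩)
    exact ⟨t, ht, by rwa [e] at hts⟩

/-- Normalization as a map from the nowhere vanishing functions in the `i`-th space. -/
noncomputable def norm (i : ℕ) (f : M.dom i) : M.sph i := ⟨normalize f, mem_image_of_mem _ f.2⟩

theorem continuous_norm (i : ℕ) : Continuous (M.norm i) :=
  Continuous.subtype_mk (continuousOn_normalize.comp_continuous continuous_subtype_val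
    fun f => f.2.2) _

open Classical in
/-- Normalization has a homotopy inverse. -/
noncomputable def seqHomotopyInverse {s : C(K, E) × ℝ → C(K, E)}
    (hs : ∀ i, M.IsSelection i s) :
    SeqHomotopyInverse (X := fun i => M.dom i) (Y := fun i => M.sph i)
      (fun i => inclusion (M.dom_mono (Nat.le_succ i)))
      (fun i => inclusion (M.sph_mono (Nat.le_succ i))) M.norm where
  inv i g := ⟨s (g, 0), ((hs i).mem _ ⟨g.2, by simp⟩).1,
    nowhereZero_of_mem_cone ((hs i).mem _ ⟨g.2, by simp⟩).2⟩
  continuous_inv i := Continuous.subtype_mk ((hs i).continuousOn.comp_continuous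
    (by fun_prop : Continuous fun g : M.sph i => ((g : C(K, E)), (0 : ℝ)))
    fun g => ⟨g.2, by simp⟩) _
  inv_map i g := rfl
  -- Both ends of the segment lie in the convex cone of functions at less than a right angle to the
  -- normalization of `p.1`, so the segment contains only nowhere vanishing functions.
  left i p := ⟨p.1 + (p.2 : ℝ) • (s (normalize p.1, 0) - p.1), by
    have h := (hs i).mem (normalize p.1, 0) ⟨mem_image_of_mem _ p.1.2, by simp⟩
    refine ⟨AffineSubspace.add_smul_sub_mem _ p.1.2.1 h.1 _, ?_⟩
    have hc := convex_cone (x := (normalize (p.1 : C(K, E)), (0 : ℝ))) le_rfl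
      (mem_cone_normalize p.1.2.2 zero_lt_one) h.2 (sub_nonneg.2 p.2.2.2) p.2.2.1
      (sub_add_cancel 1 _)
    have := nowhereZero_of_mem_cone hc
    convert this using 1
    rw [sub_smul, one_smul, smul_sub]
    abel⟩
  continuous_left i := by
    have h1 : Continuous fun f : M.dom i => s (normalize (f : C(K, E)), 0) :=
      (hs i).continuousOn.comp_continuous
        ((continuous_subtype_val.comp (M.continuous_norm i)).prodMk continuous_const)
        fun f => ⟨mem_image_of_mem _ f.2, by simp⟩
    have h2 : Continuous fun p : M.dom i × I => (p.1 : C(K, E)) :=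
      continuous_subtype_val.comp continuous_fst
    exact Continuous.subtype_mk (h2.add ((continuous_subtype_val.comp continuous_snd).smul
      ((h1.comp continuous_fst).sub h2))) _
  left_map i f t := rfl
  left_zero i f := Subtype.ext (by simp)
  left_one i f := Subtype.ext (by simp [norm])
  -- The selection is defined only for cosine bounds below 1, so time 0 is treated separately.
  -- Continuity there holds because the selected direction is within distance √(2t) of the given one
  -- at time `t`.
  right i p := if h : p.2 = 0 then p.1 else
    ⟨normalize (s (p.1, 1 - p.2)), by
      have h1 : (p.2 : ℝ) ≠ 0 := fun h0 => h (Subtype.ext h0)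
      have h2 : 0 < (p.2 : ℝ) := lt_of_le_of_ne p.2.2.1 h1.symm
      have hm := (hs i).mem (p.1, 1 - (p.2 : ℝ)) ⟨p.1.2, by simpa using p.2.2.2, by simpa using h2⟩
      exact ⟨_, ⟨hm.1, nowhereZero_of_mem_cone hm.2⟩, rfl⟩⟩
  continuous_right i := by
    rw [continuous_iff_continuousAt]
    have hmem : ∀ p : M.sph i × I, p.2 ≠ 0 →
        ((p.1 : C(K, E)), 1 - (p.2 : ℝ)) ∈ M.sph i ×ˢ Ico (0 : ℝ) 1 := by
      intro p hp
      have h1 : (p.2 : ℝ) ≠ 0 := fun h0 => hp (Subtype.ext h0)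
      have h2 : 0 < (p.2 : ℝ) := lt_of_le_of_ne p.2.2.1 h1.symm
      exact ⟨p.1.2, by simpa using p.2.2.2, by simpa using h2⟩
    have hpair : Continuous fun p : M.sph i × I => ((p.1 : C(K, E)), 1 - (p.2 : ℝ)) := by
      fun_prop
    rintro ⟨g, u⟩
    rw [Topology.IsInducing.subtypeVal.continuousAt_iff]
    by_cases hu : u = 0
    · subst hu
      have hlim : Tendsto (fun p : M.sph i × I => (p.1 : C(K, E))) (𝓝 (g, 0)) (𝓝 g) :=
        (continuous_subtype_val.comp continuous_fst).tendsto (g, (0 : I))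
      have hd : Tendsto (fun p : M.sph i × I => √(2 * (1 - (1 - (p.2 : ℝ))))) (𝓝 (g, 0)) (𝓝 0) := by
        have : Continuous fun p : M.sph i × I => √(2 * (1 - (1 - (p.2 : ℝ)))) := by fun_prop
        convert this.tendsto (g, (0 : I)) using 2
        simp
      simp only [ContinuousAt, Function.comp_def, dite_true]
      refine Tendsto.congr_dist hlim (squeeze_zero (fun p => dist_nonneg) (fun p => ?_) hd)
      by_cases hp : p.2 = 0
      · simp only [dif_pos hp, dist_self]
        exact Real.sqrt_nonneg _
      · simp only [dif_neg hp]
        rw [dist_comm]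
        refine dist_normalize_le (M.norm_of_mem_sph p.1.2) ((hs i).mem _ (hmem p hp)).2
    · have ho : {p : M.sph i × I | p.2 ≠ 0} ∈ 𝓝 (g, u) :=
        (isOpen_compl_singleton.preimage continuous_snd).mem_nhds hu
      have hc : ContinuousOn (fun p : M.sph i × I => normalize (s (p.1, 1 - (p.2 : ℝ))))
          {p | p.2 ≠ 0} := by
        refine continuousOn_normalize.comp ((hs i).continuousOn.comp hpair.continuousOn hmem) ?_
        exact fun p hp => nowhereZero_of_mem_cone ((hs i).mem _ (hmem p hp)).2
      refine (hc.continuousAt ho).congr ?_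
      filter_upwards [ho] with p hp
      simp only [Function.comp_apply]
      rw [dif_neg hp]
  right_map i g t := by
    by_cases ht : t = 0
    · simp [ht]
    · simp only [dif_neg ht]
  right_zero i g := dif_pos rfl
  right_one i g := by
    simp only [dif_neg one_ne_zero]
    refine Subtype.ext ?_
    simp [norm]

end AffineModel

end RationalLoops

namespace RationalLoops

open Topology Filter Set

/-! ## Forms and polynomials -/

section Forms

open Polynomial

theorem form_one_zero (s : Multiset ℂ) : form s ![1, 0] = 1 := by
  simp [form]

theorem form_of_eq_zero {s : Multiset ℂ} (hs : IsRealDivisor s) {v : Fin 2 → ℝ} (hv : v 1 = 0) :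
    form s v = v 0 ^ Multiset.card s := by
  have : v = v 0 • ![1, 0] := by
    ext i
    fin_cases i <;> simp [hv]
  rw [this, form_smul hs, form_one_zero]
  simp

theorem form_of_ne_zero {s : Multiset ℂ} (hs : IsRealDivisor s) {v : Fin 2 → ℝ} (hv : v 1 ≠ 0) :
    form s v = v 1 ^ Multiset.card s * form s ![v 0 / v 1, 1] := by
  have : v = v 1 • ![v 0 / v 1, 1] := by
    ext i
    fin_cases i
    · simp
      field_simp
    · simp
  rw [← form_smul hs, ← this]

/-- The homogenization of degree `n` of a polynomial. -/
noncomputable def homog (n : ℕ) (p : ℝ[X]) (v : Fin 2 → ℝ) : ℝ :=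
  ∑ i ∈ Finset.range (n + 1), p.coeff i * v 0 ^ i * v 1 ^ (n - i)

theorem homog_of_eq_zero (n : ℕ) (p : ℝ[X]) {v : Fin 2 → ℝ} (hv : v 1 = 0) :
    homog n p v = p.coeff n * v 0 ^ n := by
  rw [homog, Finset.sum_range_succ, Finset.sum_eq_zero]
  · simp
  · intro i hi
    rw [hv, zero_pow (Nat.sub_ne_zero_of_lt (Finset.mem_range.1 hi)), mul_zero]

theorem homog_of_ne_zero {n : ℕ} {p : ℝ[X]} (hp : p.natDegree ≤ n) {v : Fin 2 → ℝ}
    (hv : v 1 ≠ 0) : homog n p v = v 1 ^ n * p.eval (v 0 / v 1) := by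
  rw [eval_eq_sum_range' (Nat.lt_succ_of_le hp), Finset.mul_sum, homog]
  refine Finset.sum_congr rfl fun i hi => ?_
  have hi' : i ≤ n := Nat.lt_succ_iff.1 (Finset.mem_range.1 hi)
  have : v 1 ^ n = v 1 ^ i * v 1 ^ (n - i) := by rw [← pow_add, Nat.add_sub_cancel' hi']
  rw [this, div_pow]
  field_simp

/-- The real monic polynomial with a given real divisor. -/
theorem exists_poly_of_divisor {s : Multiset ℂ} (hs : IsRealDivisor s) :
    ∃ p : ℝ[X], p.Monic ∧ p.natDegree = Multiset.card s ∧
      p.map Complex.ofRealHom = (s.map fun z => (X - C z : ℂ[X])).prod := by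
  set q : ℂ[X] := (s.map fun z => (X - C z : ℂ[X])).prod with hq
  have hmonic : q.Monic := monic_multiset_prod_of_monic _ _ fun z _ => monic_X_sub_C z
  have hconj : q.map (starRingEnd ℂ) = q := by
    rw [hq, Polynomial.map_multiset_prod, Multiset.map_map]
    conv_rhs => rw [← hs, Multiset.map_map]
    simp
  have hl : q ∈ lifts Complex.ofRealHom := by
    rw [lifts_iff_coeff_lifts]
    intro i
    have : starRingEnd ℂ (q.coeff i) = q.coeff i := by
      conv_rhs => rw [← hconj, coeff_map]
    exact ⟨(q.coeff i).re, Complex.conj_eq_iff_re.1 this⟩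
  obtain ⟨p, hp, hd, hm⟩ := lifts_and_natDegree_eq_and_monic hl hmonic
  refine ⟨p, hm, ?_, hp⟩
  rw [hd, hq, natDegree_multiset_prod_X_sub_C_eq_card]

theorem eval_eq_form {s : Multiset ℂ} (hs : IsRealDivisor s) {p : ℝ[X]}
    (hp : p.map Complex.ofRealHom = (s.map fun z => (X - C z : ℂ[X])).prod) (x : ℝ) :
    p.eval x = form s ![x, 1] := by
  apply Complex.ofReal_injective
  rw [← eval_prod_eq_form hs, ← hp]
  have := eval_map_apply (f := Complex.ofRealHom) (p := p) (x := x)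
  simpa using this.symm

theorem homog_eq_form {s : Multiset ℂ} (hs : IsRealDivisor s) {n : ℕ} (hn : Multiset.card s = n)
    {p : ℝ[X]} (hm : p.Monic) (hd : p.natDegree = n)
    (hp : p.map Complex.ofRealHom = (s.map fun z => (X - C z : ℂ[X])).prod) (v : Fin 2 → ℝ) :
    homog n p v = form s v := by
  by_cases hv : v 1 = 0
  · rw [homog_of_eq_zero n p hv, form_of_eq_zero hs hv, hn]
    have : p.coeff n = 1 := by rw [← hd]; exact hm
    rw [this, one_mul]
  · rw [homog_of_ne_zero hd.le hv, form_of_ne_zero hs hv, hn, eval_eq_form hs hp]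

theorem map_eq_prod_roots {p : ℝ[X]} (hm : p.Monic) :
    p.map Complex.ofRealHom =
      ((p.map Complex.ofRealHom).roots.map fun z => (X - C z : ℂ[X])).prod := by
  have h := (IsAlgClosed.splits (p.map Complex.ofRealHom)).eq_prod_roots
  rw [(hm.map Complex.ofRealHom).leadingCoeff, C_1, one_mul] at h
  exact h

theorem card_roots_map (p : ℝ[X]) :
    Multiset.card (p.map Complex.ofRealHom).roots = p.natDegree := by
  rw [← (IsAlgClosed.splits _).natDegree_eq_card_roots, natDegree_map]

end Forms

/-! ## Symmetric products -/

/-- The point of the symmetric product with given coordinates. -/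
def symMk {X : Type} {n : ℕ} (x : Fin n → X) : Sym X n :=
  ⟨Multiset.ofList (List.ofFn x), by simp⟩

theorem isQuotientMap_symMk {X : Type} [TopologicalSpace X] {n : ℕ} :
    IsQuotientMap (symMk : (Fin n → X) → Sym X n) := by
  refine ⟨⟨rfl⟩, ?_⟩
  rintro ⟨s, hs⟩
  induction s using Quotient.inductionOn with
  | h l =>
    subst hs
    exact ⟨l.get, Subtype.ext (congrArg Multiset.ofList (List.ofFn_get l))⟩

theorem continuous_symMk {X : Type} [TopologicalSpace X] {n : ℕ} :
    Continuous (symMk : (Fin n → X) → Sym X n) := isQuotientMap_symMk.continuous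

theorem mem_symMk {X : Type} {n : ℕ} {x : Fin n → X} {a : X} :
    a ∈ (symMk x : Multiset X) ↔ ∃ i, x i = a := by
  change a ∈ Multiset.ofList (List.ofFn x) ↔ _
  simp

theorem map_symMk {X Y : Type} {n : ℕ} (x : Fin n → X) (f : X → Y) :
    (symMk x : Multiset X).map f = (symMk fun i => f (x i) : Multiset Y) := by
  change (Multiset.ofList (List.ofFn x)).map f = Multiset.ofList (List.ofFn fun i => f (x i))
  rw [Multiset.map_coe, List.map_ofFn]
  rfl

theorem prod_symMk {M : Type} [CommMonoid M] {n : ℕ} (x : Fin n → M) :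
    (symMk x : Multiset M).prod = ∏ i, x i := by
  change (Multiset.ofList (List.ofFn x)).prod = _
  rw [Multiset.prod_coe, List.prod_ofFn]

theorem continuous_form_sym {n : ℕ} :
    Continuous fun p : Sym ℂ n × (Fin 2 → ℝ) => form p.1 p.2 := by
  refine isQuotientMap_symMk.continuous_lift_prod_left
    (g := fun p : Sym ℂ n × (Fin 2 → ℝ) => form p.1 p.2) ?_
  have : (fun p : (Fin n → ℂ) × (Fin 2 → ℝ) => form (symMk p.1 : Multiset ℂ) p.2) =
      fun p => (∏ i, ((p.2 0 : ℂ) - p.1 i * p.2 1)).re := by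
    ext p
    rw [form, map_symMk, prod_symMk]
  change Continuous (fun p : (Fin n → ℂ) × (Fin 2 → ℝ) => form (symMk p.1 : Multiset ℂ) p.2)
  rw [this]
  fun_prop

/-! ## Tuples of divisors as functions on an interval -/

/-- The interval that parametrizes the real projective line. -/
abbrev Seg : Type := Icc (-1 : ℝ) 1

/-- A parametrization of the real projective line by the interval. -/
def vec (t : Seg) : Fin 2 → ℝ := ![t, 1 - (t : ℝ) ^ 2]

theorem vec_zero (t : Seg) : vec t 0 = t := rfl

theorem vec_one (t : Seg) : vec t 1 = 1 - (t : ℝ) ^ 2 := rfl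

theorem vec_ne_zero (t : Seg) : vec t ≠ 0 := by
  intro h
  have h0 := congrFun h 0
  have h1 := congrFun h 1
  rw [vec_zero] at h0
  rw [vec_one] at h1
  simp only [Pi.zero_apply] at h0 h1
  rw [h0] at h1
  norm_num at h1

theorem continuous_vec : Continuous vec := by
  refine continuous_pi fun i => ?_
  fin_cases i
  · exact continuous_subtype_val
  · exact continuous_const.sub (continuous_subtype_val.pow 2)

theorem vec_top : vec ⟨1, by norm_num, le_rfl⟩ = ![1, 0] := by
  ext i
  fin_cases i
  · rfl
  · simp [vec]

/-- The affine coordinate t/(1 - t²) takes every real value on the open interval; both end points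
represent infinity. -/
theorem exists_vec_eq (x : ℝ) : ∃ t : Seg, 0 < vec t 1 ∧ vec t = vec t 1 • ![x, 1] := by
  have hc : ContinuousOn (fun t : ℝ => x * (1 - t ^ 2) - t) (Icc (-1) 1) := by fun_prop
  obtain ⟨t, ht, h⟩ := intermediate_value_Icc' (by norm_num : (-1 : ℝ) ≤ 1) hc
    (show (0 : ℝ) ∈ Icc _ _ by constructor <;> norm_num)
  simp only at h
  have h0 : 1 - t ^ 2 ≠ 0 := by
    intro h0
    rw [h0] at h
    have ht0 : t = 0 := by linarith
    rw [ht0] at h0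
    norm_num at h0
  have h1 : 0 ≤ 1 - t ^ 2 := by nlinarith [ht.1, ht.2]
  refine ⟨⟨t, ht⟩, lt_of_le_of_ne h1 h0.symm, ?_⟩
  ext i
  fin_cases i
  · simp [vec]
    linarith
  · simp [vec]

/-- The Euclidean space that contains the values of tuples of forms. -/
abbrev Euc (m : ℕ) : Type := EuclideanSpace ℝ (Fin (m + 1))

/-- The absolute value of `X - z Y` on the interval. -/
noncomputable def rho (z : ℂ) (t : Seg) : ℝ := ‖(vec t 0 : ℂ) - z * vec t 1‖

theorem rho_pos {z : ℂ} (hz : z.im ≠ 0) (t : Seg) : 0 < rho z t := by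
  refine norm_pos_iff.2 fun h => vec_ne_zero t ?_
  have h1 := congrArg Complex.im h
  simp [hz] at h1
  have h0 := congrArg Complex.re h
  simp [h1] at h0
  ext i
  fin_cases i
  · exact h0
  · exact h1

theorem continuous_rho (z : ℂ) : Continuous (rho z) := by
  have h : ∀ i, Continuous fun t => vec t i := fun i => (continuous_apply i).comp continuous_vec
  have h0 := h 0
  have h1 := h 1
  unfold rho
  fun_prop

theorem form_pair (z : ℂ) (t : Seg) : form {z, starRingEnd ℂ z} (vec t) = rho z t ^ 2 := by
  apply Complex.ofReal_injective
  rw [coe_form (isRealDivisor_pair z), rho]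
  push_cast
  rw [← Complex.mul_conj']
  simp

/-- A tuple of divisors as a function on the interval. -/
noncomputable def phi {n m : ℕ} (z : ℂ) (hz : z.im ≠ 0) (d : D n m) : C(Seg, Euc m) :=
  ⟨fun t => WithLp.toLp 2 fun j => form (d.1 j) (vec t) / rho z t ^ n, by
    refine (PiLp.continuous_toLp 2 _).comp (continuous_pi fun j => ?_)
    exact ((continuous_form _).comp continuous_vec).div ((continuous_rho z).pow n)
      fun t => pow_ne_zero n (rho_pos hz t).ne'⟩

section Model

variable {n m : ℕ} {z : ℂ} {hz : z.im ≠ 0}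

theorem phi_apply (d : D n m) (t : Seg) (j : Fin (m + 1)) :
    phi z hz d t j = form (d.1 j) (vec t) / rho z t ^ n := rfl

/-- The form of the added pair is `rho z ^ 2`, which cancels against the larger exponent in the
denominator. The division by `rho z ^ n` is there for this purpose. -/
theorem phi_stabD (d : D n m) : phi z hz (stabD m z hz n d) = phi z hz d := by
  ext t j
  rw [phi_apply, phi_apply]
  have h : form ((stabD m z hz n d).1 j) (vec t) = rho z t ^ 2 * form (d.1 j) (vec t) := by
    rw [← form_pair, ← form_add (isRealDivisor_pair z) (d.2.1 j)]
    simp [stabD, Sym.coe_cons]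
  have h0 := (rho_pos hz t).ne'
  rw [h]
  field_simp
  ring

theorem phi_mem (d : D n m) : phi z hz d ∈ nowhereZero Seg (Euc m) := by
  intro t h
  apply form_ne_zero d (vec_ne_zero t)
  ext j
  have := congrArg (fun w : Euc m => w j) h
  simp only [phi_apply, PiLp.zero_apply, div_eq_zero_iff] at this
  exact this.resolve_right (pow_ne_zero n (rho_pos hz t).ne')

theorem continuous_phi : Continuous (phi z hz : D n m → C(Seg, Euc m)) := by
  refine ContinuousMap.continuous_of_continuous_uncurry _ ?_
  refine (PiLp.continuous_toLp 2 _).comp (continuous_pi fun j => ?_)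
  have h1 : Continuous fun p : D n m × Seg => p.1.1 j :=
    (continuous_apply j).comp (continuous_subtype_val.comp continuous_fst)
  refine Continuous.div (continuous_form_sym.comp (h1.prodMk (continuous_vec.comp continuous_snd)))
    (((continuous_rho z).comp continuous_snd).pow n)
    fun p => pow_ne_zero n (rho_pos hz p.2).ne'

end Model

end RationalLoops

namespace RationalLoops

open Topology Filter Set Polynomial

/-! ## The affine space of tuples of monic forms -/

/-- The tuple of forms `X ^ n`. -/
noncomputable def baseForm (n m : ℕ) {z : ℂ} (hz : z.im ≠ 0) : C(Seg, Euc m) :=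
  ⟨fun t => WithLp.toLp 2 fun _ => vec t 0 ^ n / rho z t ^ n, by
    have h0 : Continuous fun t => vec t 0 := (continuous_apply 0).comp continuous_vec
    exact (PiLp.continuous_toLp 2 _).comp (continuous_pi fun j =>
      (h0.pow n).div ((continuous_rho z).pow n) fun t => pow_ne_zero n (rho_pos hz t).ne')⟩

/-- The tuple of forms with given coefficients, without the leading terms. -/
noncomputable def linForm (n m : ℕ) {z : ℂ} (hz : z.im ≠ 0) :
    (Fin (m + 1) → Fin n → ℝ) →ₗ[ℝ] C(Seg, Euc m) where
  toFun a := ⟨fun t => WithLp.toLp 2 fun j =>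
      (∑ i : Fin n, a j i * vec t 0 ^ (i : ℕ) * vec t 1 ^ (n - i)) / rho z t ^ n, by
    have h0 : Continuous fun t => vec t 0 := (continuous_apply 0).comp continuous_vec
    have h1 : Continuous fun t => vec t 1 := (continuous_apply 1).comp continuous_vec
    refine (PiLp.continuous_toLp 2 _).comp (continuous_pi fun j => ?_)
    exact Continuous.div (by fun_prop) ((continuous_rho z).pow n)
      fun t => pow_ne_zero n (rho_pos hz t).ne'⟩
  map_add' a b := by
    ext t j
    simp [add_mul, Finset.sum_add_distrib, add_div]
  map_smul' c a := by
    ext t j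
    simp [mul_assoc, ← Finset.mul_sum, mul_div_assoc]

section

variable {n m : ℕ} {z : ℂ} {hz : z.im ≠ 0}

theorem linForm_apply (a : Fin (m + 1) → Fin n → ℝ) (t : Seg) (j : Fin (m + 1)) :
    linForm n m hz a t j =
      (∑ i : Fin n, a j i * vec t 0 ^ (i : ℕ) * vec t 1 ^ (n - i)) / rho z t ^ n := rfl

theorem baseForm_apply (t : Seg) (j : Fin (m + 1)) :
    baseForm n m hz t j = vec t 0 ^ n / rho z t ^ n := rfl

theorem baseForm_add_linForm_apply {a : Fin (m + 1) → Fin n → ℝ} {p : Fin (m + 1) → ℝ[X]}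
    (hp : ∀ j, (p j).coeff n = 1) (ha : ∀ j (i : Fin n), (p j).coeff i = a j i) (t : Seg)
    (j : Fin (m + 1)) :
    (baseForm n m hz + linForm n m hz a) t j = homog n (p j) (vec t) / rho z t ^ n := by
  rw [ContinuousMap.add_apply, PiLp.add_apply, linForm_apply, baseForm_apply, homog,
    Finset.sum_range_succ, Finset.sum_range, hp, ← add_div,
    add_comm (vec t 0 ^ n)]
  simp [ha]

/-- The restriction of a form to the interval determines the dehomogenized polynomial at every real
point, hence its coefficients. -/
theorem injective_linForm : Function.Injective (linForm n m hz) := by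
  rw [← LinearMap.ker_eq_bot, LinearMap.ker_eq_bot']
  intro a ha
  ext j i
  have h : ∑ i : Fin n, monomial (i : ℕ) (a j i) = (0 : ℝ[X]) := by
    refine Polynomial.funext fun x => ?_
    obtain ⟨t, ht, hx⟩ := exists_vec_eq x
    have h1 : linForm n m hz a t j = 0 := by rw [ha]; rfl
    have h0 : vec t 0 = vec t 1 * x := by
      conv_lhs => rw [hx]
      simp
    rw [linForm_apply, div_eq_zero_iff, or_iff_left (pow_ne_zero n (rho_pos hz t).ne')] at h1
    have h2 : ∑ i : Fin n, a j i * vec t 0 ^ (i : ℕ) * vec t 1 ^ (n - i) =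
        vec t 1 ^ n * ∑ i : Fin n, a j i * x ^ (i : ℕ) := by
      rw [Finset.mul_sum]
      refine Finset.sum_congr rfl fun i _ => ?_
      have : vec t 1 ^ n = vec t 1 ^ (i : ℕ) * vec t 1 ^ (n - i) := by
        rw [← pow_add, Nat.add_sub_cancel' i.2.le]
      rw [h0, this]
      ring
    rw [h2, mul_eq_zero, or_iff_right (pow_ne_zero n ht.ne')] at h1
    simpa [eval_finsetSum] using h1
  have := congrArg (fun p => p.coeff (i : ℕ)) h
  simpa [finsetSum_coeff, coeff_monomial, Fin.val_inj] using this

/-- The affine space of tuples of monic forms of degree `n`. -/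
noncomputable def formSpace (n m : ℕ) {z : ℂ} (hz : z.im ≠ 0) : AffineSubspace ℝ C(Seg, Euc m) :=
  AffineSubspace.mk' (baseForm n m hz) (LinearMap.range (linForm n m hz))

theorem finiteDimensional_formSpace : FiniteDimensional ℝ (formSpace n m hz).direction := by
  rw [formSpace, AffineSubspace.direction_mk']
  infer_instance

/-- Real divisors of degree `n` correspond to monic real polynomials of degree `n` by passing
between roots and coefficients, and the latter form an affine space. -/
theorem mem_formSpace {f : C(Seg, Euc m)} : f ∈ formSpace n m hz ↔
    ∃ s : Fin (m + 1) → Multiset ℂ, (∀ j, IsRealDivisor (s j)) ∧ (∀ j, Multiset.card (s j) = n) ∧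
      ∀ t j, f t j = form (s j) (vec t) / rho z t ^ n := by
  rw [formSpace, AffineSubspace.mem_mk', vsub_eq_sub, LinearMap.mem_range]
  constructor
  · rintro ⟨a, ha⟩
    let q : Fin (m + 1) → ℝ[X] := fun j => ∑ i : Fin n, C (a j i) * X ^ (i : ℕ)
    have hq : ∀ j, (q j).degree < n := fun j => degree_sum_fin_lt _
    let p : Fin (m + 1) → ℝ[X] := fun j => X ^ n + q j
    have hm : ∀ j, (p j).Monic := fun j => monic_X_pow_add (hq j)
    have hd : ∀ j, (p j).natDegree = n := fun j => by
      refine natDegree_eq_of_degree_eq_some ?_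
      rw [degree_add_eq_left_of_degree_lt (by rw [degree_X_pow]; exact hq j), degree_X_pow]
    have hc : ∀ j (i : Fin n), (p j).coeff i = a j i := fun j i => by
      have : (i : ℕ) ≠ n := i.2.ne
      simp [p, q, coeff_X_pow, this, finsetSum_coeff, Fin.val_inj]
    refine ⟨fun j => ((p j).map Complex.ofRealHom).roots, fun j => isRealDivisor_roots _,
      fun j => by rw [card_roots_map, hd], fun t j => ?_⟩
    have e : f = baseForm n m hz + linForm n m hz a := by rw [ha]; abel
    rw [e, baseForm_add_linForm_apply (p := p) (fun j => by
        have := hm j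
        rwa [Monic, leadingCoeff, hd] at this) hc,
      homog_eq_form (isRealDivisor_roots _) (by rw [card_roots_map, hd]) (hm j) (hd j)
        (map_eq_prod_roots (hm j))]
  · rintro ⟨s, hs, hn, hf⟩
    choose p hm hd hp using fun j => exists_poly_of_divisor (hs j)
    refine ⟨fun j i => (p j).coeff i, ?_⟩
    rw [eq_sub_iff_add_eq, add_comm (linForm n m hz _)]
    ext t j
    rw [baseForm_add_linForm_apply (p := p) (fun j => by
      have := hm j
      rwa [Monic, leadingCoeff, hd, hn] at this) (fun _ _ => rfl), hf,
      homog_eq_form (hs j) (hn j) (hm j) ((hd j).trans (hn j)) (hp j)]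

theorem formSpace_nonempty : (formSpace n m hz : Set C(Seg, Euc m)).Nonempty :=
  ⟨_, AffineSubspace.self_mem_mk' _ _⟩

theorem formSpace_le : formSpace n m hz ≤ formSpace (n + 2) m hz := by
  intro f hf
  obtain ⟨s, hs, hn, hf⟩ := mem_formSpace.1 hf
  refine mem_formSpace.2 ⟨fun j => {z, starRingEnd ℂ z} + s j, fun j => ?_, fun j => ?_, ?_⟩
  · have h1 := isRealDivisor_pair z
    have h2 := hs j
    rw [IsRealDivisor] at *
    rw [Multiset.map_add, h1, h2]
  · rw [Multiset.card_add, hn, Multiset.card_pair, add_comm]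
  · intro t j
    have h0 := (rho_pos hz t).ne'
    rw [hf, form_add (isRealDivisor_pair z) (hs j), form_pair]
    field_simp
    ring

theorem phi_mem_formSpace (d : D n m) : phi z hz d ∈ formSpace n m hz :=
  mem_formSpace.2 ⟨fun j => d.1 j, d.2.1, fun j => (d.1 j).2, fun _ _ => rfl⟩

theorem exists_phi_eq {f : C(Seg, Euc m)} (hf : f ∈ formSpace n m hz)
    (hf' : f ∈ nowhereZero Seg (Euc m)) : ∃ d : D n m, phi z hz d = f := by
  obtain ⟨s, hs, hn, hf⟩ := mem_formSpace.1 hf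
  refine ⟨⟨fun j => ⟨s j, hn j⟩, hs, fun x => ?_⟩, ?_⟩
  · by_contra! h
    obtain ⟨t, ht, hx⟩ := exists_vec_eq x
    apply hf' t
    ext j
    rw [hf, (form_eq_zero_iff (hs j) _).2 ⟨x, h j, ?_⟩, zero_div]
    · rfl
    · rw [hx]
      simp [mul_comm]
  · ext t j
    exact (hf t j).symm

/-! ### Continuous dependence of roots on coefficients -/

theorem form_sub_eq {s : Multiset ℂ} (hs : IsRealDivisor s) (x : ℝ) :
    ((s.map fun z => (x : ℂ) - z).prod) = form s ![x, 1] := by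
  rw [coe_form hs]
  simp

theorem eq_of_form_eq {s s' : Multiset ℂ} (h : ∀ x : ℝ, (s.map fun z => (x : ℂ) - z).prod =
    (s'.map fun z => (x : ℂ) - z).prod) : s = s' := by
  rw [← roots_multiset_prod_X_sub_C s, ← roots_multiset_prod_X_sub_C s']
  congr 1
  refine eq_of_infinite_eval_eq _ _ ((Set.infinite_range_of_injective
    Complex.ofReal_injective).mono ?_)
  rintro _ ⟨x, rfl⟩
  simpa [eval_multiset_prod] using h x

/-- The values of the forms are determined by the function on the interval. -/
theorem form_eq_phi (d : D n m) {x : ℝ} {t : Seg} (ht : 0 < vec t 1)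
    (hx : vec t = vec t 1 • ![x, 1]) (j : Fin (m + 1)) :
    form (d.1 j) ![x, 1] = rho z t ^ n / vec t 1 ^ n * phi z hz d t j := by
  have h0 := (rho_pos hz t).ne'
  rw [phi_apply]
  conv_rhs => rw [hx, form_smul (d.2.1 j)]
  rw [Sym.card_coe]
  have : (vec t 1 • ![x, 1] : Fin 2 → ℝ) 1 = vec t 1 := by simp
  rw [this]
  field_simp

/-- Cauchy's bound: bounded coefficients confine the roots to a compact disc. -/
theorem norm_le_of_mem {s : Multiset ℂ} {p : ℝ[X]} (hm : p.Monic)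
    (hp : p.map Complex.ofRealHom = (s.map fun z => (X - C z : ℂ[X])).prod) {c : ℝ} (hc : 0 ≤ c)
    (hpc : ∀ i < p.natDegree, |p.coeff i| ≤ c) {w : ℂ} (hw : w ∈ s) : ‖w‖ ≤ c + 1 := by
  have h0 : p.map Complex.ofRealHom ≠ 0 := (hm.map _).ne_zero
  have hr : (p.map Complex.ofRealHom).IsRoot w := by
    rw [hp, IsRoot, eval_multiset_prod, Multiset.prod_eq_zero_iff, Multiset.map_map]
    exact Multiset.mem_map.2 ⟨w, hw, by simp⟩
  have h1 : ‖w‖ ≤ (cauchyBound (p.map Complex.ofRealHom) : ℝ) := (hr.norm_lt_cauchyBound h0).le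
  refine h1.trans ?_
  rw [cauchyBound, (hm.map _).leadingCoeff, natDegree_map]
  lift c to NNReal using hc
  rw [nnnorm_one, div_one]
  have : (Finset.range p.natDegree).sup (fun x => ‖(p.map Complex.ofRealHom).coeff x‖₊) ≤ c := by
    refine Finset.sup_le fun i hi => ?_
    rw [← NNReal.coe_le_coe, coe_nnnorm, coeff_map]
    simpa using hpc i (Finset.mem_range.1 hi)
  exact_mod_cast add_le_add_left this 1

/-- An injective linear map from a finite-dimensional space is an embedding, so convergence of the
functions gives convergence of the coefficients. The roots then stay bounded and converge along an
ultrafilter, and their limit is the divisor of the limit form. -/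
theorem isInducing_phi : IsInducing (phi z hz : D n m → C(Seg, Euc m)) := by
  rw [isInducing_iff_nhds]
  intro d₀
  refine le_antisymm (continuous_phi.tendsto d₀).le_comap ?_
  rw [le_iff_ultrafilter]
  intro F hF
  have hF' : Tendsto (phi z hz : D n m → C(Seg, Euc m)) F (𝓝 (phi z hz d₀)) := by
    rwa [Tendsto, map_le_iff_le_comap]
  choose p hm hd hp using fun (d : D n m) (j : Fin (m + 1)) => exists_poly_of_divisor (d.2.1 j)
  have hd' : ∀ d j, (p d j).natDegree = n := fun d j => (hd d j).trans (d.1 j).2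
  let a : D n m → Fin (m + 1) → Fin n → ℝ := fun d j i => (p d j).coeff i
  have ha : ∀ d, baseForm n m hz + linForm n m hz (a d) = phi z hz d := by
    intro d
    ext t j
    rw [baseForm_add_linForm_apply (p := p d) (fun j => by
      have := hm d j
      rwa [Monic, leadingCoeff, hd'] at this) (fun _ _ => rfl), phi_apply,
      homog_eq_form (d.2.1 j) (d.1 j).2 (hm d j) (hd' d j) (hp d j)]
  have hta : Tendsto a F (𝓝 (a d₀)) := by
    have hi := (LinearMap.isClosedEmbedding_of_injective (LinearMap.ker_eq_bot.2
      (injective_linForm (n := n) (m := m) (hz := hz)))).isInducing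
    rw [hi.tendsto_nhds_iff]
    have e : ∀ d, linForm n m hz (a d) = phi z hz d - baseForm n m hz := fun d => by
      rw [← ha]
      abel
    simp only [Function.comp_def, e]
    exact hF'.sub_const _
  set c := ‖a d₀‖ + 1 with hc
  have hac : ∀ᶠ d in (F : Filter (D n m)), ‖a d‖ ≤ c :=
    (hta.norm.eventually (gt_mem_nhds (lt_add_one ‖a d₀‖))).mono fun d hd => le_of_lt hd
  choose y hy using fun (d : D n m) (j : Fin (m + 1)) => isQuotientMap_symMk.surjective (d.1 j)
  have hyc : ∀ j, ∀ᶠ d in (F : Filter (D n m)), y d j ∈ Metric.closedBall (0 : Fin n → ℂ) (c + 1) := by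
    intro j
    filter_upwards [hac] with d hd
    rw [mem_closedBall_zero_iff, pi_norm_le_iff_of_nonneg (by positivity)]
    intro i
    refine norm_le_of_mem (hm d j) (hp d j) (by positivity) (fun k hk => ?_)
      (by rw [← hy]; exact mem_symMk.2 ⟨i, rfl⟩)
    rw [hd'] at hk
    exact ((norm_le_pi_norm (a d j) ⟨k, hk⟩).trans (norm_le_pi_norm (a d) j)).trans hd
  choose y₀ _ hy₀ using fun j => (isCompact_closedBall (0 : Fin n → ℂ) (c + 1)).ultrafilter_le_nhds
    (F.map fun d => y d j) (le_principal_iff.2 (hyc j))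
  have hy₀' : ∀ j, Tendsto (fun d => y d j) F (𝓝 (y₀ j)) := hy₀
  -- The two divisors agree because both products are limits of the same values at every real point.
  have hlim : ∀ j, symMk (y₀ j) = d₀.1 j := by
    intro j
    refine Subtype.ext (eq_of_form_eq fun x => ?_)
    obtain ⟨t, ht, hx⟩ := exists_vec_eq x
    have h1 : Tendsto (fun d : D n m => (form (d.1 j) ![x, 1] : ℂ)) F
        (𝓝 (form (d₀.1 j) ![x, 1] : ℂ)) := by
      refine (Complex.continuous_ofReal.tendsto _).comp ?_
      simp only [form_eq_phi (z := z) (hz := hz) _ ht hx]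
      refine Tendsto.const_mul _ ?_
      have : Continuous fun f : C(Seg, Euc m) => f t j := by fun_prop
      exact (this.tendsto _).comp hF'
    have e : ∀ x : ℝ, ∀ y : Fin n → ℂ,
        ((symMk y : Multiset ℂ).map fun z => (x : ℂ) - z).prod = ∏ i, ((x : ℂ) - y i) := by
      intro x y
      rw [map_symMk, prod_symMk]
    have h2 : Tendsto (fun d : D n m => (form (d.1 j) ![x, 1] : ℂ)) F
        (𝓝 (∏ i, ((x : ℂ) - y₀ j i))) := by
      have : Continuous fun y : Fin n → ℂ => ∏ i, ((x : ℂ) - y i) := by fun_prop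
      refine ((this.tendsto _).comp (hy₀' j)).congr fun d => ?_
      rw [← form_sub_eq (d.2.1 j), ← hy, e]
      rfl
    change ((symMk (y₀ j) : Multiset ℂ).map fun z => (x : ℂ) - z).prod =
      ((d₀.1 j : Multiset ℂ).map fun z => (x : ℂ) - z).prod
    rw [e, form_sub_eq (d₀.2.1 j)]
    exact tendsto_nhds_unique h2 h1
  have : Tendsto (fun d : D n m => d) F (𝓝 d₀) := by
    refine tendsto_subtype_rng.2 (tendsto_pi_nhds.2 fun j => ?_)
    have h := (continuous_symMk.tendsto (y₀ j)).comp (hy₀' j)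
    rw [hlim j] at h
    exact h.congr fun d => hy d j
  exact this

theorem injective_phi : Function.Injective (phi z hz : D n m → C(Seg, Euc m)) := by
  intro d d' h
  refine Subtype.ext (funext fun j => Subtype.ext (eq_of_form_eq fun x => ?_))
  obtain ⟨t, ht, hx⟩ := exists_vec_eq x
  change ((d.1 j : Multiset ℂ).map fun z => (x : ℂ) - z).prod =
    ((d'.1 j : Multiset ℂ).map fun z => (x : ℂ) - z).prod
  rw [form_sub_eq (d.2.1 j), form_sub_eq (d'.2.1 j), form_eq_phi (z := z) (hz := hz) d ht hx,
    form_eq_phi (z := z) (hz := hz) d' ht hx, h]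

end

/-- Tuples of divisors correspond to nowhere vanishing tuples of forms. -/
noncomputable def homeoD (n m : ℕ) {z : ℂ} (hz : z.im ≠ 0) :
    D n m ≃ₜ ((formSpace n m hz : Set C(Seg, Euc m)) ∩ nowhereZero Seg (Euc m) : Set _) :=
  (Equiv.ofBijective
    (fun d => (⟨phi z hz d, phi_mem_formSpace d, phi_mem d⟩ :
      ((formSpace n m hz : Set C(Seg, Euc m)) ∩ nowhereZero Seg (Euc m) : Set _)))
    ⟨fun d d' h => injective_phi (z := z) (hz := hz) (congrArg Subtype.val h), fun f => by
      obtain ⟨d, hd⟩ := exists_phi_eq f.2.1 f.2.2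
      exact ⟨d, Subtype.ext hd⟩⟩).toHomeomorphOfIsInducing
    (IsInducing.of_comp (continuous_phi.subtype_mk _) continuous_subtype_val
      (isInducing_phi (z := z) (hz := hz)))

end RationalLoops

namespace RationalLoops

open Topology Filter Set

/-! ## Rational loops as normalized functions -/

/-- Equality of lines is the closed condition that the 2 × 2 minors of representatives vanish. -/
instance (m : ℕ) : T2Space (RP m) := by
  rw [t2Space_iff_of_isOpenQuotientMap RP.isOpenQuotientMap_mk]
  have h : Continuous fun q : {v : Fin (m + 1) → ℝ // v ≠ 0} × {v : Fin (m + 1) → ℝ // v ≠ 0} =>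
      (q.1.1, RP.mk q.2) :=
    (continuous_subtype_val.comp continuous_fst).prodMk
      (RP.isOpenQuotientMap_mk.continuous.comp continuous_snd)
  convert! isClosed_inc.preimage h using 1
  ext q
  refine ⟨fun h => ?_, fun h => (Inc.eq_mk h q.1.2).symm⟩
  change RP.mk q.1 = RP.mk q.2 at h
  change Inc q.1.1 (RP.mk q.2)
  rw [← h, inc_mk]
  exact fun i j => mul_comm _ _

/-- Composition with a proper surjective map is an inducing map of spaces of continuous maps. -/
theorem isInducing_precomp {X Y Z : Type} [TopologicalSpace X] [TopologicalSpace Y]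
    [TopologicalSpace Z] [CompactSpace X] [T2Space Y] (f : C(X, Y)) (hf : Function.Surjective f) :
    IsInducing fun g : C(Y, Z) => g.comp f := by
  rw [isInducing_iff_nhds]
  intro g
  refine le_antisymm ((ContinuousMap.continuous_precomp f).tendsto g).le_comap ?_
  refine tendsto_id'.1 (ContinuousMap.tendsto_nhds_compactOpen.2 ?_)
  intro K hK U hU hg
  refine ⟨_, ContinuousMap.eventually_mapsTo (f := g.comp f)
    (hK.isClosed.preimage f.continuous).isCompact hU (fun x hx => hg hx), fun h hh y hy => ?_⟩
  obtain ⟨x, rfl⟩ := hf y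
  exact hh hy

/-- The parametrization of the projective line by the interval. -/
noncomputable def segMap : C(Seg, RP 1) :=
  ⟨fun t => RP.mk ⟨vec t, vec_ne_zero t⟩,
    RP.isOpenQuotientMap_mk.continuous.comp (continuous_vec.subtype_mk _)⟩

theorem surjective_segMap : Function.Surjective segMap := by
  intro y
  rcases aff_or_infty y with rfl | ⟨x, rfl⟩
  · exact ⟨⟨1, by norm_num, le_rfl⟩, congrArg RP.mk (Subtype.ext vec_top)⟩
  · obtain ⟨t, ht, h⟩ := exists_vec_eq x
    exact ⟨t, (RP.mk_eq_iff _ _).2 ⟨_, h.symm⟩⟩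

/-- The point of the projective space defined by a nonzero vector of the Euclidean space. -/
noncomputable def eucMk {m : ℕ} (u : {u : Euc m // u ≠ 0}) : RP m :=
  RP.mk ⟨WithLp.ofLp u.1, fun h => u.2 ((WithLp.ofLp_eq_zero 2).1 h)⟩

theorem eucMk_eq_iff {m : ℕ} (u w : {u : Euc m // u ≠ 0}) :
    eucMk u = eucMk w ↔ ∃ a : ℝ, a • w.1 = u.1 := by
  rw [eucMk, eucMk, RP.mk_eq_iff]
  refine exists_congr fun a => ⟨fun h => ?_, fun h => ?_⟩
  · ext j
    exact congrFun h j
  · exact congrArg WithLp.ofLp h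

theorem isOpenQuotientMap_eucMk {m : ℕ} : IsOpenQuotientMap (eucMk (m := m)) := by
  let e : {u : Euc m // u ≠ 0} ≃ₜ {v : Fin (m + 1) → ℝ // v ≠ 0} :=
    (PiLp.homeomorph 2 fun _ : Fin (m + 1) => ℝ).subtype fun u =>
      not_congr (WithLp.ofLp_eq_zero 2).symm
  exact RP.isOpenQuotientMap_mk.comp e.isOpenQuotientMap

/-- The pairs of lines whose angle has a cosine greater than `c`. -/
def nearLines (m : ℕ) (c : ℝ) : Set (RP m × RP m) :=
  {p | ∀ u w : {u : Euc m // u ≠ 0}, eucMk u = p.1 → eucMk w = p.2 →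
    c * (‖u.1‖ * ‖w.1‖) < |inner ℝ u.1 w.1|}

theorem mk_mem_nearLines {m : ℕ} {c : ℝ} (u w : {u : Euc m // u ≠ 0}) :
    (eucMk u, eucMk w) ∈ nearLines m c ↔ c * (‖u.1‖ * ‖w.1‖) < |inner ℝ u.1 w.1| := by
  refine ⟨fun h => h u w rfl rfl, fun h u' w' hu hw => ?_⟩
  obtain ⟨a, ha⟩ := (eucMk_eq_iff _ _).1 hu
  obtain ⟨b, hb⟩ := (eucMk_eq_iff _ _).1 hw
  have ha0 : a ≠ 0 := by
    rintro rfl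
    exact u'.2 (by rw [← ha, zero_smul])
  have hb0 : b ≠ 0 := by
    rintro rfl
    exact w'.2 (by rw [← hb, zero_smul])
  rw [← ha, ← hb, norm_smul, norm_smul, real_inner_smul_left, real_inner_smul_right, abs_mul,
    abs_mul, Real.norm_eq_abs, Real.norm_eq_abs]
  have := mul_lt_mul_of_pos_left h (mul_pos (abs_pos.2 ha0) (abs_pos.2 hb0))
  linarith

theorem isOpen_nearLines (m : ℕ) (c : ℝ) : IsOpen (nearLines m c) := by
  rw [← (isOpenQuotientMap_eucMk.prodMap isOpenQuotientMap_eucMk).isQuotientMap.isOpen_preimage]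
  have h1 : Continuous fun p : {u : Euc m // u ≠ 0} × {u : Euc m // u ≠ 0} => p.1.1 :=
    continuous_subtype_val.comp continuous_fst
  have h2 : Continuous fun p : {u : Euc m // u ≠ 0} × {u : Euc m // u ≠ 0} => p.2.1 :=
    continuous_subtype_val.comp continuous_snd
  convert! isOpen_lt (continuous_const.mul (h1.norm.mul h2.norm)) (h1.inner h2).abs using 1
  ext p
  exact mk_mem_nearLines _ _

section

variable {n m : ℕ} {z : ℂ} {hz : z.im ≠ 0}

theorem ratLoop_segMap (d : D n m) (t : Seg) :
    (ratLoop d).1 (segMap t) = eucMk ⟨phi z hz d t, phi_mem d t⟩ := by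
  refine (RP.mk_eq_iff _ _).2 ⟨rho z t ^ n, ?_⟩
  ext j
  change rho z t ^ n * phi z hz d t j = form (d.1 j) (vec t)
  rw [phi_apply, mul_div_cancel₀ _ (pow_ne_zero n (rho_pos hz t).ne')]

theorem ratLoop_segMap_normalize (d : D n m) (t : Seg) (h : normalize (phi z hz d) t ≠ 0) :
    (ratLoop d).1 (segMap t) = eucMk ⟨normalize (phi z hz d) t, h⟩ := by
  rw [ratLoop_segMap (hz := hz), eucMk_eq_iff]
  refine ⟨‖phi z hz d t‖, ?_⟩
  simp only
  rw [normalize_apply (phi_mem d), smul_smul,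
    mul_inv_cancel₀ (norm_ne_zero_iff.2 (phi_mem d t)), one_smul]

theorem phi_top (d : D n m) (j : Fin (m + 1)) : 0 < phi z hz d ⟨1, by norm_num, le_rfl⟩ j := by
  rw [phi_apply, vec_top, form_one_zero]
  exact div_pos one_pos (pow_pos (rho_pos hz _) n)

/-- Loops close to a rational loop have normalizations close to its normalization. -/
theorem eventually_inner_normalize (d₀ : D n m) {c : ℝ} (hc0 : 0 ≤ c) (hc : c < 1) :
    ∀ᶠ γ in 𝓝 (ratLoop d₀), ∀ (k : ℕ) (d : D k m), ratLoop d = γ →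
      ∀ t, c < inner ℝ (normalize (phi z hz d) t) (normalize (phi z hz d₀) t) := by
  have hO : ∀ᶠ γ in 𝓝 (ratLoop d₀), ∀ t, (γ.1 (segMap t), (ratLoop d₀).1 (segMap t)) ∈
      nearLines m c := by
    have h1 : Continuous fun γ : Loop m =>
        ((γ.1.prodMk (ratLoop d₀).1).comp segMap : C(Seg, RP m × RP m)) := by
      refine ContinuousMap.continuous_of_continuous_uncurry _ ?_
      have h3 : Continuous fun γ : Loop m => (γ.1.comp segMap : C(Seg, RP m)) :=
        (ContinuousMap.continuous_precomp segMap).comp continuous_subtype_val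
      have h4 : Continuous fun p : Loop m × Seg => (p.1.1.comp segMap : C(Seg, RP m)) p.2 :=
        continuous_eval.comp ((h3.comp continuous_fst).prodMk continuous_snd)
      exact h4.prodMk (((ratLoop d₀).1.comp segMap).continuous.comp continuous_snd)
    have h2 := (h1.tendsto (ratLoop d₀)).eventually (ContinuousMap.eventually_mapsTo
      (isCompact_univ) (isOpen_nearLines m c) fun t _ => by
        change ((ratLoop d₀).1 (segMap t), (ratLoop d₀).1 (segMap t)) ∈ _
        rw [ratLoop_segMap (hz := hz), mk_mem_nearLines, real_inner_self_eq_norm_sq,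
          abs_of_nonneg (by positivity)]
        have := norm_pos_iff.2 (phi_mem (hz := hz) d₀ t)
        nlinarith [mul_pos this this])
    exact h2.mono fun γ h t => h (mem_univ t)
  filter_upwards [hO] with γ hγ k d hd t
  subst hd
  have hn : ∀ t, normalize (phi z hz d) t ≠ 0 ∧ normalize (phi z hz d₀) t ≠ 0 := fun t => by
    constructor <;> rw [← norm_ne_zero_iff, norm_normalize (phi_mem _)] <;> norm_num
  have habs : ∀ t, c < |inner ℝ (normalize (phi z hz d) t) (normalize (phi z hz d₀) t)| := by
    intro t
    have := hγ t
    rw [ratLoop_segMap_normalize d t (hn t).1, ratLoop_segMap_normalize d₀ t (hn t).2,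
      mk_mem_nearLines, norm_normalize (phi_mem _), norm_normalize (phi_mem _)] at this
    simpa using this
  have hcont : Continuous fun t => inner ℝ (normalize (phi z hz d) t) (normalize (phi z hz d₀) t) :=
    (ContinuousMap.continuous _).inner (ContinuousMap.continuous _)
  -- Closeness of lines controls the inner product only up to sign. It never vanishes, and at the
  -- end point 1 it is nonnegative since monic forms have positive components there; by
  -- connectedness it is positive throughout.
  have hpos : ∀ t, 0 < inner ℝ (normalize (phi z hz d) t) (normalize (phi z hz d₀) t) := by
    intro t
    by_contra! ht
    have h1 : 0 ≤ inner ℝ (normalize (phi z hz d) ⟨1, by norm_num, le_rfl⟩)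
        (normalize (phi z hz d₀) ⟨1, by norm_num, le_rfl⟩) := by
      rw [normalize_apply (phi_mem _), normalize_apply (phi_mem _), real_inner_smul_left,
        real_inner_smul_right, PiLp.inner_apply]
      refine mul_nonneg (by positivity) (mul_nonneg (by positivity) (Finset.sum_nonneg fun j _ => ?_))
      exact mul_nonneg (phi_top d₀ j).le (phi_top d j).le
    have := Subtype.preconnectedSpace (isPreconnected_Icc (a := (-1 : ℝ)) (b := 1))
    obtain ⟨t', h0⟩ := mem_range_of_exists_le_of_exists_ge hcont ⟨t, ht⟩ ⟨_, h1⟩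
    have := habs t'
    beta_reduce at h0
    rw [h0, abs_zero] at this
    exact absurd this hc0.not_gt
  have := habs t
  rwa [abs_of_pos (hpos t)] at this

theorem eventually_dist_normalize (d₀ : D n m) {ε : ℝ} (hε : 0 < ε) :
    ∀ᶠ γ in 𝓝 (ratLoop d₀), ∀ (k : ℕ) (d : D k m), ratLoop d = γ →
      dist (normalize (phi z hz d)) (normalize (phi z hz d₀)) < ε := by
  -- Unit vectors whose inner product exceeds 1 - δ²/2 have distance less than δ. The bound δ ≤ 1
  -- keeps this cosine nonnegative.
  set δ := min (ε / 2) 1 with hδ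
  have hδ0 : 0 < δ := lt_min (half_pos hε) one_pos
  have hδ1 : δ ≤ 1 := min_le_right _ _
  have hδε : δ < ε := (min_le_left _ _).trans_lt (half_lt_self hε)
  filter_upwards [eventually_inner_normalize (hz := hz) d₀ (c := 1 - δ ^ 2 / 2) (by nlinarith)
    (by nlinarith)] with γ hγ k d hd
  refine lt_of_le_of_lt ((ContinuousMap.dist_le hδ0.le).2 fun t => ?_) hδε
  have h := hγ k d hd t
  rw [dist_eq_norm]
  refine abs_le_of_sq_le_sq' ?_ hδ0.le |>.2
  rw [norm_sub_sq_real, norm_normalize (phi_mem _), norm_normalize (phi_mem _)]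
  linarith

/-- A loop is close to itself to every precision. The degrees may differ, which makes the normalized
function compatible with the inclusions of the spaces of loops. -/
theorem normalize_eq_of_ratLoop_eq {k : ℕ} {d : D k m} {d₀ : D n m} (h : ratLoop d = ratLoop d₀) :
    normalize (phi z hz d) = normalize (phi z hz d₀) := by
  refine eq_of_forall_dist_le fun ε hε => ?_
  exact ((eventually_dist_normalize (hz := hz) d₀ hε).self_of_nhds k d h).le

theorem ratLoop_eq_of_normalize_eq {k : ℕ} {d : D k m} {d₀ : D n m}
    (h : normalize (phi z hz d) = normalize (phi z hz d₀)) : ratLoop d = ratLoop d₀ := by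
  refine Subtype.ext (ContinuousMap.ext fun y => ?_)
  obtain ⟨t, rfl⟩ := surjective_segMap y
  have hn : normalize (phi z hz d) t ≠ 0 := by
    rw [← norm_ne_zero_iff, norm_normalize (phi_mem _)]
    norm_num
  rw [ratLoop_segMap_normalize d t hn, ratLoop_segMap_normalize d₀ t (h ▸ hn)]
  congr 2
  rw [h]

end

/-- The normalizations of nowhere vanishing tuples of monic forms. -/
def sphere (n m : ℕ) {z : ℂ} (hz : z.im ≠ 0) : Set C(Seg, Euc m) :=
  normalize '' ((formSpace n m hz : Set C(Seg, Euc m)) ∩ nowhereZero Seg (Euc m))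

section

variable {n m : ℕ} {z : ℂ} {hz : z.im ≠ 0}

theorem normalize_phi_mem (d : D n m) : normalize (phi z hz d) ∈ sphere n m hz :=
  mem_image_of_mem _ ⟨phi_mem_formSpace d, phi_mem d⟩

/-- The normalized function of a rational loop. -/
noncomputable def nu {n m : ℕ} (hm : 1 ≤ m) {z : ℂ} (hz : z.im ≠ 0) (γ : Rat n m) :
    sphere n m hz :=
  ⟨_, normalize_phi_mem (P_surjective hm n γ).choose⟩

variable (hm : 1 ≤ m)

theorem nu_eq {k : ℕ} {d : D k m} {γ : Rat n m} (h : γ.1 = ratLoop d) :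
    (nu hm hz γ : C(Seg, Euc m)) = normalize (phi z hz d) :=
  normalize_eq_of_ratLoop_eq
    ((congrArg Subtype.val (P_surjective hm n γ).choose_spec).trans h)

theorem nu_P (d : D n m) : (nu hm hz (P hm n d) : C(Seg, Euc m)) = normalize (phi z hz d) :=
  nu_eq hm rfl

/-- The estimate near a loop holds for all divisors that represent a neighbouring loop, so the
arbitrary choice in `nu` does no harm. -/
theorem continuous_nu : Continuous (nu (n := n) hm hz) := by
  refine continuous_induced_rng.2 (continuous_iff_continuousAt.2 fun γ => ?_)
  obtain ⟨d₀, rfl⟩ := P_surjective hm n γ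
  refine Metric.tendsto_nhds.2 fun ε hε => ?_
  have h := eventually_dist_normalize (hz := hz) d₀ hε
  have h' : Tendsto (fun γ : Rat n m => γ.1) (𝓝 (P hm n d₀)) (𝓝 (ratLoop d₀)) :=
    continuous_subtype_val.tendsto (P hm n d₀)
  filter_upwards [h'.eventually h] with γ hγ
  obtain ⟨d, rfl⟩ := P_surjective hm n γ
  simp only [Function.comp_apply, nu_P]
  exact hγ n d rfl

theorem sphere_ne_zero {g : C(Seg, Euc m)} (hg : g ∈ sphere n m hz) (t : Seg) : g t ≠ 0 := by
  obtain ⟨f, hf, rfl⟩ := hg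
  rw [← norm_ne_zero_iff, norm_normalize hf.2]
  norm_num

/-- The projection of a nowhere vanishing function to the projective space. -/
noncomputable def projectSphere (g : sphere n m hz) : C(Seg, RP m) :=
  ⟨fun t => eucMk ⟨g.1 t, sphere_ne_zero g.2 t⟩,
    isOpenQuotientMap_eucMk.continuous.comp (g.1.continuous.subtype_mk _)⟩

theorem continuous_projectSphere : Continuous (projectSphere (n := n) (m := m) (hz := hz)) := by
  refine ContinuousMap.continuous_of_continuous_uncurry _ ?_
  have h : Continuous fun p : sphere n m hz × Seg => p.1.1 p.2 :=
    continuous_eval.comp ((continuous_subtype_val.comp continuous_fst).prodMk continuous_snd)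
  exact isOpenQuotientMap_eucMk.continuous.comp (h.subtype_mk fun p => sphere_ne_zero p.1.2 p.2)

/-- Projecting a normalized function to the projective space gives back the loop composed with the
parametrization `segMap`, and composition with a continuous surjection from a compact space onto a
Hausdorff one is inducing. -/
theorem isInducing_nu : IsInducing (nu (n := n) hm hz) := by
  refine IsInducing.of_comp (continuous_nu hm) continuous_projectSphere ?_
  have h : projectSphere ∘ nu (n := n) hm hz = (fun g : C(RP 1, RP m) => g.comp segMap) ∘
      (Subtype.val : Loop m → C(RP 1, RP m)) ∘ (Subtype.val : Rat n m → Loop m) := by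
    funext γ
    obtain ⟨d, rfl⟩ := P_surjective hm n γ
    refine ContinuousMap.ext fun t => ?_
    have e := nu_P (hz := hz) hm d
    have := ratLoop_segMap_normalize d t (e ▸ sphere_ne_zero (nu hm hz (P hm n d)).2 t)
    refine Eq.trans ?_ this.symm
    simp only [Function.comp_apply, projectSphere, ContinuousMap.coe_mk, e]
  rw [h]
  exact (isInducing_precomp segMap surjective_segMap).comp
    (IsInducing.subtypeVal.comp IsInducing.subtypeVal)

theorem bijective_nu : Function.Bijective (nu (n := n) hm hz) := by
  constructor
  · intro γ γ' h
    obtain ⟨d, rfl⟩ := P_surjective hm n γ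
    obtain ⟨d', rfl⟩ := P_surjective hm n γ'
    have h' := congrArg Subtype.val h
    rw [nu_P, nu_P] at h'
    exact Subtype.ext (ratLoop_eq_of_normalize_eq h')
  · rintro ⟨_, f, hf, rfl⟩
    obtain ⟨d, rfl⟩ := exists_phi_eq hf.1 hf.2
    exact ⟨P hm n d, Subtype.ext (nu_P hm d)⟩

/-- Rational loops correspond to normalized tuples of forms. -/
noncomputable def homeoRat (n : ℕ) (hm : 1 ≤ m) (hz : z.im ≠ 0) : Rat n m ≃ₜ sphere n m hz :=
  (Equiv.ofBijective _ (bijective_nu (n := n) (hz := hz) hm)).toHomeomorphOfIsInducing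
    (isInducing_nu hm)

theorem homeoRat_P (d : D n m) :
    (homeoRat n hm hz (P hm n d) : C(Seg, Euc m)) = normalize (phi z hz d) := nu_P hm d

theorem homeoRat_stabRat (γ : Rat n m) :
    (homeoRat (n + 2) hm hz (stabRat hm n γ) : C(Seg, Euc m)) = homeoRat n hm hz γ := by
  obtain ⟨d, rfl⟩ := P_surjective hm n γ
  rw [homeoRat_P]
  exact nu_eq hm rfl

theorem continuous_P : Continuous (P hm n) := by
  rw [← (homeoRat n hm I_im_ne).comp_continuous_iff, continuous_induced_rng]
  change Continuous fun d => (homeoRat n hm I_im_ne (P hm n d) : C(Seg, Euc m))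
  simp only [homeoRat_P]
  exact continuousOn_normalize.comp_continuous continuous_phi phi_mem

/-- Under `homeoRat` this is the inclusion of `Rat n m` in `Rat (n + 2) m`, which is closed because
`Rat n m` is a closure in the loop space. By `P_surjective` every loop in that closure comes from
forms of degree `n`. -/
theorem exists_isClosed_sphere (n : ℕ) (hm : 1 ≤ m) (hz : z.im ≠ 0) :
    ∃ Z, IsClosed Z ∧ sphere (n + 2) m hz ∩ Z = sphere n m hz := by
  have h : IsClosed {g : sphere (n + 2) m hz |
      ((homeoRat (n + 2) hm hz).symm g).1 ∈ closure (RRat n m)} :=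
    isClosed_closure.preimage
      (continuous_subtype_val.comp (homeoRat (n + 2) hm hz).symm.continuous)
  obtain ⟨Z, hZ, hZh⟩ := isClosed_induced_iff.1 h
  have key : ∀ g : sphere (n + 2) m hz, g.1 ∈ Z ↔
      ((homeoRat (n + 2) hm hz).symm g).1 ∈ closure (RRat n m) := fun g => by
    have := congrArg (fun s => g ∈ s) hZh
    exact this.to_iff
  refine ⟨Z, hZ, subset_antisymm ?_ ?_⟩
  · rintro g ⟨hg, hgZ⟩
    have h1 := (key ⟨g, hg⟩).1 hgZ
    obtain ⟨d, hd⟩ := P_surjective hm n ⟨_, h1⟩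
    have h2 : (homeoRat (n + 2) hm hz).symm ⟨g, hg⟩ = stabRat hm n (P hm n d) :=
      Subtype.ext (congrArg Subtype.val hd).symm
    have h3 := congrArg (homeoRat (n + 2) hm hz) h2
    rw [Homeomorph.apply_symm_apply] at h3
    have h4 := congrArg Subtype.val h3
    rw [homeoRat_stabRat] at h4
    change g = _ at h4
    rw [h4]
    exact Subtype.prop _
  · intro g hg
    set γ := (homeoRat n hm hz).symm ⟨g, hg⟩ with hγ
    have h1 : (homeoRat (n + 2) hm hz (stabRat hm n γ) : C(Seg, Euc m)) = g := by
      rw [homeoRat_stabRat, hγ, Homeomorph.apply_symm_apply]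
    rw [← h1]
    refine ⟨Subtype.prop _, (key _).2 ?_⟩
    rw [Homeomorph.symm_apply_apply]
    exact γ.2

end

end RationalLoops

namespace RationalLoops

open Topology Filter Set

/-! ## Real zeros of odd multiplicity -/

theorem IsRealDivisor.add {s t : Multiset ℂ} (hs : IsRealDivisor s) (ht : IsRealDivisor t) :
    IsRealDivisor (s + t) := by
  rw [IsRealDivisor] at *
  rw [Multiset.map_add, hs, ht]

theorem IsRealDivisor.of_add {s t : Multiset ℂ} (hs : IsRealDivisor s)
    (h : IsRealDivisor (s + t)) : IsRealDivisor t := by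
  rw [IsRealDivisor] at *
  rw [Multiset.map_add, hs] at h
  exact add_left_cancel h

theorem isRealDivisor_map (e : Multiset ℝ) : IsRealDivisor (e.map ((↑) : ℝ → ℂ)) := by
  rw [IsRealDivisor, Multiset.map_map]
  simp

theorem isRealDivisor_replicate (k : ℕ) (x : ℝ) :
    IsRealDivisor (Multiset.replicate k (x : ℂ)) := by
  simp [IsRealDivisor]

theorem form_pair_nonneg (z : ℂ) (v : Fin 2 → ℝ) : 0 ≤ form {z, starRingEnd ℂ z} v := by
  have : form {z, starRingEnd ℂ z} v = ‖(v 0 : ℂ) - z * v 1‖ ^ 2 := by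
    apply Complex.ofReal_injective
    rw [coe_form (isRealDivisor_pair z)]
    push_cast
    rw [← Complex.mul_conj']
    simp
  rw [this]
  positivity

theorem form_replicate (k : ℕ) (x : ℝ) (v : Fin 2 → ℝ) :
    form (Multiset.replicate k (x : ℂ)) v = (v 0 - x * v 1) ^ k := by
  apply Complex.ofReal_injective
  rw [coe_form (isRealDivisor_replicate k x)]
  simp

/-- A real point of even positive multiplicity occurs at least twice, and a non-real point occurs
together with its distinct conjugate. -/
theorem pair_le {s : Multiset ℂ} (hs : IsRealDivisor s) (h : ∀ x : ℝ, Even (s.count (x : ℂ)))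
    {z : ℂ} (hz : z ∈ s) : ({z, starRingEnd ℂ z} : Multiset ℂ) ≤ s := by
  by_cases hr : starRingEnd ℂ z = z
  · obtain ⟨x, rfl⟩ := Complex.conj_eq_iff_real.1 hr
    rw [hr]
    change Multiset.replicate 2 (x : ℂ) ≤ s
    rw [← Multiset.le_count_iff_replicate_le]
    have h1 := Multiset.count_pos.2 hz
    obtain ⟨k, hk⟩ := h x
    omega
  · refine (Multiset.le_iff_subset ?_).2 fun w hw => ?_
    · simpa using Ne.symm hr
    · simp only [Multiset.insert_eq_cons, Multiset.mem_cons, Multiset.mem_singleton] at hw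
      rcases hw with rfl | rfl
      · exact hz
      · rw [← hs]
        exact Multiset.mem_map_of_mem _ hz

theorem even_count_pair (z : ℂ) (x : ℝ) :
    Even (Multiset.count (x : ℂ) {z, starRingEnd ℂ z}) := by
  by_cases h : (x : ℂ) = z
  · subst h
    simp
  · have h' : (x : ℂ) ≠ starRingEnd ℂ z := fun e => h (by
      have := congrArg (starRingEnd ℂ) e
      simpa using this)
    simp [h, h']

/-- The divisor splits into pairs of a point and its conjugate, each of which contributes a squared
absolute value. -/
theorem form_nonneg {s : Multiset ℂ} (hs : IsRealDivisor s)
    (h : ∀ x : ℝ, Even (s.count (x : ℂ))) (v : Fin 2 → ℝ) : 0 ≤ form s v := by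
  induction hn : Multiset.card s using Nat.strong_induction_on generalizing s with
  | _ n ih =>
    rcases Multiset.empty_or_exists_mem s with rfl | ⟨z, hz⟩
    · simp [form]
    · obtain ⟨t, rfl⟩ := Multiset.le_iff_exists_add.1 (pair_le hs h hz)
      have ht := (isRealDivisor_pair z).of_add hs
      rw [form_add (isRealDivisor_pair z) ht]
      refine mul_nonneg (form_pair_nonneg z v) (ih (Multiset.card t) ?_ ht (fun x => ?_) rfl)
      · rw [← hn, Multiset.card_add, Multiset.card_pair]
        omega
      · have h1 := h x
        rw [Multiset.count_add] at h1
        exact (Nat.even_add.1 h1).1 (even_count_pair z x)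

/-- At a zero of odd multiplicity the form changes sign. -/
theorem even_count_of_form_nonneg {s : Multiset ℂ} (hs : IsRealDivisor s)
    (h : ∀ x : ℝ, 0 ≤ form s ![x, 1]) (x : ℝ) : Even (s.count (x : ℂ)) := by
  by_contra hodd
  rw [Nat.not_even_iff_odd] at hodd
  obtain ⟨k, hk⟩ : ∃ k, k = s.count (x : ℂ) := ⟨_, rfl⟩
  rw [← hk] at hodd
  obtain ⟨t, rfl⟩ := Multiset.le_iff_exists_add.1
    (Multiset.le_count_iff_replicate_le.1 hk.le)
  have ht := (isRealDivisor_replicate k x).of_add hs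
  have h0 : form t ![x, 1] ≠ 0 := by
    rw [Ne, form_eq_zero_iff ht]
    rintro ⟨w, hw, e⟩
    have e' : (x : ℂ) = w := by simpa using e
    rw [Multiset.count_add, Multiset.count_replicate_self, e'] at hk
    have := Multiset.count_pos.2 hw
    omega
  have hc : Continuous fun y : ℝ => form t ![y, 1] := (continuous_form t).comp (by fun_prop)
  have h' : ∀ y : ℝ, 0 ≤ (y - x) ^ k * form t ![y, 1] := by
    intro y
    have := h y
    rw [form_add (isRealDivisor_replicate k x) ht, form_replicate] at this
    simpa using this
  -- The cofactor keeps its sign near `x`. A negative value of the product occurs just to the right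
  -- of `x` if the cofactor is negative, and just to the left if it is positive.
  rcases lt_or_gt_of_ne h0 with hneg | hpos
  · have h1 : ∀ᶠ y in 𝓝[>] x, form t ![y, 1] < 0 :=
      (hc.continuousAt.eventually (gt_mem_nhds hneg)).filter_mono nhdsWithin_le_nhds
    obtain ⟨y, hy, hxy⟩ := (h1.and self_mem_nhdsWithin).exists
    have h2 : 0 < (y - x) ^ k := pow_pos (sub_pos.2 hxy) k
    nlinarith [h' y]
  · have h1 : ∀ᶠ y in 𝓝[<] x, 0 < form t ![y, 1] :=
      (hc.continuousAt.eventually (lt_mem_nhds hpos)).filter_mono nhdsWithin_le_nhds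
    obtain ⟨y, hy, hxy⟩ := (h1.and self_mem_nhdsWithin).exists
    have h2 : (y - x) ^ k < 0 := hodd.pow_neg (sub_neg.2 hxy)
    nlinarith [h' y]

/-- The real points of odd multiplicity. -/
noncomputable def oddSet (s : Multiset ℂ) : Finset ℝ :=
  (realPart s).toFinset.filter fun x => Odd (s.count (x : ℂ))

theorem mem_oddSet {s : Multiset ℂ} {x : ℝ} : x ∈ oddSet s ↔ Odd (s.count (x : ℂ)) := by
  rw [oddSet, Finset.mem_filter, Multiset.mem_toFinset, mem_realPart, and_iff_right_iff_imp]
  exact fun h => Multiset.count_pos.1 h.pos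

theorem mem_of_mem_oddSet {s : Multiset ℂ} {x : ℝ} (h : x ∈ oddSet s) : (x : ℂ) ∈ s :=
  Multiset.count_pos.1 (mem_oddSet.1 h).pos

theorem count_map_ofReal (e : Multiset ℝ) (x : ℝ) :
    (e.map ((↑) : ℝ → ℂ)).count (x : ℂ) = e.count x :=
  Multiset.count_map_eq_count' _ _ Complex.ofReal_injective _

theorem count_oddSet_modEq (s : Multiset ℂ) (x : ℝ) :
    (oddSet s).val.count x ≡ s.count (x : ℂ) [MOD 2] := by
  by_cases h : x ∈ oddSet s
  · rw [Multiset.count_eq_one_of_mem (oddSet s).nodup h]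
    exact (Nat.odd_iff.1 (mem_oddSet.1 h)).symm
  · rw [Multiset.count_eq_zero_of_notMem h]
    rw [mem_oddSet, Nat.not_odd_iff_even] at h
    exact (Nat.even_iff.1 h).symm

theorem modEq_two_iff {a b : ℕ} : a ≡ b [MOD 2] ↔ Even (a + b) := by
  rw [Nat.even_iff, Nat.ModEq]
  omega

theorem oddSet_eq_iff {s t : Multiset ℂ} :
    oddSet s = oddSet t ↔ ∀ x : ℝ, s.count (x : ℂ) ≡ t.count (x : ℂ) [MOD 2] := by
  rw [Finset.ext_iff]
  refine forall_congr' fun x => ?_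
  rw [mem_oddSet, mem_oddSet, modEq_two_iff, Nat.even_add']

/-- The product of two forms has no negative values if and only if the multiplicities of their real
zeros are congruent modulo 2. -/
theorem form_mul_form_nonneg {s t : Multiset ℂ} (hs : IsRealDivisor s) (ht : IsRealDivisor t)
    (h : ∀ x : ℝ, s.count (x : ℂ) ≡ t.count (x : ℂ) [MOD 2]) (v : Fin 2 → ℝ) :
    0 ≤ form s v * form t v := by
  rw [← form_add hs ht]
  refine form_nonneg (hs.add ht) (fun x => ?_) v
  rw [Multiset.count_add]
  exact modEq_two_iff.1 (h x)

theorem count_modEq_of_nonneg {s t : Multiset ℂ} (hs : IsRealDivisor s) (ht : IsRealDivisor t)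
    (h : ∀ x : ℝ, 0 ≤ form s ![x, 1] * form t ![x, 1]) (x : ℝ) :
    s.count (x : ℂ) ≡ t.count (x : ℂ) [MOD 2] := by
  rw [modEq_two_iff, ← Multiset.count_add]
  refine even_count_of_form_nonneg (hs.add ht) (fun y => ?_) x
  rw [form_add hs ht]
  exact h y

theorem card_oddSet {s : Multiset ℂ} (hs : IsRealDivisor s) :
    ∃ k, (oddSet s).card + 2 * k = Multiset.card s := by
  obtain ⟨k, hk⟩ := card_realPart hs
  -- The discarded pairs are the `k` conjugate pairs off the real axis and, at each real point, half
  -- of its multiplicity rounded down.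
  refine ⟨k + ∑ x ∈ (realPart s).toFinset, s.count (x : ℂ) / 2, ?_⟩
  have h1 : (oddSet s).card = ∑ x ∈ (realPart s).toFinset, s.count (x : ℂ) % 2 := by
    rw [oddSet, Finset.card_filter]
    refine Finset.sum_congr rfl fun x _ => ?_
    split_ifs with h
    · exact (Nat.odd_iff.1 h).symm
    · exact (Nat.even_iff.1 (Nat.not_odd_iff_even.1 h)).symm
  have h2 : Multiset.card (realPart s) = ∑ x ∈ (realPart s).toFinset, s.count (x : ℂ) := by
    rw [← Multiset.toFinset_sum_count_eq]
    exact Finset.sum_congr rfl fun x _ => count_realPart s x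
  have h3 : (∑ x ∈ (realPart s).toFinset, s.count (x : ℂ) % 2) +
      2 * (∑ x ∈ (realPart s).toFinset, s.count (x : ℂ) / 2) =
      ∑ x ∈ (realPart s).toFinset, s.count (x : ℂ) := by
    rw [Finset.mul_sum, ← Finset.sum_add_distrib]
    exact Finset.sum_congr rfl fun x _ => Nat.mod_add_div _ _
  omega

/-! ## Tuples of real divisors of different degrees as functions on the interval -/

/-- A tuple of divisors on the real line as a function on the interval. -/
noncomputable def realFn {m : ℕ} (z : ℂ) (hz : z.im ≠ 0) (e : Fin (m + 1) → Multiset ℝ) :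
    C(Seg, Euc m) :=
  ⟨fun t => WithLp.toLp 2 fun j =>
      form ((e j).map (↑)) (vec t) / rho z t ^ Multiset.card (e j), by
    refine (PiLp.continuous_toLp 2 _).comp (continuous_pi fun j => ?_)
    exact ((continuous_form _).comp continuous_vec).div ((continuous_rho z).pow _)
      fun t => pow_ne_zero _ (rho_pos hz t).ne'⟩

section

variable {n m : ℕ} {z : ℂ} {hz : z.im ≠ 0}

theorem realFn_apply (e : Fin (m + 1) → Multiset ℝ) (t : Seg) (j : Fin (m + 1)) :
    realFn z hz e t j = form ((e j).map (↑)) (vec t) / rho z t ^ Multiset.card (e j) := rfl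

theorem form_add_pairs {s : Multiset ℂ} (hs : IsRealDivisor s) (k : ℕ) (t : Seg) :
    IsRealDivisor (s + k • {z, starRingEnd ℂ z}) ∧
      form (s + k • {z, starRingEnd ℂ z}) (vec t) = form s (vec t) * rho z t ^ (2 * k) := by
  induction k with
  | zero => simp [hs]
  | succ k ih =>
    rw [succ_nsmul, ← add_assoc]
    refine ⟨ih.1.add (isRealDivisor_pair z), ?_⟩
    rw [form_add ih.1 (isRealDivisor_pair z), ih.2, form_pair]
    ring

/-- Adding copies of z and its conjugate raises the degrees to `n` without changing the function.
Hence the standard points lie in the affine space. -/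
theorem realFn_mem_formSpace {e : Fin (m + 1) → Multiset ℝ}
    (he : ∀ j, ∃ k, Multiset.card (e j) + 2 * k = n) : realFn z hz e ∈ formSpace n m hz := by
  choose k hk using he
  have t₀ : Seg := ⟨1, by norm_num, le_rfl⟩
  refine mem_formSpace.2 ⟨fun j => (e j).map (↑) + k j • {z, starRingEnd ℂ z},
    fun j => (form_add_pairs (isRealDivisor_map _) _ t₀).1, fun j => ?_, fun t j => ?_⟩
  · simp only [Multiset.card_add, Multiset.card_map, Multiset.card_nsmul, Multiset.card_pair]
    rw [← hk j, mul_comm]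
  · have h0 := (rho_pos hz t).ne'
    rw [(form_add_pairs (isRealDivisor_map _) _ t).2, realFn_apply, ← hk j, pow_add]
    field_simp

theorem continuous_realFn {κ : Fin (m + 1) → ℕ} :
    Continuous fun a : ∀ j, Fin (κ j) → ℝ => realFn z hz fun j => (symMk (a j) : Multiset ℝ) := by
  refine ContinuousMap.continuous_of_continuous_uncurry _ ?_
  refine (PiLp.continuous_toLp 2 _).comp (continuous_pi fun j => ?_)
  have h1 : Continuous fun p : (∀ j, Fin (κ j) → ℝ) × Seg => symMk fun l => (p.1 j l : ℂ) :=
    continuous_symMk.comp (by fun_prop)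
  have h2 : Continuous fun p : (∀ j, Fin (κ j) → ℝ) × Seg =>
      form ((symMk (p.1 j) : Multiset ℝ).map (↑)) (vec p.2) := by
    simp only [map_symMk]
    exact continuous_form_sym.comp (h1.prodMk (continuous_vec.comp continuous_snd))
  refine h2.div ?_ fun p => pow_ne_zero _ (rho_pos hz p.2).ne'
  simp only [Sym.card_coe]
  exact ((continuous_rho z).comp continuous_snd).pow _

end

end RationalLoops

namespace RationalLoops

open Topology Filter Set

/-! ## Limits of odd zeros -/

section

variable {n m : ℕ} {z : ℂ} {hz : z.im ≠ 0}

theorem normalize_phi_apply (d : D n m) (t : Seg) (j : Fin (m + 1)) :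
    normalize (phi z hz d) t j = ‖phi z hz d t‖⁻¹ * (form (d.1 j) (vec t) / rho z t ^ n) := by
  rw [normalize_apply (phi_mem d), PiLp.smul_apply, phi_apply, smul_eq_mul]

theorem normalize_phi_eq_zero_iff (d : D n m) (t : Seg) (j : Fin (m + 1)) :
    normalize (phi z hz d) t j = 0 ↔ form (d.1 j) (vec t) = 0 := by
  rw [normalize_phi_apply, mul_eq_zero, div_eq_zero_iff,
    or_iff_right (inv_ne_zero (norm_ne_zero_iff.2 (phi_mem d t))),
    or_iff_left (pow_ne_zero n (rho_pos hz t).ne')]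

theorem vec_one_ne_zero {s : Multiset ℂ} (hs : IsRealDivisor s) {t : Seg}
    (h : form s (vec t) = 0) : vec t 1 ≠ 0 := by
  intro h1
  rw [form_of_eq_zero hs h1] at h
  apply vec_ne_zero t
  ext i
  fin_cases i
  · exact eq_zero_of_pow_eq_zero h
  · exact h1

theorem vec_eq_smul {t : Seg} (h : vec t 1 ≠ 0) : vec t = vec t 1 • ![vec t 0 / vec t 1, 1] := by
  ext i
  fin_cases i
  · simp
    field_simp
  · simp

/-- If the normalized functions of divisors converge along an ultrafilter, then the real zeros of
odd multiplicity converge to real zeros of the limit, and modulo 2 no multiplicity is lost. -/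
theorem exists_limit_oddSet {ι : Type} (F : Ultrafilter ι) (d : ι → D n m) (d₀ : D n m)
    (h : Tendsto (fun i => normalize (phi z hz (d i))) F (𝓝 (normalize (phi z hz d₀)))) :
    ∃ (κ : Fin (m + 1) → ℕ) (a : ι → ∀ j, Fin (κ j) → ℝ) (a₀ : ∀ j, Fin (κ j) → ℝ),
      (∀ᶠ i in F, ∀ j, (symMk (a i j) : Multiset ℝ) = (oddSet ((d i).1 j)).val) ∧
      Tendsto a F (𝓝 a₀) ∧ (∀ x : ℝ, ∃ j, x ∉ (symMk (a₀ j) : Multiset ℝ)) ∧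
      ∀ j (x : ℝ), (symMk (a₀ j) : Multiset ℝ).count x ≡
        (d₀.1 j : Multiset ℂ).count (x : ℂ) [MOD 2] := by
  -- The number of odd zeros is at most `n`, so it is constant along the ultrafilter.
  have hcard : ∀ j, ∃ k, ∀ᶠ i in F, (oddSet ((d i).1 j)).card = k := by
    intro j
    have h1 : ∀ᶠ i in F, ∃ k ∈ Iic n, (oddSet ((d i).1 j)).card = k := by
      refine Eventually.of_forall fun i => ⟨_, ?_, rfl⟩
      obtain ⟨k, hk⟩ := card_oddSet ((d i).2.1 j)
      rw [Sym.card_coe] at hk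
      exact mem_Iic.2 (by omega)
    obtain ⟨k, -, hk⟩ := (Ultrafilter.eventually_exists_mem_iff (finite_Iic n)).1 h1
    exact ⟨k, hk⟩
  choose κ hκ using hcard
  -- The odd zeros are lifted to the compact interval, where limits exist. The point 1 is an
  -- irrelevant default when the number of zeros is not `κ j`.
  have hex : ∀ i j, ∃ τ : Fin (κ j) → Seg, (oddSet ((d i).1 j)).card = κ j →
      (symMk (fun l => vec (τ l) 0 / vec (τ l) 1) : Multiset ℝ) = (oddSet ((d i).1 j)).val ∧
      ∀ l, form ((d i).1 j) (vec (τ l)) = 0 := by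
    intro i j
    by_cases hc : (oddSet ((d i).1 j)).card = κ j
    · obtain ⟨x, hx⟩ := isQuotientMap_symMk.surjective (⟨(oddSet ((d i).1 j)).val, hc⟩ : Sym ℝ (κ j))
      have hx' : (symMk x : Multiset ℝ) = (oddSet ((d i).1 j)).val := congrArg Subtype.val hx
      choose τ hτ0 hτ using fun l => exists_vec_eq (x l)
      have hdiv : ∀ l, vec (τ l) 0 / vec (τ l) 1 = x l := by
        intro l
        have h0 := congrFun (hτ l) 0
        rw [Pi.smul_apply, smul_eq_mul, Matrix.cons_val_zero] at h0
        rw [h0, mul_div_cancel_left₀ _ (hτ0 l).ne']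
      refine ⟨τ, fun _ => ⟨?_, fun l => ?_⟩⟩
      · simp only [hdiv]
        exact hx'
      · refine (form_eq_zero_iff ((d i).2.1 j) _).2 ⟨x l, mem_of_mem_oddSet ?_, ?_⟩
        · rw [← Finset.mem_val, ← hx']
          exact mem_symMk.2 ⟨l, rfl⟩
        · rw [← hdiv l]
          have := (hτ0 l).ne'
          push_cast
          rw [div_mul_cancel₀]
          exact_mod_cast this
    · exact ⟨fun _ => ⟨1, by norm_num, le_rfl⟩, fun h => absurd h hc⟩
  choose τ hτ using hex
  obtain ⟨τ₀, -, hτ₀⟩ := (isCompact_univ (X := ∀ j, Fin (κ j) → Seg)).ultrafilter_le_nhds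
    (F.map τ) (by simp)
  have hτt : Tendsto τ F (𝓝 τ₀) := hτ₀
  have hκ' : ∀ᶠ i in F, ∀ j, (oddSet ((d i).1 j)).card = κ j := eventually_all.2 hκ
  have hlim : ∀ j l, form (d₀.1 j) (vec (τ₀ j l)) = 0 := by
    intro j l
    rw [← normalize_phi_eq_zero_iff (z := z) (hz := hz)]
    have h1 : Tendsto (fun i => τ i j l) F (𝓝 (τ₀ j l)) :=
      tendsto_pi_nhds.1 (tendsto_pi_nhds.1 hτt j) l
    have h2 : Tendsto (fun i => normalize (phi z hz (d i)) (τ i j l)) F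
        (𝓝 (normalize (phi z hz d₀) (τ₀ j l))) :=
      (continuous_eval.tendsto _).comp (h.prodMk_nhds h1)
    have h3 : Continuous fun w : Euc m => w j := by fun_prop
    refine tendsto_nhds_unique ((h3.tendsto _).comp h2) (tendsto_const_nhds.congr' ?_)
    filter_upwards [hκ'] with i hi
    exact ((normalize_phi_eq_zero_iff _ _ _).2 ((hτ i j (hi j)).2 l)).symm
  -- No particle escapes to infinity: a monic form does not vanish there.
  have hne : ∀ j l, vec (τ₀ j l) 1 ≠ 0 := fun j l => vec_one_ne_zero (d₀.2.1 j) (hlim j l)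
  have hat : Tendsto (fun i j l => vec (τ i j l) 0 / vec (τ i j l) 1) F
      (𝓝 fun j l => vec (τ₀ j l) 0 / vec (τ₀ j l) 1) := by
    refine tendsto_pi_nhds.2 fun j => tendsto_pi_nhds.2 fun l => ?_
    have h1 : Tendsto (fun i => vec (τ i j l)) F (𝓝 (vec (τ₀ j l))) :=
      (continuous_vec.tendsto _).comp (tendsto_pi_nhds.1 (tendsto_pi_nhds.1 hτt j) l)
    exact (tendsto_pi_nhds.1 h1 0).div (tendsto_pi_nhds.1 h1 1) (hne j l)
  have heq : ∀ᶠ i in F, ∀ j, (symMk fun l => vec (τ i j l) 0 / vec (τ i j l) 1 : Multiset ℝ) =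
      (oddSet ((d i).1 j)).val := by
    filter_upwards [hκ'] with i hi j
    exact (hτ i j (hi j)).1
  refine ⟨κ, _, _, heq, hat, fun x => ?_, fun j x => ?_⟩
  -- A point common to all limit divisors would be a common real zero of the forms of `d₀`.
  · by_contra! hx
    refine form_ne_zero d₀ (v := ![x, 1]) (fun h => by simpa using congrFun h 1) (funext fun j => ?_)
    obtain ⟨l, hl⟩ := mem_symMk.1 (hx j)
    have h1 := hlim j l
    rw [vec_eq_smul (hne j l), form_smul (d₀.2.1 j), hl] at h1
    exact (mul_eq_zero.1 h1).resolve_left (pow_ne_zero _ (hne j l))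
  · rw [← count_map_ofReal]
    refine count_modEq_of_nonneg (isRealDivisor_map _) (d₀.2.1 j) (fun y => ?_) x
    obtain ⟨t, ht, hy⟩ := exists_vec_eq y
    -- The form of the odd zeros never has the sign opposite to the original form. This closed
    -- condition passes to the limit, where it says that the multiplicities agree modulo 2.
    have h1 : ∀ᶠ i in F, 0 ≤ realFn z hz (fun j => (symMk fun l =>
        vec (τ i j l) 0 / vec (τ i j l) 1 : Multiset ℝ)) t j * normalize (phi z hz (d i)) t j := by
      filter_upwards [heq] with i hi
      rw [realFn_apply, normalize_phi_apply, hi j]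
      have h2 := form_mul_form_nonneg (isRealDivisor_map (oddSet ((d i).1 j)).val) ((d i).2.1 j)
        (fun x => by
          rw [count_map_ofReal]
          exact count_oddSet_modEq _ x) (vec t)
      have h3 := rho_pos hz t
      calc (0 : ℝ) ≤ ‖phi z hz (d i) t‖⁻¹ * ((form ((oddSet ((d i).1 j)).val.map (↑)) (vec t) *
            form ((d i).1 j) (vec t)) / (rho z t ^ Multiset.card (oddSet ((d i).1 j)).val *
              rho z t ^ n)) := by positivity
        _ = _ := by
          rw [mul_div_mul_comm]
          ring
    have h2 : Continuous fun f : C(Seg, Euc m) => f t j := by fun_prop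
    have h3 := ((h2.tendsto _).comp ((continuous_realFn (z := z) (hz := hz)).tendsto _ |>.comp hat)).mul
      ((h2.tendsto _).comp h)
    have h4 := ge_of_tendsto h3 h1
    rw [realFn_apply, normalize_phi_apply, hy, form_smul (isRealDivisor_map _),
      form_smul (d₀.2.1 j)] at h4
    have h5 := rho_pos hz t
    have h6 := norm_pos_iff.2 (phi_mem (hz := hz) d₀ t)
    by_contra! hneg
    refine absurd h4 (not_le.2 ?_)
    have e : ∀ a b c d e A B : ℝ, a * A / b * (c * (d * B / e)) = a / b * (c * (d / e)) * (A * B) :=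
      fun a b c d e A B => by ring
    rw [e]
    exact mul_neg_of_pos_of_neg (by positivity) hneg

end

end RationalLoops

namespace RationalLoops

open Topology Filter Set

/-! ## The mod 2 particles of a rational loop -/

theorem symMk_append_const {κ n r : ℕ} (h : κ + r = n) (a : Fin κ → ℝ) (y : ℝ) :
    (symMk (fun l : Fin n => if hl : (l : ℕ) < κ then a ⟨l, hl⟩ else y) : Multiset ℝ) =
      (symMk a : Multiset ℝ) + Multiset.replicate r y := by
  subst h
  change Multiset.ofList (List.ofFn _) = Multiset.ofList (List.ofFn a) + _
  rw [← Multiset.coe_replicate, Multiset.coe_add, ← List.ofFn_const, ← List.ofFn_fin_append]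
  congr 2
  funext l
  refine Fin.addCases (fun i => ?_) (fun i => ?_) l <;> simp

section

variable {n m : ℕ}

/-- The inclusion of tuples of real divisors in tuples of divisors. -/
def ofS (s : S n m) : D n m :=
  ⟨fun j => (s.1 j).map ((↑) : ℝ → ℂ), fun j => isRealDivisor_map (s.1 j : Multiset ℝ), fun x => by
    obtain ⟨j, hj⟩ := s.2 x
    refine ⟨j, fun h => hj ?_⟩
    obtain ⟨y, hy, e⟩ := Multiset.mem_map.1 h
    rwa [← Complex.ofReal_injective e]⟩

theorem count_ofS (s : S n m) (j : Fin (m + 1)) (x : ℝ) :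
    ((ofS s).1 j : Multiset ℂ).count (x : ℂ) = (s.1 j : Multiset ℝ).count x :=
  count_map_ofReal _ _

theorem continuous_ofS : Continuous (ofS : S n m → D n m) := by
  refine Continuous.subtype_mk (continuous_pi fun j => ?_) _
  have h : Continuous fun s : Sym ℝ n => s.map ((↑) : ℝ → ℂ) := by
    refine isQuotientMap_symMk.continuous_iff.2 ?_
    have : (fun s : Sym ℝ n => s.map ((↑) : ℝ → ℂ)) ∘ symMk =
        fun x : Fin n → ℝ => symMk fun i => (x i : ℂ) := by
      funext x
      exact Subtype.ext (map_symMk x _)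
    rw [this]
    exact continuous_symMk.comp (by fun_prop)
  exact h.comp ((continuous_apply j).comp continuous_subtype_val)

variable (hm : 1 ≤ m)

theorem R_eq_mk {d : D n m} {s : S n m}
    (h : ∀ j (x : ℝ), (s.1 j : Multiset ℝ).count x ≡ (d.1 j : Multiset ℂ).count (x : ℂ) [MOD 2]) :
    R hm n d = Quotient.mk (parity n m) s :=
  R_eq hm d s fun j x => by
    rw [count_realPart]
    exact h j x

theorem R_eq_R_iff {n : ℕ} {d d' : D n m} :
    R hm n d = R hm n d' ↔ ∀ j, oddSet (d.1 j) = oddSet (d'.1 j) := by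
  have h0 : ∀ (d : D n m) j (x : ℝ), ((exists_S_of_D hm d).choose.1 j : Multiset ℝ).count x ≡
      (d.1 j : Multiset ℂ).count (x : ℂ) [MOD 2] := fun d j x => by
    rw [← count_realPart]
    exact (exists_S_of_D hm d).choose_spec j x
  simp only [oddSet_eq_iff]
  refine ⟨fun h j x => ?_, fun h => R_eq_mk hm fun j x => (h0 d' j x).trans (h j x).symm⟩
  have h3 := Quotient.exact (s := parity n m) h
  exact (h0 d j x).symm.trans ((h3 j x).trans (h0 d' j x))

theorem continuous_mk : Continuous (Quotient.mk (parity n m) : S n m → T n m) :=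
  continuous_quotient_mk'

/-- Limits of the mod 2 particles along an ultrafilter for which the normalized functions
converge. -/
theorem tendsto_R {ι : Type} (F : Ultrafilter ι) (d : ι → D n m) (d₀ : D n m) {z : ℂ}
    {hz : z.im ≠ 0}
    (h : Tendsto (fun i => normalize (phi z hz (d i))) F (𝓝 (normalize (phi z hz d₀)))) :
    Tendsto (fun i => R hm n (d i)) F (𝓝 (R hm n d₀)) := by
  classical
  obtain ⟨κ, a, a₀, heq, hat, hne, hpar⟩ := exists_limit_oddSet F d d₀ h
  have hκ : ∀ j, ∃ k, κ j + 2 * k = n := by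
    intro j
    obtain ⟨i, hi⟩ := heq.exists
    obtain ⟨k, hk⟩ := card_oddSet ((d i).2.1 j)
    refine ⟨k, ?_⟩
    have h1 := congrArg Multiset.card (hi j)
    rw [Sym.card_coe] at h1 hk
    rw [h1]
    exact hk
  choose k hk using hκ
  obtain ⟨M, hM⟩ : ∃ M : ℝ, ∀ j l, a₀ j l < M := by
    obtain ⟨M, hM⟩ := (finite_range fun p : Σ j, Fin (κ j) => a₀ p.1 p.2).bddAbove
    exact ⟨M + 1, fun j l => (hM (mem_range_self (⟨j, l⟩ : Σ j, Fin (κ j)))).trans_lt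
      (lt_add_one M)⟩
  have hMi : ∀ᶠ i in F, ∀ j l, a i j l < M := by
    refine eventually_all.2 fun j => eventually_all.2 fun l => ?_
    exact (tendsto_pi_nhds.1 (tendsto_pi_nhds.1 hat j) l).eventually (gt_mem_nhds (hM j l))
  -- The divisors are filled up to degree `n` by an even number of copies of `M + j`, beyond all
  -- particles. These points differ for different `j`, so they create no common point.
  let b : (∀ j, Fin (κ j) → ℝ) → Fin (m + 1) → Sym ℝ n := fun a j =>
    symMk fun l : Fin n => if hl : (l : ℕ) < κ j then a j ⟨l, hl⟩ else M + (j : ℕ)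
  have hb : Continuous b := by
    refine continuous_pi fun j => continuous_symMk.comp (continuous_pi fun l => ?_)
    by_cases hl : (l : ℕ) < κ j
    · simp only [hl, dite_true]
      fun_prop
    · simp only [hl, dite_false]
      fun_prop
  have hbe : ∀ a j, (b a j : Multiset ℝ) =
      (symMk (a j) : Multiset ℝ) + Multiset.replicate (2 * k j) (M + (j : ℕ)) := fun a j =>
    symMk_append_const (hk j) _ _
  have hbS : ∀ a, (∀ j l, a j l < M) → (∀ x : ℝ, ∃ j, x ∉ (symMk (a j) : Multiset ℝ)) →
      ∀ x : ℝ, ∃ j, x ∉ (b a j : Multiset ℝ) := by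
    intro a haM ha x
    by_contra! hx
    simp only [hbe, Multiset.mem_add, Multiset.mem_replicate, mem_symMk] at hx
    by_cases hxM : x < M
    · obtain ⟨j, hj⟩ := ha x
      rcases hx j with h | h
      · exact hj (mem_symMk.2 h)
      · have : (0 : ℝ) ≤ (j : ℕ) := Nat.cast_nonneg _
        linarith [h.2]
    · have hx' : ∀ j : Fin (m + 1), x = M + (j : ℕ) := by
        intro j
        rcases hx j with ⟨l, hl⟩ | h
        · exact absurd (hl ▸ haM j l) hxM
        · exact h.2
      have h0 := (hx' 0).symm.trans (hx' (Fin.last m))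
      simp at h0
      omega
  have hcount : ∀ a j x, (b a j : Multiset ℝ).count x ≡ (symMk (a j) : Multiset ℝ).count x
      [MOD 2] := by
    intro a j x
    rw [hbe, Multiset.count_add, Multiset.count_replicate]
    split_ifs
    · simp [Nat.ModEq, Nat.add_mod]
    · simp [Nat.ModEq]
  let s₀ : S n m := ⟨b a₀, hbS a₀ hM hne⟩
  -- The default `s₀` is never used along the ultrafilter.
  let s : ι → S n m := fun i => if hi : ∀ x : ℝ, ∃ j, x ∉ (b (a i) j : Multiset ℝ) then ⟨_, hi⟩ else s₀
  have hs : ∀ᶠ i in F, (s i).1 = b (a i) ∧ ∀ j, (symMk (a i j) : Multiset ℝ) =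
      (oddSet ((d i).1 j)).val := by
    filter_upwards [heq, hMi] with i hi hMi
    refine ⟨?_, hi⟩
    have : ∀ x : ℝ, ∃ j, x ∉ (b (a i) j : Multiset ℝ) := by
      refine hbS _ hMi fun x => ?_
      obtain ⟨j, hj⟩ := (d i).2.2 x
      refine ⟨j, fun hx => hj (mem_of_mem_oddSet ?_)⟩
      rwa [hi j] at hx
    have e : s i = ⟨_, this⟩ := dif_pos this
    rw [e]
  have hst : Tendsto s F (𝓝 s₀) := by
    refine tendsto_subtype_rng.2 (((hb.tendsto a₀).comp hat).congr' ?_)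
    filter_upwards [hs] with i hi
    exact hi.1.symm
  have h0 : R hm n d₀ = Quotient.mk (parity n m) s₀ :=
    R_eq_mk hm fun j x => (hcount a₀ j x).trans (hpar j x)
  rw [h0]
  refine ((continuous_mk.tendsto s₀).comp hst).congr' ?_
  filter_upwards [hs] with i hi
  refine (R_eq_mk hm fun j x => ?_).symm
  rw [hi.1]
  refine (hcount _ j x).trans ?_
  rw [hi.2 j]
  exact count_oddSet_modEq _ x

/-- Arbitrary representatives in `D n m` of convergent loops need not converge. Their normalized
functions do, which is all that `tendsto_R` requires. -/
theorem continuous_Q : Continuous (Q hm n) := by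
  refine continuous_iff_ultrafilter.2 fun γ₀ F hF => ?_
  obtain ⟨d₀, rfl⟩ := P_surjective hm n γ₀
  choose d hd using P_surjective hm n
  have h1 : ∀ γ, Q hm n γ = R hm n (d γ) := fun γ => by
    conv_lhs => rw [← hd γ, Q_P]
  have h2 : ∀ γ, (homeoRat n hm I_im_ne γ : C(Seg, Euc m)) =
      normalize (phi Complex.I I_im_ne (d γ)) := fun γ => by
    conv_lhs => rw [← hd γ, homeoRat_P]
  rw [Q_P]
  refine (tendsto_R hm F d d₀ (z := Complex.I) (hz := I_im_ne) ?_).congr fun γ => (h1 γ).symm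
  have h3 : Continuous fun γ : Rat n m => (homeoRat n hm I_im_ne γ : C(Seg, Euc m)) :=
    continuous_subtype_val.comp (homeoRat n hm I_im_ne).continuous
  have h4 := (h3.tendsto (P hm n d₀)).mono_left hF
  simp only [h2] at h4
  rwa [← h2, homeoRat_P] at h4

theorem continuous_R : Continuous (R hm n) := by
  have : R hm n = Q hm n ∘ P hm n := funext fun d => (Q_P hm n d).symm
  rw [this]
  exact (continuous_Q hm).comp (continuous_P hm)

/-- Restricted to tuples of real divisors, the continuous map `R` is already the projection that
defines the quotient topology. -/
theorem isQuotientMap_R : IsQuotientMap (R hm n) := by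
  refine IsQuotientMap.of_comp continuous_ofS (continuous_R hm) ?_
  have : R hm n ∘ ofS = (Quotient.mk (parity n m) : S n m → T n m) := by
    funext s
    refine R_eq_mk hm fun j x => ?_
    rw [count_ofS]
  rw [this]
  exact isQuotientMap_quotient_mk'

end

end RationalLoops

namespace RationalLoops

open Topology Filter Set

/-! ## The fibres of the map to mod 2 particles -/

section

variable {m : ℕ} {z : ℂ} {hz : z.im ≠ 0}

open Classical in
/-- The real zeros of odd multiplicity of a tuple of forms. -/
noncomputable def oddType (hz : z.im ≠ 0) (f : C(Seg, Euc m)) : Fin (m + 1) → Finset ℝ :=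
  if h : ∃ n, ∃ d : D n m, phi z hz d = f then fun j => oddSet (h.choose_spec.choose.1 j)
  else fun _ => ∅

theorem form_sign {n : ℕ} (d : D n m) {x : ℝ} {t : Seg} (ht : 0 < vec t 1)
    (hx : vec t = vec t 1 • ![x, 1]) (j : Fin (m + 1)) :
    ∃ c : ℝ, 0 < c ∧ form (d.1 j) ![x, 1] = c * phi z hz d t j :=
  ⟨_, div_pos (pow_pos (rho_pos hz t) n) (pow_pos ht n), form_eq_phi d ht hx j⟩

/-- If the components of two tuples of forms never have opposite signs, then their zeros of odd
multiplicity are the same. -/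
theorem oddSet_eq_of_phi {n k : ℕ} {d : D n m} {e : D k m}
    (h : ∀ t j, 0 ≤ phi z hz d t j * phi z hz e t j) (j : Fin (m + 1)) :
    oddSet (d.1 j) = oddSet (e.1 j) := by
  refine oddSet_eq_iff.2 (count_modEq_of_nonneg (d.2.1 j) (e.2.1 j) fun x => ?_)
  obtain ⟨t, ht, hx⟩ := exists_vec_eq x
  obtain ⟨a, ha, hd⟩ := form_sign (hz := hz) d ht hx j
  obtain ⟨b, hb, he⟩ := form_sign (hz := hz) e ht hx j
  rw [hd, he, mul_mul_mul_comm]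
  exact mul_nonneg (mul_pos ha hb).le (h t j)

/-- A function may come from divisors of several degrees, but its signs determine the odd zeros, so
the choice in `oddType` does not matter. -/
theorem oddType_phi {n : ℕ} (d : D n m) : oddType hz (phi z hz d) = fun j => oddSet (d.1 j) := by
  have h : ∃ n, ∃ e : D n m, phi z hz e = phi z hz d := ⟨n, d, rfl⟩
  rw [oddType, dif_pos h]
  funext j
  refine oddSet_eq_of_phi (z := z) (hz := hz) (fun t j => ?_) j
  rw [h.choose_spec.choose_spec]
  exact mul_self_nonneg _

theorem realFn_mul_phi_nonneg {n : ℕ} (d : D n m) {e : Fin (m + 1) → Multiset ℝ}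
    (h : ∀ j x, (e j).count x ≡ (d.1 j : Multiset ℂ).count (x : ℂ) [MOD 2]) (t : Seg)
    (j : Fin (m + 1)) : 0 ≤ phi z hz d t j * realFn z hz e t j := by
  have h1 := form_mul_form_nonneg (d.2.1 j) (isRealDivisor_map (e j)) (fun x => by
    rw [count_map_ofReal]
    exact (h j x).symm) (vec t)
  have h2 := rho_pos hz t
  rw [phi_apply, realFn_apply, ← mul_div_mul_comm]
  positivity

theorem realFn_ne_zero {e : Fin (m + 1) → Multiset ℝ} (h : ∀ x : ℝ, ∃ j, x ∉ e j) :
    realFn z hz e ∈ nowhereZero Seg (Euc m) := by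
  intro t h0
  have h1 : ∀ j, form ((e j).map (↑)) (vec t) = 0 := by
    intro j
    have := congrArg (fun w : Euc m => w j) h0
    simp only [realFn_apply, PiLp.zero_apply, div_eq_zero_iff] at this
    exact this.resolve_right (pow_ne_zero _ (rho_pos hz t).ne')
  have hv : vec t 1 ≠ 0 := vec_one_ne_zero (isRealDivisor_map (e 0)) (h1 0)
  obtain ⟨j, hj⟩ := h (vec t 0 / vec t 1)
  obtain ⟨w, hw, e'⟩ := (form_eq_zero_iff (isRealDivisor_map _) _).1 (h1 j)
  obtain ⟨x, hx, rfl⟩ := Multiset.mem_map.1 hw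
  apply hj
  have : vec t 0 = x * vec t 1 := by exact_mod_cast e'
  rwa [this, mul_div_cancel_right₀ _ hv]

/-- The fibres of the map to mod 2 particles are convex in the space of forms. -/
theorem segment_mem {n : ℕ} (d : D n m) {w : C(Seg, Euc m)} (hw : w ∈ formSpace n m hz)
    (hw' : w ∈ nowhereZero Seg (Euc m)) (h : ∀ t j, 0 ≤ phi z hz d t j * w t j) {u : ℝ}
    (hu : u ∈ Icc (0 : ℝ) 1) :
    phi z hz d + u • (w - phi z hz d) ∈ nowhereZero Seg (Euc m) ∧
      oddType hz (phi z hz d + u • (w - phi z hz d)) = oddType hz (phi z hz d) := by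
  have happ : ∀ t j, (phi z hz d + u • (w - phi z hz d)) t j =
      (1 - u) * phi z hz d t j + u * w t j := by
    intro t j
    simp only [ContinuousMap.add_apply, ContinuousMap.smul_apply, ContinuousMap.sub_apply,
      PiLp.add_apply, PiLp.smul_apply, PiLp.sub_apply, smul_eq_mul]
    ring
  have h1 : phi z hz d + u • (w - phi z hz d) ∈ nowhereZero Seg (Euc m) := by
    intro t h0
    have h2 : ∀ j, (1 - u) * phi z hz d t j + u * w t j = 0 := fun j => by
      rw [← happ, h0]
      rfl
    rcases hu.2.eq_or_lt with rfl | hu1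
    · refine hw' t (PiLp.ext fun j => ?_)
      have := h2 j
      simpa using this
    · refine phi_mem (hz := hz) d t (PiLp.ext fun j => ?_)
      -- Multiplying the vanishing component by that of `phi` gives two nonnegative summands with
      -- sum zero.
      have h3 : (1 - u) * phi z hz d t j ^ 2 + u * (phi z hz d t j * w t j) = 0 := by
        linear_combination phi z hz d t j * h2 j
      have h4 := mul_nonneg hu.1 (h t j)
      have h5 : 0 ≤ (1 - u) * phi z hz d t j ^ 2 := mul_nonneg (sub_pos.2 hu1).le (sq_nonneg _)
      have h6 : (1 - u) * phi z hz d t j ^ 2 = 0 := by linarith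
      rcases mul_eq_zero.1 h6 with h7 | h7
      · exact absurd h7 (sub_pos.2 hu1).ne'
      · exact eq_zero_of_pow_eq_zero h7
  refine ⟨h1, ?_⟩
  obtain ⟨e, he⟩ := exists_phi_eq
    (AffineSubspace.add_smul_sub_mem _ (phi_mem_formSpace d) hw u) h1
  rw [← he, oddType_phi, oddType_phi]
  funext j
  refine oddSet_eq_of_phi (z := z) (hz := hz) (fun t j => ?_) j
  rw [he, happ]
  have h2 := mul_nonneg hu.1 (h t j)
  have h3 := mul_nonneg (sub_nonneg.2 hu.2) (mul_self_nonneg (phi z hz d t j))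
  nlinarith

/-- The limit property of a sequence of strata. -/
theorem exists_limit_oddType {n : ℕ} (F : Ultrafilter C(Seg, Euc m)) {f₀ : C(Seg, Euc m)}
    (hA : f₀ ∈ formSpace n m hz) (hU : f₀ ∈ nowhereZero Seg (Euc m)) (hF : ↑F ≤ 𝓝 f₀)
    (hm : ∀ᶠ f in F, f ∈ formSpace n m hz ∧ f ∈ nowhereZero Seg (Euc m)) :
    ∃ w ∈ formSpace n m hz,
      Tendsto (fun f => realFn z hz fun j => (oddType hz f j).val) F (𝓝 w) ∧
      (∀ u ∈ Icc (0 : ℝ) 1, f₀ + u • (w - f₀) ∈ nowhereZero Seg (Euc m) ∧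
        oddType hz (f₀ + u • (w - f₀)) = oddType hz f₀) ∧
      (∀ᶠ f in (F : Filter C(Seg, Euc m)), ∑ j, (oddType hz f₀ j).card ≤ ∑ j, (oddType hz f j).card) ∧
      ((∀ᶠ f in (F : Filter C(Seg, Euc m)), ∑ j, (oddType hz f j).card = ∑ j, (oddType hz f₀ j).card) →
        w = realFn z hz fun j => (oddType hz f₀ j).val) := by
  classical
  obtain ⟨d₀, rfl⟩ := exists_phi_eq hA hU
  have hex : ∀ f, ∃ d : D n m, (f ∈ formSpace n m hz ∧ f ∈ nowhereZero Seg (Euc m)) →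
      phi z hz d = f := by
    intro f
    by_cases hf : f ∈ formSpace n m hz ∧ f ∈ nowhereZero Seg (Euc m)
    · obtain ⟨d, hd⟩ := exists_phi_eq hf.1 hf.2
      exact ⟨d, fun _ => hd⟩
    · exact ⟨d₀, fun h => absurd h hf⟩
  choose d hd using hex
  have hphi : ∀ᶠ f in F, phi z hz (d f) = f := hm.mono fun f hf => hd f hf
  have hlim : Tendsto (fun f => normalize (phi z hz (d f))) F (𝓝 (normalize (phi z hz d₀))) := by
    have h1 : ContinuousAt normalize (phi z hz d₀) :=
      continuousOn_normalize.continuousAt (isOpen_nowhereZero.mem_nhds hU)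
    refine (h1.mono_left hF).congr' ?_
    filter_upwards [hphi] with f hf
    rw [hf]
  obtain ⟨κ, a, a₀, heq, hat, hne, hpar⟩ := exists_limit_oddSet F d d₀ hlim
  have htype : ∀ᶠ f in F, ∀ j, (symMk (a f j) : Multiset ℝ) = (oddType hz f j).val := by
    filter_upwards [heq, hphi] with f hf hf' j
    rw [hf j]
    conv_rhs => rw [← hf', oddType_phi]
  have hcard : ∀ᶠ f in F, ∀ j, (oddType hz f j).card = κ j := by
    filter_upwards [htype] with f hf j
    rw [Finset.card, ← hf j, Sym.card_coe]
  have hκ : ∀ j, ∃ k, κ j + 2 * k = n := by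
    intro j
    obtain ⟨f, hf, hf'⟩ := (hcard.and hphi).exists
    obtain ⟨k, hk⟩ := card_oddSet ((d f).2.1 j)
    refine ⟨k, ?_⟩
    rw [← hf j]
    conv_lhs => rw [← hf', oddType_phi]
    rw [hk, Sym.card_coe]
  set w : C(Seg, Euc m) := realFn z hz fun j => (symMk (a₀ j) : Multiset ℝ) with hw
  have hwA : w ∈ formSpace n m hz := realFn_mem_formSpace fun j => by
    simpa only [Sym.card_coe] using hκ j
  -- A zero of odd multiplicity of the limit has odd, hence positive, multiplicity among the limits
  -- of the odd zeros.
  have hle : ∀ j, oddType hz (phi z hz d₀) j ⊆ (symMk (a₀ j) : Multiset ℝ).toFinset := by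
    intro j x hx
    rw [oddType_phi, mem_oddSet] at hx
    rw [Multiset.mem_toFinset, ← Multiset.count_pos]
    have h1 := hpar j x
    rw [Nat.odd_iff] at hx
    rw [Nat.ModEq, hx] at h1
    omega
  have hlec : ∀ j, (oddType hz (phi z hz d₀) j).card ≤ κ j := fun j =>
    (Finset.card_le_card (hle j)).trans ((Multiset.toFinset_card_le _).trans (Sym.card_coe).le)
  refine ⟨w, hwA, ?_, fun u hu => ?_, ?_, fun hsize => ?_⟩
  · refine ((continuous_realFn.tendsto a₀).comp hat).congr' ?_
    filter_upwards [htype] with f hf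
    simp only [Function.comp_apply, hf]
  · exact segment_mem d₀ hwA (realFn_ne_zero hne)
      (fun t j => realFn_mul_phi_nonneg d₀ hpar t j) hu
  · filter_upwards [hcard] with f hf
    simp only [hf]
    exact Finset.sum_le_sum fun j _ => hlec j
  · obtain ⟨f, hf, hf'⟩ := (hcard.and hsize).exists
    simp only [hf] at hf'
    -- Equal total sizes force equality in each component. Then no particles have collided, and the
    -- limits of the odd zeros are exactly the odd zeros of the limit.
    have hall := (Finset.sum_eq_sum_iff_of_le fun j _ => hlec j).1 hf'.symm
    rw [hw]
    congr 1
    funext j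
    have h1 : (oddType hz (phi z hz d₀) j).val ≤ (symMk (a₀ j) : Multiset ℝ) :=
      (Multiset.le_iff_subset (Finset.nodup _)).2 fun x hx => Multiset.mem_toFinset.1 (hle j hx)
    refine (Multiset.eq_of_le_of_card_le h1 ?_).symm
    rw [Sym.card_coe, ← hall j (Finset.mem_univ j)]
    exact le_rfl

theorem exists_size_le (n : ℕ) : ∃ N, ∀ f ∈ formSpace n m hz, f ∈ nowhereZero Seg (Euc m) →
    ∑ j, (oddType hz f j).card ≤ N := by
  refine ⟨∑ _ : Fin (m + 1), n, fun f hf hf' => Finset.sum_le_sum fun j _ => ?_⟩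
  obtain ⟨d, rfl⟩ := exists_phi_eq hf hf'
  obtain ⟨k, hk⟩ := card_oddSet (d.2.1 j)
  rw [Sym.card_coe] at hk
  rw [oddType_phi]
  change (oddSet (d.1 j)).card ≤ n
  omega

end

theorem formSpace_mono {N : ℕ → ℕ} (hN : ∀ i, N (i + 1) = N i + 2) (m : ℕ) {z : ℂ}
    (hz : z.im ≠ 0) : Monotone fun i => formSpace (N i) m hz := by
  refine monotone_nat_of_le_succ fun i => ?_
  rw [hN]
  exact formSpace_le

/-- The spaces of forms whose degrees have a given parity, with the fibres of the map to mod 2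
particles. -/
noncomputable def fibredModel {N : ℕ → ℕ} (hN : ∀ i, N (i + 1) = N i + 2) (m : ℕ) {z : ℂ}
    (hz : z.im ≠ 0) : FibredModel C(Seg, Euc m) where
  A i := formSpace (N i) m hz
  mono := formSpace_mono hN m hz
  nonempty _ := formSpace_nonempty
  finiteDimensional _ := finiteDimensional_formSpace
  U := nowhereZero Seg (Euc m)
  isOpen_U := isOpen_nowhereZero
  nonempty_compl := ⟨0, fun h => h ⟨1, by norm_num, le_rfl⟩ rfl⟩
  C := Fin (m + 1) → Finset ℝ
  type := oddType hz
  size c := ∑ j, (c j).card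
  std c := realFn z hz fun j => (c j).val
  exists_bound _ := exists_size_le _
  exists_limit _ F _ hA hU hF hm := exists_limit_oddType F hA hU hF hm

/-- The spaces of forms whose degrees have a given parity. -/
noncomputable def affineModel {N : ℕ → ℕ} (hN : ∀ i, N (i + 1) = N i + 2) (m : ℕ) {z : ℂ}
    (hz : z.im ≠ 0) : AffineModel Seg (Euc m) where
  A i := formSpace (N i) m hz
  mono := formSpace_mono hN m hz
  nonempty _ := formSpace_nonempty
  finiteDimensional _ := finiteDimensional_formSpace

end RationalLoops

namespace RationalLoops

open Topology Filter Set unitInterval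

/-! ## The homotopy equivalences -/

/-- Homotopy inverses are transported along homeomorphisms of sequences. -/
def SeqHomotopyInverse.congr {X Y X' Y' : ℕ → Type} [∀ k, TopologicalSpace (X k)]
    [∀ k, TopologicalSpace (Y k)] [∀ k, TopologicalSpace (X' k)] [∀ k, TopologicalSpace (Y' k)]
    {ι : ∀ k, X k → X (k + 1)} {κ : ∀ k, Y k → Y (k + 1)} {f : ∀ k, X k → Y k}
    {ι' : ∀ k, X' k → X' (k + 1)} {κ' : ∀ k, Y' k → Y' (k + 1)} {f' : ∀ k, X' k → Y' k}
    (e : SeqHomotopyInverse ι κ f) (a : ∀ k, X' k ≃ₜ X k) (b : ∀ k, Y' k ≃ₜ Y k)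
    (ha : ∀ k x, a (k + 1) (ι' k x) = ι k (a k x)) (hb : ∀ k y, b (k + 1) (κ' k y) = κ k (b k y))
    (hf : ∀ k x, b k (f' k x) = f k (a k x)) : SeqHomotopyInverse ι' κ' f' where
  inv k y := (a k).symm (e.inv k (b k y))
  continuous_inv k := (a k).symm.continuous.comp ((e.continuous_inv k).comp (b k).continuous)
  inv_map k y := by
    rw [hb, e.inv_map, Homeomorph.symm_apply_eq, ha, Homeomorph.apply_symm_apply]
  left k p := (a k).symm (e.left k (a k p.1, p.2))
  continuous_left k := (a k).symm.continuous.comp ((e.continuous_left k).comp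
    (((a k).continuous.comp continuous_fst).prodMk continuous_snd))
  left_map k x t := by
    rw [ha, e.left_map, Homeomorph.symm_apply_eq, ha, Homeomorph.apply_symm_apply]
  left_zero k x := by rw [e.left_zero, Homeomorph.symm_apply_apply]
  left_one k x := by rw [e.left_one, hf]
  right k p := (b k).symm (e.right k (b k p.1, p.2))
  continuous_right k := (b k).symm.continuous.comp ((e.continuous_right k).comp
    (((b k).continuous.comp continuous_fst).prodMk continuous_snd))
  right_map k y t := by
    rw [hb, e.right_map, Homeomorph.symm_apply_eq, hb, Homeomorph.apply_symm_apply]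
  right_zero k y := by rw [e.right_zero, Homeomorph.symm_apply_apply]
  right_one k y := by
    rw [e.right_one, Homeomorph.symm_apply_eq, hf, Homeomorph.apply_symm_apply]

section

variable {m : ℕ} (hm : 1 ≤ m) {z : ℂ} (hz : z.im ≠ 0) {N : ℕ → ℕ}

/-- Under `homeoD` and `homeoRat` both stabilizations become inclusions of sets of functions and `P`
becomes normalization, so the inverse for `affineModel` can be transported. -/
theorem nonempty_seqHomotopyInverse_P (hN : ∀ i, N (i + 1) = N i + 2)
    {ι : ∀ k, D (N k) m → D (N (k + 1)) m}
    {κ : ∀ k, Rat (N k) m → Rat (N (k + 1)) m} (hι : ∀ k d, phi z hz (ι k d) = phi z hz d)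
    (hκ : ∀ k γ, (homeoRat _ hm hz (κ k γ) : C(Seg, Euc m)) = homeoRat _ hm hz γ) :
    Nonempty (SeqHomotopyInverse (X := fun k => D (N k) m) (Y := fun k => Rat (N k) m) ι κ
      fun k => P hm (N k)) := by
  obtain ⟨s, hs⟩ := (affineModel hN m hz).exists_isSelection fun i => by
    obtain ⟨Z, hZ, h⟩ := exists_isClosed_sphere (N i) hm hz
    refine ⟨Z, hZ, ?_⟩
    rw [← hN] at h
    exact h
  exact ⟨((affineModel hN m hz).seqHomotopyInverse hs).congr
    (X' := fun k => D (N k) m) (Y' := fun k => Rat (N k) m)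
    (fun k => homeoD (N k) m hz) (fun k => homeoRat (N k) hm hz)
    (fun k d => Subtype.ext (hι k d)) (fun k γ => Subtype.ext (hκ k γ))
    fun k d => Subtype.ext (homeoRat_P hm d)⟩

/-- Under `homeoD` the fibres of the quotient map `R` are those of `oddType`, so the inverse for
`fibredModel` can be transported. -/
theorem nonempty_seqHomotopyInverse_R (hN : ∀ i, N (i + 1) = N i + 2)
    {ι : ∀ k, D (N k) m → D (N (k + 1)) m}
    {κ : ∀ k, T (N k) m → T (N (k + 1)) m} (hι : ∀ k d, phi z hz (ι k d) = phi z hz d)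
    (hκ : ∀ k d, R hm _ (ι k d) = κ k (R hm _ d)) :
    Nonempty (SeqHomotopyInverse (X := fun k => D (N k) m) (Y := fun k => T (N k) m) ι κ
      fun k => R hm (N k)) := by
  refine ⟨((fibredModel hN m hz).seqHomotopyInverse (T := fun k => T (N k) m) κ
    (fun k f => R hm (N k) ((homeoD (N k) m hz).symm f)) (fun k => ?_) (fun k f g => ?_)
    fun k f => ?_).congr
    (X' := fun k => D (N k) m) (Y' := fun k => T (N k) m)
    (fun k => homeoD (N k) m hz) (fun k => Homeomorph.refl _)
    (fun k d => Subtype.ext (hι k d)) (fun k γ => rfl) fun k d => ?_⟩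
  · exact (isQuotientMap_R hm).comp (homeoD (N k) m hz).symm.isQuotientMap
  · obtain ⟨d, rfl⟩ := (homeoD (N k) m hz).surjective f
    obtain ⟨e, rfl⟩ := (homeoD (N k) m hz).surjective g
    rw [Homeomorph.symm_apply_apply, Homeomorph.symm_apply_apply, R_eq_R_iff, ← funext_iff]
    change _ ↔ oddType hz (phi z hz d) = oddType hz (phi z hz e)
    rw [oddType_phi, oddType_phi]
  · obtain ⟨d, rfl⟩ := (homeoD (N k) m hz).surjective f
    rw [Homeomorph.symm_apply_apply, ← hκ]
    congr 1
    exact (Homeomorph.symm_apply_eq _).2 (Subtype.ext (hι k d).symm)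
  · exact congrArg (R hm (N k)) ((homeoD (N k) m hz).symm_apply_apply d).symm

end

section

variable {m : ℕ} (hm : 1 ≤ m) (z : ℂ) (hz : z.im ≠ 0)

theorem nonempty_even_P : Nonempty (SeqHomotopyInverse (X := fun k => D (2 * k) m)
    (Y := fun k => Rat (2 * k) m) (fun k => stabD m z hz (2 * k)) (fun k => stabRat hm (2 * k))
    fun k => P hm (2 * k)) :=
  nonempty_seqHomotopyInverse_P hm hz (N := fun k => 2 * k) (fun _ => rfl)
    (fun _ d => phi_stabD d) fun _ γ => homeoRat_stabRat hm γ

theorem nonempty_odd_P : Nonempty (SeqHomotopyInverse (X := fun k => D (2 * k + 1) m)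
    (Y := fun k => Rat (2 * k + 1) m) (fun k => stabD m z hz (2 * k + 1))
    (fun k => stabRat hm (2 * k + 1)) fun k => P hm (2 * k + 1)) :=
  nonempty_seqHomotopyInverse_P hm hz (N := fun k => 2 * k + 1) (fun _ => rfl)
    (fun _ d => phi_stabD d) fun _ γ => homeoRat_stabRat hm γ

theorem nonempty_even_R : Nonempty (SeqHomotopyInverse (X := fun k => D (2 * k) m)
    (Y := fun k => T (2 * k) m) (fun k => stabD m z hz (2 * k)) (fun k => stabT hm (2 * k))
    fun k => R hm (2 * k)) :=
  nonempty_seqHomotopyInverse_R hm hz (N := fun k => 2 * k) (fun _ => rfl)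
    (fun _ d => phi_stabD d) fun _ d => R_stabD hm z hz _ d

theorem nonempty_odd_R : Nonempty (SeqHomotopyInverse (X := fun k => D (2 * k + 1) m)
    (Y := fun k => T (2 * k + 1) m) (fun k => stabD m z hz (2 * k + 1))
    (fun k => stabT hm (2 * k + 1)) fun k => R hm (2 * k + 1)) :=
  nonempty_seqHomotopyInverse_R hm hz (N := fun k => 2 * k + 1) (fun _ => rfl)
    (fun _ d => phi_stabD d) fun _ d => R_stabD hm z hz _ d

theorem isHomotopyEquiv_P (n : ℕ) : IsHomotopyEquiv (P hm n) := by
  rcases Nat.even_or_odd' n with ⟨k, rfl | rfl⟩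
  · obtain ⟨e⟩ := nonempty_even_P hm Complex.I I_im_ne
    exact e.isHomotopyEquiv (fun _ => continuous_P hm) k
  · obtain ⟨e⟩ := nonempty_odd_P hm Complex.I I_im_ne
    exact e.isHomotopyEquiv (fun _ => continuous_P hm) k

theorem isHomotopyEquiv_R (n : ℕ) : IsHomotopyEquiv (R hm n) := by
  rcases Nat.even_or_odd' n with ⟨k, rfl | rfl⟩
  · obtain ⟨e⟩ := nonempty_even_R hm Complex.I I_im_ne
    exact e.isHomotopyEquiv (fun _ => continuous_R hm) k
  · obtain ⟨e⟩ := nonempty_odd_R hm Complex.I I_im_ne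
    exact e.isHomotopyEquiv (fun _ => continuous_R hm) k

theorem isHomotopyEquiv_Q (n : ℕ) : IsHomotopyEquiv (Q hm n) :=
  (isHomotopyEquiv_P hm n).of_comp (isHomotopyEquiv_R hm n) (continuous_Q hm) (Q_P hm n)

theorem isHomotopyEquiv_PInf : IsHomotopyEquiv (PInf hm z hz) := by
  obtain ⟨e⟩ := nonempty_even_P hm z hz
  obtain ⟨e'⟩ := nonempty_odd_P hm z hz
  exact (e.isHomotopyEquiv_lim (fun _ => continuous_P hm) fun _ => P_stabD hm z hz _).sumMap
    (e'.isHomotopyEquiv_lim (fun _ => continuous_P hm) fun _ => P_stabD hm z hz _)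

/-- The map from divisors to mod 2 particles for `n = ∞`. -/
noncomputable def RInf : DInf m z hz → TInf hm := Stable.map (R hm) (R_stabD hm z hz)

theorem isHomotopyEquiv_RInf : IsHomotopyEquiv (RInf hm z hz) := by
  obtain ⟨e⟩ := nonempty_even_R hm z hz
  obtain ⟨e'⟩ := nonempty_odd_R hm z hz
  exact (e.isHomotopyEquiv_lim (fun _ => continuous_R hm) fun _ => R_stabD hm z hz _).sumMap
    (e'.isHomotopyEquiv_lim (fun _ => continuous_R hm) fun _ => R_stabD hm z hz _)

theorem QInf_PInf (x : DInf m z hz) : QInf hm (PInf hm z hz x) = RInf hm z hz x := by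
  rcases x with ⟨k, d⟩ | ⟨k, d⟩
  · exact congrArg (fun y => (Sum.inl (SeqLim.of (fun k => stabT hm (2 * k)) k y) :
      Stable (fun n => T n m) (stabT hm))) (Q_P hm (2 * k) d)
  · exact congrArg (fun y => (Sum.inr (SeqLim.of (fun k => stabT hm (2 * k + 1)) k y) :
      Stable (fun n => T n m) (stabT hm))) (Q_P hm (2 * k + 1) d)

theorem continuous_QInf : Continuous (QInf hm) :=
  (SeqLim.continuous_map _ (fun _ => continuous_Q hm) _).sumMap
    (SeqLim.continuous_map _ (fun _ => continuous_Q hm) _)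

/-- `QInf` does not involve `z`, so factoring through the divisors stabilized by the imaginary unit
suffices. -/
theorem isHomotopyEquiv_QInf : IsHomotopyEquiv (QInf hm) :=
  (isHomotopyEquiv_PInf hm Complex.I I_im_ne).of_comp
    (isHomotopyEquiv_RInf hm Complex.I I_im_ne) (continuous_QInf hm)
    (QInf_PInf hm Complex.I I_im_ne)

end

end RationalLoops

theorem mainTheorem4 (m : ℕ) (hm : 1 ≤ m) :
    (∀ n : ℕ, RationalLoops.IsHomotopyEquiv (RationalLoops.P hm n) ∧
      RationalLoops.IsHomotopyEquiv (RationalLoops.Q hm n)) ∧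
    (∀ (z : ℂ) (hz : z.im ≠ 0),
      RationalLoops.IsHomotopyEquiv (RationalLoops.PInf hm z hz)) ∧
    RationalLoops.IsHomotopyEquiv (RationalLoops.QInf hm) :=
  ⟨fun n => ⟨RationalLoops.isHomotopyEquiv_P hm n, RationalLoops.isHomotopyEquiv_Q hm n⟩,
    fun z hz => RationalLoops.isHomotopyEquiv_PInf hm z hz, RationalLoops.isHomotopyEquiv_QInf hm⟩
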